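/- Let $\mathcal X,\mathcal Y$ be (real or complex) Hilbert spaces and let $F:\mathcal D(F)\subset\mathcal X\to\mathcal Y$ be Fréchet differentiable, with derivative $F'(x)$ and adjoint $F'(x)^*$. Let $x^\dagger\in\mathcal D(F)$, $y=F(x^\dagger)$, and suppose that for some $\rho>0$, $K_0\ge 0$ and $\Theta<1$ the closed ball $B_\rho(x^\dagger)$ of radius $\rho$ around $x^\dagger$ is contained in $\mathcal D(F)$ and $$\|[F'(x)-F'(z)]h\|\le K_0\|x-z\|\,\|F'(z)h\|,\qquad \|F'(x)\|\le\Theta\qquad\text{for all }x,z\in B_\rho(x^\dagger),\ h\in\mathcal X .$$ Let $\tau>2$ and $0<\eta<1$ with $\tau\eta>2$, and let $x_0\in B_\rho(x^\dagger)$. For $\delta>0$ and data $y^\delta\in\mathcal Y$ with $\|y^\delta-y\|\le\delta$, consider the inexact Newton method $x_{n+1}=x_n+u_n(t_n)$, where $$u_n(t)=g_t\big(F'(x_n)^*F'(x_n)\big)F'(x_n)^*\big(y^\delta-F(x_n)\big),$$ $t_n$ is the smallest number $t_n>0$ such that $$\|y^\delta-F(x_n)-F'(x_n)u_n(t_n)\|\le\eta\|y^\delta-F(x_n)\|,$$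 and the iteration is stopped at the first index $n_\delta$ with $\|y^\delta-F(x_{n_\delta})\|\le\tau\delta$. The inner scheme is one of the following four: $g_t(\lambda)=\sum_{j=0}^{[t]-1}(1-\lambda)^j$ (Landweber iteration), $g_t(\lambda)=\sum_{j=1}^{[t]}(1+\lambda)^{-j}$ (implicit iteration), $g_t(\lambda)=\frac1\lambda(1-e^{-t\lambda})$, with $g_t(0)=t$ (asymptotic regularization), or $g_t(\lambda)=(\frac1t+\lambda)^{-1}$ (Tikhonov regularization), where $[t]$ is the integer part of $t$. (i) There is $\varepsilon>0$, depending only on $\mathcal X,\mathcal Y,\tau,\eta,\Theta$, such that if $K_0\|x_0-x^\dagger\|\le\varepsilon$, then all four methods are well-defined (all $t_n$, $0\le n<n_\delta$, exist and all iterates $x_n$, $0\le n\le n_\delta$, lie in $\mathcal D(F)$) and terminate after $n_\delta\le C(1+|\log\delta|)$ iterations, where $C$ does not depend on $\delta$ and $y^\delta$. (ii) For every $0<\mu\le\frac12$ there are $\varepsilon'>0$ and $C>0$, depending only on $\mathcal X,\mathcal Y,\tau,\eta,\Theta,\mu$ (in particular independent of $\delta$ and $\|\omega\|$), such that if, in addition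 to the condition in (i), $x_0-x^\dagger=(F'(x^\dagger)^*F'(x^\dagger))^\mu\omega$ for some $\omega\in\mathcal N(F'(x^\dagger))^\perp$ with $K_0\|\omega\|\le\varepsilon'$, then for all four methods $$\|x_{n_\delta}-x^\dagger\|\le C\,\|\omega\|^{\frac1{1+2\mu}}\,\delta^{\frac{2\mu}{1+2\mu}} .$$ -/

import Mathlib

open Set Metric Polynomial
open scoped InnerProductSpace

namespace InexactNewton

/-- `G = f(B)` for a bounded positive self-adjoint operator `B` on a real or complex Hilbert space
and a continuous `f : [0, ‖B‖] → ℝ`: the graph of the continuous functional calculus. `G` is the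
norm limit of `p(B)` along real polynomials `p` converging to `f` uniformly on `[0, ‖B‖]`,
an interval that contains the spectrum of `B`. -/
def IsFunctionOf {𝕜 X : Type*} [RCLike 𝕜] [NormedAddCommGroup X] [InnerProductSpace 𝕜 X]
    (B : X →L[𝕜] X) (f : ℝ → ℝ) (G : X →L[𝕜] X) : Prop :=
  ∀ ε : ℝ, 0 < ε → ∃ p : ℝ[X], (∀ l ∈ Icc (0 : ℝ) ‖B‖, |p.eval l - f l| ≤ ε) ∧
    ‖aeval B (p.map (algebraMap ℝ 𝕜)) - G‖ ≤ ε

open Classical in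
/-- The operator `f(B)` given by the continuous functional calculus. -/
noncomputable def opFun {𝕜 X : Type*} [RCLike 𝕜] [NormedAddCommGroup X] [InnerProductSpace 𝕜 X]
    (f : ℝ → ℝ) (B : X →L[𝕜] X) : X →L[𝕜] X :=
  if h : ∃ G, IsFunctionOf B f G then h.choose else 0

/-- The four linear regularization methods used as inner schemes. -/
inductive InnerScheme where
  | landweber
  | implicitIteration
  | asymptotic
  | tikhonov

/-- The spectral filter functions `g_t(l)`. The function `(1 - exp (-t l)) / l` of the asymptotic
regularization takes its limit value `t` at `l = 0`. -/
noncomputable def spectralFilter : InnerScheme → ℝ → ℝ → ℝ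
  | .landweber, t, l => ∑ j ∈ Finset.range ⌊t⌋₊, (1 - l) ^ j
  | .implicitIteration, t, l => ∑ j ∈ Finset.Icc 1 ⌊t⌋₊, ((1 + l) ^ j)⁻¹
  | .asymptotic, t, l => if l = 0 then t else (1 - Real.exp (-(t * l))) / l
  | .tikhonov, t, l => (1 / t + l)⁻¹

section

variable {𝕜 X Y : Type*} [RCLike 𝕜]
  [NormedAddCommGroup X] [InnerProductSpace 𝕜 X] [CompleteSpace X]
  [NormedAddCommGroup Y] [InnerProductSpace 𝕜 Y] [CompleteSpace Y]

/-- The positive self-adjoint operator `T* T`. -/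
noncomputable def gram (T : X →L[𝕜] Y) : X →L[𝕜] X :=
  (ContinuousLinearMap.adjoint T).comp T

/-- The regularized solution `g_t(T* T) T* r` of the linear equation `T u = r`. -/
noncomputable def innerSolution (m : InnerScheme) (T : X →L[𝕜] Y) (r : Y) (t : ℝ) : X :=
  opFun (spectralFilter m t) (gram T) (ContinuousLinearMap.adjoint T r)

/-- `F : D → Y` is Fréchet differentiable with derivative `F'`, the ball `B_ρ(x†)` lies in `D`,
and on that ball `F'` satisfies the Newton–Mysovskii condition with constant `K₀` and the
scaling `‖F'(x)‖ ≤ Θ`. -/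
structure NewtonMysovskii (D : Set X) (F : X → Y) (F' : X → X →L[𝕜] Y) (xd : X)
    (ρ K₀ Θ : ℝ) : Prop where
  hasDeriv : ∀ x ∈ D, HasFDerivWithinAt F (F' x) D x
  radius_pos : 0 < ρ
  ball_subset : closedBall xd ρ ⊆ D
  const_nonneg : 0 ≤ K₀
  bound : ∀ x ∈ closedBall xd ρ, ∀ z ∈ closedBall xd ρ, ∀ h : X,
    ‖(F' x - F' z) h‖ ≤ K₀ * ‖x - z‖ * ‖F' z h‖
  scaled : ∀ x ∈ closedBall xd ρ, ‖F' x‖ ≤ Θ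

/-- The inexact Newton method with inner scheme `m`, started at `x₀` with the data `yδ`, runs
through the iterates `x 0, …, x N` in `D` with inner stopping parameters `t 0, …, t (N - 1)`, and
the discrepancy principle stops it at the index `N`. -/
structure IsRun (m : InnerScheme) (D : Set X) (F : X → Y) (F' : X → X →L[𝕜] Y)
    (τ η δ : ℝ) (yδ : Y) (x₀ : X) (N : ℕ) (x : ℕ → X) (t : ℕ → ℝ) : Prop where
  start : x 0 = x₀
  mem_domain : ∀ n ≤ N, x n ∈ D
  continues : ∀ n < N, τ * δ < ‖yδ - F (x n)‖
  stops : ‖yδ - F (x N)‖ ≤ τ * δ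
  inner_stop : ∀ n < N, IsLeast
    {s : ℝ | 0 < s ∧
      ‖yδ - F (x n) - F' (x n) (innerSolution m (F' (x n)) (yδ - F (x n)) s)‖
        ≤ η * ‖yδ - F (x n)‖} (t n)
  step : ∀ n < N, x (n + 1) = x n + innerSolution m (F' (x n)) (yδ - F (x n)) (t n)

end

end InexactNewton

/-! With `T = F'(x_n)`, `r = y^δ - F(x_n)` and `H = T T*`, all four inner schemes integrate the same
dual equation `v' = r - H v`, and the update is `T* v`: asymptotic regularization is the exact flow,
Landweber and implicit iteration are the explicit and implicit Euler methods with unit steps,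
Tikhonov is a single implicit step of length `t`. `InnerPath` encodes such motions, so every
estimate is proved once, through `InnerPath.energy`, for a quantity `‖z0 + G v‖ ^ 2`.

For `z0 = x_n - x†` and `G = T*` this quantity is the squared error. Noise and linearization error
stay below `η / 2 * ‖r‖`, so before stopping the residual dominates and the error loses a multiple
of `t ‖r‖ ^ 2` (`InnerPath.norm_sq_add_le`). Hence the inner stopping times exist, the iterates stay
in the ball, and the outer residuals contract geometrically, which gives the logarithmic iteration
count.

For the rate, put `A = F'(x†)`, `B = A* A`, `κ = K₀ ‖x_n - x†‖` and `x_n - x† = B^μ ω_n`. The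
Newton–Mysovskii condition gives `T = (1 + Q) A` with `‖Q‖ ≤ κ`, so `T*` factors through `B^μ`, and
the source element moves by `z' = -B z + B^(1/2-μ) ξ` with `ξ` of size `δ + κ ‖r‖`
(`exists_source_dynamics`). The term `-B z` absorbs part of the forcing; with `α = 1 / (1 + 2 μ)`,
the quantity `‖ω_n‖ ^ (2 α)` grows by at most a multiple of `t (δ + κ ‖r‖) ^ (2 α)`
(`InnerPath.exists_source`).

Over a whole run this is growth by a bounded factor (`source_bounded`): the part with `κ ‖r‖`
telescopes against the decrease of the error, and the part with `δ` is controlled by the potential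
`v / (v + E)`. The discrepancy principle makes `‖A (x_N - x†)‖` of order `δ`, and interpolating with
the bounded source element gives the rate. -/

namespace InexactNewton

/-! ### Continuous functional calculus of a positive operator. -/

section FunctionalCalculus

variable {𝕜 Z : Type*} [RCLike 𝕜] [NormedAddCommGroup Z] [InnerProductSpace 𝕜 Z]

/-- A real polynomial evaluated at an operator. -/
noncomputable def polyOp (B : Z →L[𝕜] Z) (p : ℝ[X]) : Z →L[𝕜] Z :=
  aeval B (p.map (algebraMap ℝ 𝕜))

lemma polyOp_mul (B : Z →L[𝕜] Z) (p q : ℝ[X]) : polyOp B (p * q) = polyOp B p * polyOp B q := by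
  simp [polyOp]

lemma polyOp_sub (B : Z →L[𝕜] Z) (p q : ℝ[X]) : polyOp B (p - q) = polyOp B p - polyOp B q := by
  simp [polyOp]

lemma polyOp_add (B : Z →L[𝕜] Z) (p q : ℝ[X]) : polyOp B (p + q) = polyOp B p + polyOp B q := by
  simp [polyOp]

lemma polyOp_X (B : Z →L[𝕜] Z) : polyOp B X = B := by simp [polyOp]

lemma polyOp_C_apply (B : Z →L[𝕜] Z) (a : ℝ) (x : Z) : polyOp B (C a) x = (a : 𝕜) • x := by
  simp [polyOp, Algebra.algebraMap_eq_smul_one]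

lemma isSymmetric_polyOp {B : Z →L[𝕜] Z} (hB : B.IsPositive) (p : ℝ[X]) (x y : Z) :
    ⟪polyOp B p x, y⟫_𝕜 = ⟪x, polyOp B p y⟫_𝕜 := by
  induction p using Polynomial.induction_on generalizing x y with
  | C a => simp [polyOp_C_apply, inner_smul_left, inner_smul_right]
  | add p q hp hq => simp [polyOp_add, inner_add_left, inner_add_right, hp, hq]
  | monomial n a ih =>
    have hX : ∀ x, polyOp B (C a * X ^ (n + 1)) x = polyOp B (C a * X ^ n) (B x) := fun x => by
      rw [pow_succ, ← mul_assoc, polyOp_mul, polyOp_X]; rfl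
    have hX' : ∀ x, polyOp B (C a * X ^ (n + 1)) x = B (polyOp B (C a * X ^ n) x) := fun x => by
      rw [pow_succ', mul_left_comm, polyOp_mul, polyOp_X]; rfl
    rw [hX, hX', ih]
    exact hB.1 _ _

lemma re_inner_nonneg {B : Z →L[𝕜] Z} (hB : B.IsPositive) (x : Z) :
    0 ≤ RCLike.re ⟪B x, x⟫_𝕜 := hB.2 x

/-- For `l < 0` positivity of `B` gives the bound through the quadratic form; for `l > ‖B‖` the
triangle inequality does. -/
lemma norm_lower_linear {B : Z →L[𝕜] Z} (hB : B.IsPositive) {l : ℝ} (hl : l ∉ Icc (0 : ℝ) ‖B‖) :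
    ∃ c : ℝ, 0 < c ∧ ∀ x, c * ‖x‖ ≤ ‖B x - (l : 𝕜) • x‖ := by
  rcases lt_or_ge l 0 with h | h
  · refine ⟨-l, by linarith, fun x => ?_⟩
    rcases eq_or_ne x 0 with rfl | hx
    · simp
    have h1 : -l * ‖x‖ ^ 2 ≤ RCLike.re ⟪B x - (l : 𝕜) • x, x⟫_𝕜 := by
      rw [inner_sub_left, inner_smul_left, map_sub]
      have h3 : RCLike.re ((starRingEnd 𝕜) (l : 𝕜) * ⟪x, x⟫_𝕜) = l * ‖x‖ ^ 2 := by
        rw [RCLike.conj_ofReal, RCLike.re_ofReal_mul, inner_self_eq_norm_sq]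
      rw [h3]
      have := re_inner_nonneg hB x
      linarith
    have h2 : RCLike.re ⟪B x - (l : 𝕜) • x, x⟫_𝕜 ≤ ‖B x - (l : 𝕜) • x‖ * ‖x‖ :=
      re_inner_le_norm _ _
    have hx' : 0 < ‖x‖ := norm_pos_iff.2 hx
    exact le_of_mul_le_mul_right (by nlinarith) hx'
  · have h' : ‖B‖ < l := by
      by_contra h''
      exact hl ⟨h, not_lt.1 h''⟩
    refine ⟨l - ‖B‖, by linarith, fun x => ?_⟩
    have h1 : ‖(l : 𝕜) • x‖ = l * ‖x‖ := by
      rw [norm_smul, RCLike.norm_ofReal, abs_of_nonneg h]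
    have h2 := norm_sub_norm_le ((l : 𝕜) • x) (B x)
    rw [norm_sub_rev] at h2
    have h3 := B.le_opNorm x
    linarith

/-- `S = B - a` is symmetric, so the quadratic form of `S ^ 2 + d` at `x` is `‖S x‖ ^ 2 + d ‖x‖ ^
2`. -/
lemma norm_lower_quadratic {B : Z →L[𝕜] Z} (hB : B.IsPositive) (a d : ℝ)
    (x : Z) : d * ‖x‖ ≤ ‖polyOp B ((X - C a) ^ 2 + C d) x‖ := by
  rcases eq_or_ne x 0 with rfl | hx
  · simp
  set S := polyOp B (X - C a) with hS
  have h0 : polyOp B ((X - C a) ^ 2 + C d) x = S (S x) + (d : 𝕜) • x := by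
    rw [polyOp_add, sq, polyOp_mul, add_apply, polyOp_C_apply]; rfl
  have h1 : d * ‖x‖ ^ 2 ≤ RCLike.re ⟪S (S x) + (d : 𝕜) • x, x⟫_𝕜 := by
    rw [inner_add_left, inner_smul_left, map_add, RCLike.conj_ofReal, RCLike.re_ofReal_mul,
      inner_self_eq_norm_sq, hS, isSymmetric_polyOp hB, inner_self_eq_norm_sq]
    have := sq_nonneg ‖polyOp B (X - C a) x‖
    linarith
  have h2 := re_inner_le_norm (𝕜 := 𝕜) (S (S x) + (d : 𝕜) • x) x
  have hx' : 0 < ‖x‖ := norm_pos_iff.2 hx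
  rw [h0]
  exact le_of_mul_le_mul_right (by nlinarith) hx'

lemma norm_lower_irreducible {B : Z →L[𝕜] Z} (hB : B.IsPositive) {q : ℝ[X]} (hq : Irreducible q)
    (hroot : ∀ l ∈ Icc (0 : ℝ) ‖B‖, q.eval l ≠ 0) :
    ∃ c : ℝ, 0 < c ∧ ∀ x, c * ‖x‖ ≤ ‖polyOp B q x‖ := by
  have hdeg := hq.natDegree_le_two
  by_cases h1 : q.natDegree ≤ 1
  · obtain ⟨a, b, rfl⟩ := exists_eq_X_add_C_of_natDegree_le_one h1
    have ha : a ≠ 0 := by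
      rintro rfl
      apply hq.not_isUnit
      have hb : b ≠ 0 := by
        rintro rfl
        exact hq.ne_zero (by simp)
      simpa using hb
    have hl : -b / a ∉ Icc (0 : ℝ) ‖B‖ := fun h => hroot _ h (by simp; field_simp; ring)
    obtain ⟨c, hc, h⟩ := norm_lower_linear hB hl
    refine ⟨|a| * c, by positivity, fun x => ?_⟩
    have : polyOp B (C a * X + C b) x = (a : 𝕜) • (B x - ((-b / a : ℝ) : 𝕜) • x) := by
      rw [polyOp_add, polyOp_mul, polyOp_X, add_apply, polyOp_C_apply, smul_sub, smul_smul,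
        mul_apply_eq_comp, polyOp_C_apply, ← RCLike.ofReal_mul,
        mul_div_cancel₀ _ ha]
      simp
    rw [this, norm_smul, RCLike.norm_ofReal, mul_assoc]
    exact mul_le_mul_of_nonneg_left (h x) (abs_nonneg a)
  · have h2 : q.natDegree = 2 := by omega
    have hform := eq_quadratic_of_degree_le_two (degree_le_of_natDegree_le hdeg)
    set a := q.coeff 2 with ha'
    set b := q.coeff 1
    set c := q.coeff 0
    have ha : a ≠ 0 := by
      rw [ha', ← h2]
      exact leadingCoeff_ne_zero.2 hq.ne_zero
    have hnoroot : ∀ l, q.eval l ≠ 0 := fun l hl => by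
      have hdvd : X - C l ∣ q := dvd_iff_isRoot.2 hl
      have := degree_eq_one_of_irreducible_of_root hq hl
      rw [degree_eq_natDegree hq.ne_zero, h2] at this
      norm_num at this
    have hd : 0 < c / a - (b / (2 * a)) ^ 2 := by
      by_contra hneg
      push Not at hneg
      set s := Real.sqrt (-(c / a - (b / (2 * a)) ^ 2))
      have hs : s ^ 2 = -(c / a - (b / (2 * a)) ^ 2) := Real.sq_sqrt (by linarith)
      apply hnoroot (-(b / (2 * a)) + s)
      rw [hform]
      simp only [eval_add, eval_mul, eval_C, eval_pow, eval_X]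
      have : a * (-(b / (2 * a)) + s) ^ 2 + b * (-(b / (2 * a)) + s) + c
        = a * (s ^ 2 + (c / a - (b / (2 * a)) ^ 2)) := by field_simp; ring
      rw [this, hs]; ring
    refine ⟨|a| * (c / a - (b / (2 * a)) ^ 2), by positivity, fun x => ?_⟩
    have hq' : q = C a * ((X - C (-(b / (2 * a)))) ^ 2 + C (c / a - (b / (2 * a)) ^ 2)) := by
      apply Polynomial.funext
      intro l
      rw [hform]
      simp only [eval_add, eval_sub, eval_mul, eval_C, eval_pow, eval_X]
      field_simp
      ring
    rw [hq', polyOp_mul, mul_apply_eq_comp, polyOp_C_apply, norm_smul,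
      RCLike.norm_ofReal, mul_assoc]
    exact mul_le_mul_of_nonneg_left (norm_lower_quadratic hB _ _ x) (abs_nonneg a)

/-- This plays the role of spectral mapping: a real polynomial splits into linear and quadratic
irreducible factors, and lower bounds multiply. -/
lemma norm_lower_polyOp {B : Z →L[𝕜] Z} (hB : B.IsPositive) (q : ℝ[X]) :
    q ≠ 0 → (∀ l ∈ Icc (0 : ℝ) ‖B‖, q.eval l ≠ 0) →
      ∃ c : ℝ, 0 < c ∧ ∀ x, c * ‖x‖ ≤ ‖polyOp B q x‖ := by
  induction q using WfDvdMonoid.induction_on_irreducible with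
  | zero => exact fun h => (h rfl).elim
  | unit u hu =>
    intro _ _
    obtain ⟨a, ha, rfl⟩ := Polynomial.isUnit_iff.1 hu
    refine ⟨|a|, by simpa using ha.ne_zero, fun x => ?_⟩
    rw [polyOp_C_apply, norm_smul, RCLike.norm_ofReal]
  | mul q i hq hi ih =>
    intro h0 hroot
    obtain ⟨c, hc, h⟩ := ih hq fun l hl h => hroot l hl (by simp [h])
    obtain ⟨c', hc', h'⟩ := norm_lower_irreducible hB hi fun l hl h => hroot l hl (by simp [h])
    refine ⟨c' * c, by positivity, fun x => ?_⟩
    rw [polyOp_mul, mul_apply_eq_comp, mul_assoc]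
    exact (mul_le_mul_of_nonneg_left (h x) hc'.le).trans (h' _)

/-- The spectral bound for real polynomials of a positive operator. -/
lemma norm_polyOp_le {B : Z →L[𝕜] Z} (hB : B.IsPositive) (p : ℝ[X]) {M : ℝ}
    (hM : ∀ l ∈ Icc (0 : ℝ) ‖B‖, |p.eval l| ≤ M) : ‖polyOp B p‖ ≤ M := by
  by_contra hlt
  push Not at hlt
  set S := polyOp B p with hS
  set m := ‖S‖ with hm
  have hM0 : 0 ≤ M := (abs_nonneg _).trans (hM 0 ⟨le_rfl, norm_nonneg _⟩)
  have hmpos : 0 < m := hM0.trans_lt hlt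
  -- As `m > M`, the polynomial `m ^ 2 - p ^ 2` has no root on the interval, so `m ^ 2 - S ^ 2` is
  -- bounded below by some `c`. Expanding its squared norm gives `‖S‖ ^ 2 ≤ m ^ 2 - c ^ 2 / m ^ 2`,
  -- against `m = ‖S‖`.
  have hroot : ∀ l ∈ Icc (0 : ℝ) ‖B‖, (C (m ^ 2) - p * p).eval l ≠ 0 := by
    intro l hl h
    simp only [eval_sub, eval_C, eval_mul] at h
    have h1 := hM l hl
    have h2 : |p.eval l| ^ 2 = m ^ 2 := by rw [sq_abs]; linarith
    have h3 : |p.eval l| = m := (pow_left_inj₀ (abs_nonneg _) hmpos.le two_ne_zero).1 h2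
    linarith
  have hne : C (m ^ 2) - p * p ≠ 0 := fun h =>
    hroot 0 ⟨le_rfl, norm_nonneg _⟩ (by rw [h]; simp)
  obtain ⟨c, hc, h⟩ := norm_lower_polyOp hB _ hne hroot
  have key : ∀ x, ‖S x‖ ^ 2 ≤ (m ^ 2 - c ^ 2 / m ^ 2) * ‖x‖ ^ 2 := by
    intro x
    have h1 := h x
    have h2 : polyOp B (C (m ^ 2) - p * p) x = ((m ^ 2 : ℝ) : 𝕜) • x - S (S x) := by
      rw [polyOp_sub, polyOp_mul, sub_apply, polyOp_C_apply]; rfl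
    rw [h2] at h1
    have h3 : ‖((m ^ 2 : ℝ) : 𝕜) • x - S (S x)‖ ^ 2
        = m ^ 4 * ‖x‖ ^ 2 - 2 * (m ^ 2 * ‖S x‖ ^ 2) + ‖S (S x)‖ ^ 2 := by
      rw [norm_sub_sq (𝕜 := 𝕜), norm_smul, RCLike.norm_ofReal, abs_of_nonneg (by positivity),
        inner_smul_left, RCLike.conj_ofReal, RCLike.re_ofReal_mul, ← isSymmetric_polyOp hB,
        ← hS, inner_self_eq_norm_sq]
      ring
    have h4 : ‖S (S x)‖ ≤ m * ‖S x‖ := S.le_opNorm _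
    have h5 : ‖S (S x)‖ ^ 2 ≤ (m * ‖S x‖) ^ 2 := pow_le_pow_left₀ (norm_nonneg _) h4 2
    have h6 : (c * ‖x‖) ^ 2 ≤ ‖((m ^ 2 : ℝ) : 𝕜) • x - S (S x)‖ ^ 2 :=
      pow_le_pow_left₀ (by positivity) h1 2
    have h7 : c ^ 2 * ‖x‖ ^ 2 ≤ m ^ 2 * (m ^ 2 * ‖x‖ ^ 2 - ‖S x‖ ^ 2) := by nlinarith
    have h8 : c ^ 2 / m ^ 2 * ‖x‖ ^ 2 ≤ m ^ 2 * ‖x‖ ^ 2 - ‖S x‖ ^ 2 := by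
      rw [div_mul_eq_mul_div, div_le_iff₀ (by positivity)]
      linarith
    linarith
  set k := m ^ 2 - c ^ 2 / m ^ 2 with hk
  have hle : m ≤ Real.sqrt k := by
    refine S.opNorm_le_bound (Real.sqrt_nonneg _) fun x => ?_
    rw [← Real.sqrt_sq (norm_nonneg x), ← Real.sqrt_mul' _ (sq_nonneg _)]
    exact Real.le_sqrt_of_sq_le (key x)
  have hk0 : 0 < k := Real.sqrt_pos.1 (hmpos.trans_le hle)
  have h9 := pow_le_pow_left₀ hmpos.le hle 2
  rw [Real.sq_sqrt hk0.le] at h9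
  have : 0 < c ^ 2 / m ^ 2 := by positivity
  linarith

variable {B : Z →L[𝕜] Z} {f g : ℝ → ℝ} {G G' : Z →L[𝕜] Z}

lemma IsFunctionOf.exists_polyOp (h : IsFunctionOf B f G) {ε : ℝ} (hε : 0 < ε) :
    ∃ p : ℝ[X], (∀ l ∈ Icc (0 : ℝ) ‖B‖, |p.eval l - f l| ≤ ε) ∧ ‖polyOp B p - G‖ ≤ ε := h ε hε

lemma IsFunctionOf.norm_le (hB : B.IsPositive) (h : IsFunctionOf B f G) {M : ℝ}
    (hM : ∀ l ∈ Icc (0 : ℝ) ‖B‖, |f l| ≤ M) : ‖G‖ ≤ M := by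
  refine le_of_forall_pos_le_add fun ε hε => ?_
  obtain ⟨p, hp, hG⟩ := h.exists_polyOp (half_pos hε)
  have h1 : ‖polyOp B p‖ ≤ M + ε / 2 := norm_polyOp_le hB p fun l hl => by
    have h2 := abs_add_le (p.eval l - f l) (f l)
    rw [sub_add_cancel] at h2
    linarith [hp l hl, hM l hl]
  have h3 := norm_sub_norm_le G (polyOp B p)
  rw [norm_sub_rev] at h3
  linarith

lemma IsFunctionOf.sub (h : IsFunctionOf B f G) (h' : IsFunctionOf B g G') :
    IsFunctionOf B (fun l => f l - g l) (G - G') := by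
  intro ε hε
  obtain ⟨p, hp, hG⟩ := h.exists_polyOp (half_pos hε)
  obtain ⟨q, hq, hG'⟩ := h'.exists_polyOp (half_pos hε)
  refine ⟨p - q, fun l hl => ?_, ?_⟩
  · rw [eval_sub, show p.eval l - q.eval l - (f l - g l)
      = (p.eval l - f l) - (q.eval l - g l) by ring]
    linarith [abs_sub (p.eval l - f l) (q.eval l - g l), hp l hl, hq l hl]
  · change ‖polyOp B (p - q) - (G - G')‖ ≤ ε
    rw [polyOp_sub, show polyOp B p - polyOp B q - (G - G')
      = (polyOp B p - G) - (polyOp B q - G') by abel]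
    linarith [norm_sub_le (polyOp B p - G) (polyOp B q - G')]

lemma IsFunctionOf.congr (h : IsFunctionOf B f G) (hfg : EqOn f g (Icc 0 ‖B‖)) :
    IsFunctionOf B g G := by
  intro ε hε
  obtain ⟨p, hp, hG⟩ := h ε hε
  exact ⟨p, fun l hl => by rw [← hfg hl]; exact hp l hl, hG⟩

lemma IsFunctionOf.unique (hB : B.IsPositive) (h : IsFunctionOf B f G)
    (h' : IsFunctionOf B f G') : G = G' := by
  have := (h.sub h').norm_le hB (M := 0) (by simp)
  exact sub_eq_zero.1 (norm_le_zero_iff.1 this)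

lemma isFunctionOf_polyOp (p : ℝ[X]) : IsFunctionOf B (fun l => p.eval l) (polyOp B p) :=
  fun ε hε => ⟨p, by simp [hε.le], by simpa [polyOp] using hε.le⟩

lemma IsFunctionOf.opFun_eq (hB : B.IsPositive) (h : IsFunctionOf B f G) : opFun f B = G := by
  have hex : ∃ G, IsFunctionOf B f G := ⟨G, h⟩
  rw [opFun, dif_pos hex]
  exact hex.choose_spec.unique hB h

lemma IsFunctionOf.mul (hB : B.IsPositive) (hf : ContinuousOn f (Icc 0 ‖B‖))
    (hg : ContinuousOn g (Icc 0 ‖B‖)) (h : IsFunctionOf B f G) (h' : IsFunctionOf B g G') :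
    IsFunctionOf B (fun l => f l * g l) (G * G') := by
  obtain ⟨M, hM⟩ := isCompact_Icc.exists_bound_of_continuousOn hf
  obtain ⟨M', hM'⟩ := isCompact_Icc.exists_bound_of_continuousOn hg
  simp only [Real.norm_eq_abs] at hM hM'
  have h0 : (0 : ℝ) ∈ Icc 0 ‖B‖ := ⟨le_rfl, norm_nonneg _⟩
  have hM0 : 0 ≤ M := (abs_nonneg _).trans (hM 0 h0)
  have hM'0 : 0 ≤ M' := (abs_nonneg _).trans (hM' 0 h0)
  intro ε hε
  -- The two product errors are at most `(M + 1) e` and `e M'`; the bound `e ≤ 1` keeps `|p|` below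
  -- `M + 1`.
  set e := min 1 (ε / (M + 1 + M')) with he
  have hepos : 0 < e := lt_min one_pos (by positivity)
  have he1 : e ≤ 1 := min_le_left _ _
  have he2 : (M + 1 + M') * e ≤ ε := by
    have := min_le_right 1 (ε / (M + 1 + M'))
    rw [← he, le_div_iff₀ (by positivity)] at this
    linarith
  obtain ⟨p, hp, hG⟩ := h.exists_polyOp hepos
  obtain ⟨q, hq, hG'⟩ := h'.exists_polyOp hepos
  have hpM : ∀ l ∈ Icc (0 : ℝ) ‖B‖, |p.eval l| ≤ M + 1 := fun l hl => by
    have h2 := abs_add_le (p.eval l - f l) (f l)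
    rw [sub_add_cancel] at h2
    linarith [hp l hl, hM l hl]
  refine ⟨p * q, fun l hl => ?_, ?_⟩
  · rw [eval_mul, show p.eval l * q.eval l - f l * g l
      = p.eval l * (q.eval l - g l) + (p.eval l - f l) * g l by ring]
    refine (abs_add_le _ _).trans ?_
    rw [abs_mul, abs_mul]
    have h1 := mul_le_mul (hpM l hl) (hq l hl) (abs_nonneg _) (by linarith)
    have h2 := mul_le_mul (hp l hl) (hM' l hl) (abs_nonneg _) hepos.le
    nlinarith
  · change ‖polyOp B (p * q) - G * G'‖ ≤ ε
    rw [polyOp_mul, show polyOp B p * polyOp B q - G * G'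
      = polyOp B p * (polyOp B q - G') + (polyOp B p - G) * G' by noncomm_ring]
    refine (norm_add_le _ _).trans ?_
    have h1 := norm_mul_le (polyOp B p) (polyOp B q - G')
    have h2 := norm_mul_le (polyOp B p - G) G'
    have h3 := mul_le_mul (norm_polyOp_le hB p hpM) hG' (norm_nonneg _) (by linarith)
    have h4 := mul_le_mul hG (h'.norm_le hB hM') (norm_nonneg _) hepos.le
    nlinarith

lemma opFun_polynomial (hB : B.IsPositive) (p : ℝ[X]) :
    opFun (fun l => p.eval l) B = polyOp B p := (isFunctionOf_polyOp p).opFun_eq hB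

lemma opFun_id (hB : B.IsPositive) : opFun (fun l => l) B = B := by
  have := opFun_polynomial hB X
  simpa [polyOp_X] using this

lemma opFun_const_apply (hB : B.IsPositive) (a : ℝ) (x : Z) :
    opFun (fun _ => a) B x = (a : 𝕜) • x := by
  have := opFun_polynomial hB (C a)
  simp only [eval_C] at this
  rw [this, polyOp_C_apply]

lemma opFun_one (hB : B.IsPositive) : opFun (fun _ => 1) B = 1 := by
  ext x
  rw [opFun_const_apply hB]
  simp

variable [CompleteSpace Z]

/-- The spectral bound makes `p_n(B)` a Cauchy sequence for Weierstrass approximants `p_n` of `f`.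
So for continuous `f` the default value of `opFun` never occurs. -/
lemma isFunctionOf_opFun (hB : B.IsPositive) (hf : ContinuousOn f (Icc 0 ‖B‖)) :
    IsFunctionOf B f (opFun f B) := by
  have hex : ∃ G, IsFunctionOf B f G := by
    have hpow : ∀ n : ℕ, (0 : ℝ) < (1 / 2) ^ n := fun n => by positivity
    choose p hp using fun n : ℕ => exists_polynomial_near_of_continuousOn 0 ‖B‖ f hf _ (hpow n)
    have hdist : ∀ n, dist (polyOp B (p n)) (polyOp B (p (n + 1))) ≤ 2 * (1 / 2) ^ n := by
      intro n
      rw [dist_eq_norm, ← polyOp_sub]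
      refine norm_polyOp_le hB _ fun l hl => ?_
      have h1 := hp n l hl
      have h2 := hp (n + 1) l hl
      rw [eval_sub, show (p n).eval l - (p (n + 1)).eval l
        = ((p n).eval l - f l) - ((p (n + 1)).eval l - f l) by ring]
      have h3 := abs_sub ((p n).eval l - f l) ((p (n + 1)).eval l - f l)
      rw [pow_succ] at h2
      linarith [hpow n]
    obtain ⟨G, hG⟩ := cauchySeq_tendsto_of_complete
      (cauchySeq_of_le_geometric (1 / 2) 2 (by norm_num) hdist)
    refine ⟨G, fun ε hε => ?_⟩
    have hlim : Filter.Tendsto (fun n : ℕ => ((1 : ℝ) / 2) ^ n) Filter.atTop (nhds 0) :=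
      tendsto_pow_atTop_nhds_zero_of_lt_one (by norm_num) (by norm_num)
    obtain ⟨n, hn1, hn2⟩ := ((hlim.eventually (gt_mem_nhds hε)).and
      (hG.eventually (Metric.ball_mem_nhds G hε))).exists
    refine ⟨p n, fun l hl => ((hp n l hl).trans hn1).le, ?_⟩
    have := Metric.mem_ball.1 hn2
    rw [dist_eq_norm] at this
    exact this.le
  rw [opFun, dif_pos hex]
  exact hex.choose_spec

lemma opFun_congr (hB : B.IsPositive) (hf : ContinuousOn f (Icc 0 ‖B‖))
    (hfg : EqOn f g (Icc 0 ‖B‖)) : opFun g B = opFun f B :=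
  ((isFunctionOf_opFun hB hf).congr hfg).opFun_eq hB

lemma norm_opFun_le (hB : B.IsPositive) (hf : ContinuousOn f (Icc 0 ‖B‖)) {M : ℝ}
    (hM : ∀ l ∈ Icc (0 : ℝ) ‖B‖, |f l| ≤ M) : ‖opFun f B‖ ≤ M :=
  (isFunctionOf_opFun hB hf).norm_le hB hM

lemma opFun_sub (hB : B.IsPositive) (hf : ContinuousOn f (Icc 0 ‖B‖))
    (hg : ContinuousOn g (Icc 0 ‖B‖)) :
    opFun (fun l => f l - g l) B = opFun f B - opFun g B :=
  ((isFunctionOf_opFun hB hf).sub (isFunctionOf_opFun hB hg)).opFun_eq hB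

lemma opFun_add (hB : B.IsPositive) (hf : ContinuousOn f (Icc 0 ‖B‖))
    (hg : ContinuousOn g (Icc 0 ‖B‖)) :
    opFun (fun l => f l + g l) B = opFun f B + opFun g B := by
  have := opFun_sub hB (hf.add hg) hg
  simp only [Pi.add_apply, add_sub_cancel_right] at this
  rw [this]
  change _ = opFun (f + g) B - _ + _
  simp [Pi.add_def]

lemma opFun_mul (hB : B.IsPositive) (hf : ContinuousOn f (Icc 0 ‖B‖))
    (hg : ContinuousOn g (Icc 0 ‖B‖)) :
    opFun (fun l => f l * g l) B = opFun f B * opFun g B :=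
  ((isFunctionOf_opFun hB hf).mul hB hf hg (isFunctionOf_opFun hB hg)).opFun_eq hB

/-- Polynomials in `B` are symmetric, and for fixed vectors symmetry is a closed condition on the
operator. -/
lemma inner_opFun_left (hB : B.IsPositive) (hf : ContinuousOn f (Icc 0 ‖B‖)) (x y : Z) :
    ⟪opFun f B x, y⟫_𝕜 = ⟪x, opFun f B y⟫_𝕜 := by
  have hclosed : IsClosed {G : Z →L[𝕜] Z | ⟪G x, y⟫_𝕜 = ⟪x, G y⟫_𝕜} := by
    refine isClosed_eq ?_ ?_ <;> fun_prop
  refine hclosed.closure_subset (Metric.mem_closure_iff.2 fun ε hε => ?_)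
  obtain ⟨p, -, hp⟩ := (isFunctionOf_opFun hB hf).exists_polyOp (half_pos hε)
  refine ⟨polyOp B p, isSymmetric_polyOp hB p x y, ?_⟩
  rw [dist_comm, dist_eq_norm]
  linarith

/-- `opFun f B` is the square of the symmetric operator given by `√f`. -/
lemma re_inner_opFun_nonneg (hB : B.IsPositive) (hf : ContinuousOn f (Icc 0 ‖B‖))
    (h0 : ∀ l ∈ Icc (0 : ℝ) ‖B‖, 0 ≤ f l) (x : Z) : 0 ≤ RCLike.re ⟪opFun f B x, x⟫_𝕜 := by
  have hs : ContinuousOn (fun l => Real.sqrt (f l)) (Icc 0 ‖B‖) :=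
    Real.continuous_sqrt.comp_continuousOn hf
  have h1 : opFun f B = opFun (fun l => Real.sqrt (f l)) B * opFun (fun l => Real.sqrt (f l)) B := by
    rw [← opFun_mul hB hs hs]
    exact opFun_congr hB (hs.mul hs) fun l hl => Real.mul_self_sqrt (h0 l hl)
  rw [h1, mul_apply_eq_comp, inner_opFun_left hB hs, inner_self_eq_norm_sq]
  positivity

lemma re_inner_opFun_mono (hB : B.IsPositive) (hf : ContinuousOn f (Icc 0 ‖B‖))
    (hg : ContinuousOn g (Icc 0 ‖B‖)) (h : ∀ l ∈ Icc (0 : ℝ) ‖B‖, f l ≤ g l) (x : Z) :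
    RCLike.re ⟪opFun f B x, x⟫_𝕜 ≤ RCLike.re ⟪opFun g B x, x⟫_𝕜 := by
  have h1 := re_inner_opFun_nonneg hB (hg.sub hf) (fun l hl => sub_nonneg.2 (h l hl)) x
  change 0 ≤ RCLike.re ⟪opFun (fun l => g l - f l) B x, x⟫_𝕜 at h1
  rw [opFun_sub hB hg hf, sub_apply, inner_sub_left, map_sub] at h1
  linarith

lemma norm_opFun_apply_sq (hB : B.IsPositive) (hf : ContinuousOn f (Icc 0 ‖B‖)) (x : Z) :
    ‖opFun f B x‖ ^ 2 = RCLike.re ⟪opFun (fun l => f l * f l) B x, x⟫_𝕜 := by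
  rw [opFun_mul hB hf hf, mul_apply_eq_comp, inner_opFun_left hB hf,
    inner_self_eq_norm_sq]

end FunctionalCalculus

/-! ### The operators `T* T` and `T T*`. -/

section Gram

variable {𝕜 X Y : Type*} [RCLike 𝕜]
  [NormedAddCommGroup X] [InnerProductSpace 𝕜 X] [CompleteSpace X]
  [NormedAddCommGroup Y] [InnerProductSpace 𝕜 Y] [CompleteSpace Y]

lemma isPositive_gram (T : X →L[𝕜] Y) : (gram T).IsPositive :=
  ContinuousLinearMap.isPositive_adjoint_comp_self T

lemma norm_gram (T : X →L[𝕜] Y) : ‖gram T‖ = ‖T‖ * ‖T‖ :=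
  ContinuousLinearMap.norm_adjoint_comp_self T

lemma norm_gram_adjoint (T : X →L[𝕜] Y) :
    ‖gram (ContinuousLinearMap.adjoint T)‖ = ‖gram T‖ := by
  rw [norm_gram, norm_gram, LinearIsometryEquiv.norm_map]

lemma gram_adjoint_apply (T : X →L[𝕜] Y) (y : Y) :
    gram (ContinuousLinearMap.adjoint T) y = T (ContinuousLinearMap.adjoint T y) := by
  simp [gram]

lemma polyOp_gram_adjoint (T : X →L[𝕜] Y) (p : ℝ[X]) (y : Y) :
    polyOp (gram T) p (ContinuousLinearMap.adjoint T y)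
      = ContinuousLinearMap.adjoint T (polyOp (gram (ContinuousLinearMap.adjoint T)) p y) := by
  induction p using Polynomial.induction_on generalizing y with
  | C a => simp [polyOp_C_apply]
  | add p q hp hq => simp [polyOp_add, hp, hq]
  | monomial n a ih =>
    have hX : ∀ x, polyOp (gram T) (C a * Polynomial.X ^ (n + 1)) x
        = polyOp (gram T) (C a * Polynomial.X ^ n) (gram T x) := fun x => by
      rw [pow_succ, ← mul_assoc, polyOp_mul, polyOp_X]; rfl
    have hX' : ∀ x, polyOp (gram (ContinuousLinearMap.adjoint T)) (C a * Polynomial.X ^ (n + 1)) x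
        = polyOp (gram (ContinuousLinearMap.adjoint T)) (C a * Polynomial.X ^ n)
          (gram (ContinuousLinearMap.adjoint T) x) := fun x => by
      rw [pow_succ, ← mul_assoc, polyOp_mul, polyOp_X]; rfl
    rw [hX, hX', ← ih, gram_adjoint_apply]
    rfl

/-- The intertwining relation `f(T* T) T* = T* f(T T*)`. -/
lemma opFun_gram_adjoint (T : X →L[𝕜] Y) {f : ℝ → ℝ} (hf : ContinuousOn f (Icc 0 ‖gram T‖))
    (y : Y) : opFun f (gram T) (ContinuousLinearMap.adjoint T y)
      = ContinuousLinearMap.adjoint T (opFun f (gram (ContinuousLinearMap.adjoint T)) y) := by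
  set S := ContinuousLinearMap.adjoint T with hS
  have hn := norm_gram_adjoint T
  have hf' : ContinuousOn f (Icc 0 ‖gram S‖) := by rwa [hn]
  have key : ∀ ε : ℝ, 0 < ε → ‖opFun f (gram T) ∘L S - S ∘L opFun f (gram S)‖ ≤ ε := by
    intro ε hε
    set e := ε / (3 * (‖S‖ + 1)) with he
    have hepos : 0 < e := by positivity
    have he' : 3 * (‖S‖ * e) ≤ ε := by
      have : ε = 3 * (‖S‖ + 1) * e := by rw [he]; field_simp
      nlinarith
    obtain ⟨p, hp, hpG⟩ := (isFunctionOf_opFun (isPositive_gram T) hf).exists_polyOp hepos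
    have hpG' : ‖polyOp (gram S) p - opFun f (gram S)‖ ≤ e :=
      ((isFunctionOf_polyOp p).sub (isFunctionOf_opFun (isPositive_gram S) hf')).norm_le
        (isPositive_gram S) fun l hl => hp l (by rwa [← hn])
    have heq : opFun f (gram T) ∘L S - S ∘L opFun f (gram S)
        = S ∘L (polyOp (gram S) p - opFun f (gram S))
          - (polyOp (gram T) p - opFun f (gram T)) ∘L S := by
      ext y
      simp [polyOp_gram_adjoint, hS]
    rw [heq]
    refine (norm_sub_le _ _).trans ?_
    have h1 := ContinuousLinearMap.opNorm_comp_le S (polyOp (gram S) p - opFun f (gram S))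
    have h2 := ContinuousLinearMap.opNorm_comp_le (polyOp (gram T) p - opFun f (gram T)) S
    have h3 := mul_le_mul_of_nonneg_left hpG' (norm_nonneg S)
    have h4 := mul_le_mul_of_nonneg_right hpG (norm_nonneg S)
    nlinarith [norm_nonneg S]
  have h0 : ‖opFun f (gram T) ∘L S - S ∘L opFun f (gram S)‖ ≤ 0 :=
    le_of_forall_pos_le_add fun ε hε => by simpa using key ε hε
  have h1 := sub_eq_zero.1 (norm_le_zero_iff.1 h0)
  exact congrArg (fun G : Y →L[𝕜] X => G y) h1

end Gram

/-! ### Fractional powers and the interpolation inequality. -/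

lemma rpow_le_tangent {m u θ : ℝ} (hm : 0 < m) (hu : 0 ≤ u) (h0 : 0 ≤ θ) (h1 : θ ≤ 1) :
    u ^ θ ≤ m ^ θ + θ * m ^ (θ - 1) * (u - m) := by
  have h := rpow_one_add_le_one_add_mul_self (s := u / m - 1)
    (by linarith [div_nonneg hu hm.le]) h0 h1
  rw [add_sub_cancel, Real.div_rpow hu hm.le, div_le_iff₀ (by positivity)] at h
  refine h.trans_eq ?_
  rw [Real.rpow_sub_one hm.ne']
  field_simp

section Powers

variable {𝕜 Z : Type*} [RCLike 𝕜] [NormedAddCommGroup Z] [InnerProductSpace 𝕜 Z]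

/-- Fractional powers of a positive operator. -/
noncomputable def opPow (B : Z →L[𝕜] Z) (a : ℝ) : Z →L[𝕜] Z := opFun (fun l => l ^ a) B

lemma continuousOn_rpow {a : ℝ} (ha : 0 ≤ a) (s : Set ℝ) : ContinuousOn (fun l : ℝ => l ^ a) s :=
  (Real.continuous_rpow_const ha).continuousOn

variable {B : Z →L[𝕜] Z}

lemma opPow_zero (hB : B.IsPositive) : opPow B 0 = 1 := by
  have : (fun l : ℝ => l ^ (0 : ℝ)) = fun _ => 1 := by ext; simp
  rw [opPow, this, opFun_one hB]

lemma opPow_one (hB : B.IsPositive) : opPow B 1 = B := by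
  have : (fun l : ℝ => l ^ (1 : ℝ)) = fun l => l := by ext; simp
  rw [opPow, this, opFun_id hB]

variable [CompleteSpace Z]

lemma opPow_add (hB : B.IsPositive) {a b : ℝ} (ha : 0 ≤ a) (hb : 0 ≤ b) :
    opPow B (a + b) = opPow B a * opPow B b := by
  rw [opPow, opPow, opPow, ← opFun_mul hB (continuousOn_rpow ha _) (continuousOn_rpow hb _)]
  exact opFun_congr hB ((continuousOn_rpow ha _).mul (continuousOn_rpow hb _))
    fun l hl => (Real.rpow_add_of_nonneg hl.1 ha hb).symm

lemma opPow_apply_opPow (hB : B.IsPositive) {a b : ℝ} (ha : 0 ≤ a) (hb : 0 ≤ b) (x : Z) :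
    opPow B a (opPow B b x) = opPow B (a + b) x := by
  rw [opPow_add hB ha hb]; rfl

lemma inner_opPow_left (hB : B.IsPositive) {a : ℝ} (ha : 0 ≤ a) (x y : Z) :
    ⟪opPow B a x, y⟫_𝕜 = ⟪x, opPow B a y⟫_𝕜 :=
  inner_opFun_left hB (continuousOn_rpow ha _) x y

lemma norm_opPow_apply_le (hB : B.IsPositive) (hB1 : ‖B‖ ≤ 1) {a : ℝ} (ha : 0 ≤ a) (x : Z) :
    ‖opPow B a x‖ ≤ ‖x‖ := by
  have h : ‖opPow B a‖ ≤ 1 := norm_opFun_le hB (continuousOn_rpow ha _) fun l hl => by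
    rw [abs_of_nonneg (Real.rpow_nonneg hl.1 a)]
    exact Real.rpow_le_one hl.1 (hl.2.trans hB1) ha
  simpa using (opPow B a).le_of_opNorm_le h x

/-- Jensen's inequality without a spectral measure: the concave function `u ^ θ` lies below its
tangent at `m`. Inserting `u = l ^ (2 b)` and passing to quadratic forms leaves `m` free for
optimization. -/
lemma norm_opPow_sq_le_tangent (hB : B.IsPositive) {b θ m : ℝ} (hb : 0 ≤ b) (h0 : 0 ≤ θ)
    (h1 : θ ≤ 1) (hm : 0 < m) (x : Z) :
    ‖opPow B (θ * b) x‖ ^ 2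
      ≤ m ^ θ * ‖x‖ ^ 2 + θ * m ^ (θ - 1) * (‖opPow B b x‖ ^ 2 - m * ‖x‖ ^ 2) := by
  have hcb := continuousOn_rpow hb (Icc 0 ‖B‖)
  have hct := continuousOn_rpow (mul_nonneg h0 hb) (Icc 0 ‖B‖)
  set c0 := m ^ θ - θ * m ^ (θ - 1) * m with hc0
  set c1 := θ * m ^ (θ - 1) with hc1
  have hcc : ContinuousOn (fun _ : ℝ => c1) (Icc 0 ‖B‖) := continuousOn_const
  have hcc0 : ContinuousOn (fun _ : ℝ => c0) (Icc 0 ‖B‖) := continuousOn_const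
  have hmono := re_inner_opFun_mono hB (hct.mul hct) (hcc0.add (hcc.mul (hcb.mul hcb)))
    (fun l hl => by
      have := rpow_le_tangent hm (mul_nonneg (Real.rpow_nonneg hl.1 b) (Real.rpow_nonneg hl.1 b))
        h0 h1
      have h2 : l ^ (θ * b) * l ^ (θ * b) = (l ^ b * l ^ b) ^ θ := by
        rw [Real.mul_rpow (Real.rpow_nonneg hl.1 b) (Real.rpow_nonneg hl.1 b),
          ← Real.rpow_mul hl.1, mul_comm b]
      simp only [Pi.mul_apply, Pi.add_apply]
      rw [h2, hc0, hc1]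
      linarith) x
  have hL := norm_opFun_apply_sq hB hct x
  have hR := norm_opFun_apply_sq hB hcb x
  have e1 : opFun ((fun _ => c0) + (fun _ => c1) * ((fun l => l ^ b) * fun l : ℝ => l ^ b)) B x
      = (c0 : 𝕜) • x + (c1 : 𝕜) • opFun (fun l : ℝ => l ^ b * l ^ b) B x := by
    have e2 := opFun_add hB hcc0 (hcc.mul (hcb.mul hcb))
    have e3 := opFun_mul hB hcc (hcb.mul hcb)
    change opFun (fun l => c0 + c1 * (l ^ b * l ^ b)) B x = _
    change opFun (fun l => c0 + c1 * (l ^ b * l ^ b)) B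
      = _ + opFun (fun l => c1 * (l ^ b * l ^ b)) B at e2
    change opFun (fun l => c1 * (l ^ b * l ^ b)) B
      = _ * opFun (fun l => (l ^ b * l ^ b)) B at e3
    rw [e2, e3, add_apply, opFun_const_apply hB, mul_apply_eq_comp, opFun_const_apply hB]
  rw [e1, inner_add_left, inner_smul_left, inner_smul_left, map_add, RCLike.conj_ofReal,
    RCLike.conj_ofReal, RCLike.re_ofReal_mul, RCLike.re_ofReal_mul, inner_self_eq_norm_sq,
    ← hR] at hmono
  change RCLike.re ⟪opFun (fun l => l ^ (θ * b) * l ^ (θ * b)) B x, x⟫_𝕜 ≤ _ at hmono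
  rw [← hL] at hmono
  change ‖opFun (fun l => l ^ (θ * b)) B x‖ ^ 2
    ≤ m ^ θ * ‖x‖ ^ 2 + c1 * (‖opFun (fun l => l ^ b) B x‖ ^ 2 - m * ‖x‖ ^ 2)
  refine hmono.trans_eq ?_
  rw [hc0]
  ring

/-- The interpolation inequality for powers of a positive operator. -/
lemma norm_opPow_interpolation (hB : B.IsPositive) {b θ : ℝ} (hb : 0 ≤ b) (h0 : 0 ≤ θ)
    (h1 : θ ≤ 1) (x : Z) :
    ‖opPow B (θ * b) x‖ ≤ ‖x‖ ^ (1 - θ) * ‖opPow B b x‖ ^ θ := by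
  rcases eq_or_ne x 0 with rfl | hx
  · rw [map_zero, norm_zero]
    positivity
  have hxpos : 0 < ‖x‖ := norm_pos_iff.2 hx
  have htan := fun m hm => norm_opPow_sq_le_tangent hB hb h0 h1 (m := m) hm x
  rcases (norm_nonneg (opPow B b x)).eq_or_lt with hP | hP
  · rw [← hP] at htan ⊢
    rcases h0.eq_or_lt with rfl | hθ
    · simp only [zero_mul, sub_zero, Real.rpow_one, Real.rpow_zero, mul_one]
      rw [opPow_zero hB]; rfl
    rw [Real.zero_rpow hθ.ne', mul_zero]
    by_contra hQ
    push Not at hQ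
    set Q := ‖opPow B (θ * b) x‖ ^ 2 with hQdef
    have hQpos : 0 < Q := by positivity
    have hbase : 0 < Q / (2 * ‖x‖ ^ 2) := by positivity
    -- Here `‖B^b x‖ = 0`. The tangent point with `m ^ θ * ‖x‖ ^ 2 = Q / 2` already yields `Q ≤ Q /
    -- 2`.
    have h2 := htan ((Q / (2 * ‖x‖ ^ 2)) ^ (1 / θ)) (by positivity)
    have h3 : ((Q / (2 * ‖x‖ ^ 2)) ^ (1 / θ)) ^ θ = Q / (2 * ‖x‖ ^ 2) := by
      rw [← Real.rpow_mul hbase.le, one_div_mul_cancel hθ.ne', Real.rpow_one]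
    rw [h3] at h2
    have h4 : Q / (2 * ‖x‖ ^ 2) * ‖x‖ ^ 2 = Q / 2 := by field_simp
    rw [h4] at h2
    have h5 : 0 ≤ θ * ((Q / (2 * ‖x‖ ^ 2)) ^ (1 / θ)) ^ (θ - 1)
        * ((Q / (2 * ‖x‖ ^ 2)) ^ (1 / θ) * ‖x‖ ^ 2) := by positivity
    nlinarith
  · set P := ‖opPow B b x‖ with hPdef
    -- At the mean value `P ^ 2 / ‖x‖ ^ 2` of `l ^ (2 b)` the linear term drops out.
    have h2 := htan (P ^ 2 / ‖x‖ ^ 2) (by positivity)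
    have h3 : P ^ 2 / ‖x‖ ^ 2 * ‖x‖ ^ 2 = P ^ 2 := by field_simp
    rw [h3, sub_self, mul_zero, add_zero] at h2
    refine le_of_sq_le_sq ?_ (by positivity)
    refine h2.trans_eq ?_
    rw [mul_pow, Real.div_rpow (by positivity) (by positivity), Real.rpow_sub hxpos,
      Real.rpow_one, ← Real.rpow_natCast, ← Real.rpow_natCast, ← Real.rpow_mul hP.le,
      ← Real.rpow_mul hxpos.le, mul_comm _ θ, Real.rpow_mul hP.le, Real.rpow_mul hxpos.le]
    simp only [Nat.cast_ofNat, Real.rpow_two]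
    field_simp

end Powers

/-! ### Douglas factorization and polar decomposition. -/

section Factorization

variable {𝕜 X Y W : Type*} [RCLike 𝕜]
  [NormedAddCommGroup X] [InnerProductSpace 𝕜 X]
  [NormedAddCommGroup Y] [InnerProductSpace 𝕜 Y] [CompleteSpace Y]
  [NormedAddCommGroup W] [InnerProductSpace 𝕜 W] [CompleteSpace W]

/-- Douglas' factorization lemma. -/
lemma exists_factorization (S : X →L[𝕜] W) (T : X →L[𝕜] Y) {c : ℝ} (hc : 0 ≤ c)
    (h : ∀ x, ‖S x‖ ≤ c * ‖T x‖) : ∃ Q : Y →L[𝕜] W, ‖Q‖ ≤ c ∧ ∀ x, Q (T x) = S x := by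
  set K := (LinearMap.range (T : X →ₗ[𝕜] Y)) with hK
  have hker : LinearMap.ker (T : X →ₗ[𝕜] Y) ≤ LinearMap.ker (S : X →ₗ[𝕜] W) := fun x hx => by
    have hx' : T x = 0 := hx
    have := h x
    rw [hx', norm_zero, mul_zero] at this
    exact norm_le_zero_iff.1 this
  -- `S` descends to the range of `T` through any linear right inverse; the choice is immaterial
  -- since `ker T ≤ ker S`.
  obtain ⟨g, hg⟩ : ∃ g : K →ₗ[𝕜] W, ∀ x, g ⟨T x, ⟨x, rfl⟩⟩ = S x := by
    have hsurj := (T : X →ₗ[𝕜] Y).surjective_rangeRestrict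
    obtain ⟨r, hr⟩ := (T : X →ₗ[𝕜] Y).rangeRestrict.exists_rightInverse_of_surjective
      (LinearMap.range_eq_top.2 hsurj)
    refine ⟨(S : X →ₗ[𝕜] W) ∘ₗ r, fun x => ?_⟩
    have h1 : (T : X →ₗ[𝕜] Y) (r ⟨T x, ⟨x, rfl⟩⟩) = T x := by
      have := congrArg (fun k => ((k ⟨T x, ⟨x, rfl⟩⟩ : K) : Y)) hr
      exact this
    have h2 : r ⟨T x, ⟨x, rfl⟩⟩ - x ∈ LinearMap.ker (T : X →ₗ[𝕜] Y) := by
      rw [LinearMap.mem_ker, map_sub, h1]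
      exact sub_self _
    have h3 := hker h2
    rw [LinearMap.mem_ker, map_sub] at h3
    exact sub_eq_zero.1 h3
  have hgb : ∀ y : K, ‖g y‖ ≤ c * ‖y‖ := by
    rintro ⟨-, x, rfl⟩
    have := h x
    rw [← hg x] at this
    exact this
  set gc := g.mkContinuous c hgb with hgc
  set e : K →L[𝕜] K.topologicalClosure :=
    ⟨Submodule.inclusion K.le_topologicalClosure, by
      exact continuous_inclusion K.le_topologicalClosure⟩ with he
  have hdense : DenseRange e := by
    have := denseRange_inclusion_iff (s := (K : Set Y)) (t := (K.topologicalClosure : Set Y))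
      K.le_topologicalClosure
    exact this.2 subset_rfl
  have hnorm : ∀ y : K, ‖e y‖ = ‖y‖ := fun y => rfl
  have hui : IsUniformInducing e :=
    (AddMonoidHomClass.isometry_of_norm e hnorm).isUniformInducing
  have : CompleteSpace K.topologicalClosure :=
    K.isClosed_topologicalClosure.completeSpace_coe
  -- Extension by density to the closure of the range and by zero on its orthogonal complement.
  refine ⟨(gc.extend e) ∘L K.topologicalClosure.orthogonalProjectionOnto, ?_, fun x => ?_⟩
  · have h1 : ‖gc.extend e‖ ≤ c := by
      have := gc.opNorm_extend_le (e := e) (N := 1) hdense (fun y => by simp [hnorm])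
      rw [NNReal.coe_one, one_mul] at this
      exact this.trans (g.mkContinuous_norm_le hc hgb)
    refine (ContinuousLinearMap.opNorm_comp_le _ _).trans ?_
    have h2 := K.topologicalClosure.orthogonalProjectionOnto_norm_le
    nlinarith [norm_nonneg (gc.extend e)]
  · have hx : T x ∈ K.topologicalClosure := K.le_topologicalClosure ⟨x, rfl⟩
    have h1 : K.topologicalClosure.orthogonalProjectionOnto (T x) = e ⟨T x, ⟨x, rfl⟩⟩ := by
      have := Submodule.orthogonalProjectionOnto_mem_subspace_eq_self
        (K := K.topologicalClosure) ⟨T x, hx⟩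
      exact this
    rw [ContinuousLinearMap.comp_apply, h1, ContinuousLinearMap.extend_eq _ hdense hui]
    exact hg x

end Factorization

section Polar

variable {𝕜 X Y : Type*} [RCLike 𝕜]
  [NormedAddCommGroup X] [InnerProductSpace 𝕜 X] [CompleteSpace X]
  [NormedAddCommGroup Y] [InnerProductSpace 𝕜 Y] [CompleteSpace Y]

lemma norm_opPow_half_gram (A : X →L[𝕜] Y) (x : X) : ‖opPow (gram A) (1 / 2) x‖ = ‖A x‖ := by
  have hB := isPositive_gram A
  have h1 : ‖opPow (gram A) (1 / 2) x‖ ^ 2 = ‖A x‖ ^ 2 := by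
    rw [← inner_self_eq_norm_sq (𝕜 := 𝕜), inner_opPow_left hB (by norm_num),
      opPow_apply_opPow hB (by norm_num) (by norm_num), ← inner_self_eq_norm_sq (𝕜 := 𝕜),
      add_halves, opPow_one hB, gram, ContinuousLinearMap.comp_apply,
      ContinuousLinearMap.adjoint_inner_right]
  exact (pow_left_inj₀ (norm_nonneg _) (norm_nonneg _) two_ne_zero).1 h1

/-- The polar decomposition `A = V (A* A)^{1/2}`. -/
lemma exists_polar (A : X →L[𝕜] Y) : ∃ V : X →L[𝕜] Y, ‖V‖ ≤ 1 ∧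
    (∀ x, V (opPow (gram A) (1 / 2) x) = A x) ∧
    (∀ x, ContinuousLinearMap.adjoint V (A x) = opPow (gram A) (1 / 2) x) ∧
    ∀ y, opPow (gram A) (1 / 2) (ContinuousLinearMap.adjoint V y)
      = ContinuousLinearMap.adjoint A y := by
  have hB := isPositive_gram A
  obtain ⟨V, hV, hVA⟩ := exists_factorization A (opPow (gram A) (1 / 2)) zero_le_one
    (fun x => by rw [norm_opPow_half_gram, one_mul])
  refine ⟨V, hV, hVA, fun x => ?_, fun y => ?_⟩
  · set s := opPow (gram A) (1 / 2) x with hs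
    have hn : ‖A x‖ = ‖s‖ := (norm_opPow_half_gram A x).symm
    have h1 : ‖ContinuousLinearMap.adjoint V (A x)‖ ≤ ‖s‖ := by
      rw [← hn]
      have h := (ContinuousLinearMap.adjoint V).le_opNorm (A x)
      rw [LinearIsometryEquiv.norm_map] at h
      nlinarith [norm_nonneg (A x)]
    -- The equality case of Cauchy–Schwarz: `‖V* A x‖ ≤ ‖s‖` while `⟪V* A x, s⟫ = ‖s‖ ^ 2`.
    have h2 : ‖ContinuousLinearMap.adjoint V (A x) - s‖ ^ 2 ≤ 0 := by
      rw [norm_sub_sq (𝕜 := 𝕜), ContinuousLinearMap.adjoint_inner_left, hVA,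
        inner_self_eq_norm_sq, hn]
      nlinarith [norm_nonneg (ContinuousLinearMap.adjoint V (A x))]
    have h3 : ‖ContinuousLinearMap.adjoint V (A x) - s‖ = 0 :=
      pow_eq_zero_iff two_ne_zero |>.1 (le_antisymm h2 (sq_nonneg _))
    exact sub_eq_zero.1 (norm_eq_zero.1 h3)
  · refine ext_inner_right 𝕜 fun x => ?_
    rw [inner_opPow_left hB (by norm_num), ContinuousLinearMap.adjoint_inner_left, hVA,
      ContinuousLinearMap.adjoint_inner_left]

end Polar

/-! ### Scalar inequalities for single time steps. -/

section Scalar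

/-- An explicit step of `y' ≤ K y ^ (1 - α)`; concavity turns it into linear growth of `y ^ α`. The
alternative `α = 1` admits negative `K`, which the decay of the error needs. -/
lemma rpow_le_rpow_add_of_le_left {x y K α : ℝ} (hx : 0 ≤ x) (hy : 0 ≤ y) (h0 : 0 < α)
    (h1 : α ≤ 1) (hK : 0 ≤ K ∨ α = 1) (h : y ≤ x + K * x ^ (1 - α)) : y ^ α ≤ x ^ α + K := by
  rcases h1.eq_or_lt with rfl | h1'
  · simpa using h
  have hK' : 0 ≤ K := hK.resolve_right h1'.ne
  rcases hx.eq_or_lt with rfl | hx'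
  · rw [Real.zero_rpow (by linarith)] at h
    have : y = 0 := by linarith
    rw [this]; linarith
  have h2 := rpow_le_tangent hx' hy h0.le h1
  have h3 : x ^ (α - 1) * x ^ (1 - α) = 1 := by
    rw [← Real.rpow_add hx']; simp
  have h4 : α * x ^ (α - 1) * (y - x) ≤ α * x ^ (α - 1) * (K * x ^ (1 - α)) :=
    mul_le_mul_of_nonneg_left (by linarith) (by positivity)
  have h5 : α * x ^ (α - 1) * (K * x ^ (1 - α)) = α * K := by
    linear_combination (α * K) * h3
  nlinarith

/-- The implicit analogue: if `y > x`, multiply by `y ^ (α - 1)`, which for `x > 0` is at most `x ^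
(α - 1)`. -/
lemma rpow_le_rpow_add_of_le_right {x y K α : ℝ} (hx : 0 ≤ x) (hy : 0 ≤ y) (h0 : 0 < α)
    (h1 : α ≤ 1) (hK : 0 ≤ K ∨ α = 1) (h : y ≤ x + K * y ^ (1 - α)) : y ^ α ≤ x ^ α + K := by
  rcases h1.eq_or_lt with rfl | h1'
  · simpa using h
  have hK' : 0 ≤ K := hK.resolve_right h1'.ne
  rcases le_or_gt y x with hyx | hyx
  · exact (Real.rpow_le_rpow hy hyx h0.le).trans (by linarith)
  have hy' : 0 < y := hx.trans_lt hyx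
  have h3 : y ^ (α - 1) * y ^ (1 - α) = 1 := by
    rw [← Real.rpow_add hy']; simp
  have h4 : x * y ^ (α - 1) ≤ x ^ α := by
    rcases hx.eq_or_lt with rfl | hx'
    · rw [zero_mul]; positivity
    have h5 : y ^ (α - 1) ≤ x ^ (α - 1) :=
      Real.rpow_le_rpow_of_nonpos hx' hyx.le (by linarith)
    refine (mul_le_mul_of_nonneg_left h5 hx).trans_eq ?_
    rw [mul_comm, ← Real.rpow_add_one hx'.ne']; simp
  have h6 : y ^ α = y * y ^ (α - 1) := by
    rw [mul_comm, ← Real.rpow_add_one hy'.ne']; simp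
  have h7 : (y - x) * y ^ (α - 1) ≤ K * y ^ (1 - α) * y ^ (α - 1) :=
    mul_le_mul_of_nonneg_right (by linarith) (by positivity)
  have h8 : K * y ^ (1 - α) * y ^ (α - 1) = K := by linear_combination K * h3
  rw [h6]
  linarith

/-- A function whose forward increments are bounded by `K d + C d ^ 2` has slope at most `K`. -/
lemma le_add_of_increment_le {ψ : ℝ → ℝ} {h K C : ℝ} (hh : 0 ≤ h)
    (H : ∀ a b, 0 ≤ a → a < h → a ≤ b → b ≤ h → ψ b ≤ ψ a + K * (b - a) + C * (b - a) ^ 2) :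
    ψ h ≤ ψ 0 + K * h := by
  -- Over `n` equal steps the quadratic errors add up to `C h ^ 2 / n`, which vanishes in the limit.
  have hn : ∀ n : ℕ, 0 < n → ψ h ≤ ψ 0 + K * h + C * h ^ 2 * (1 / n) := by
    intro n hn
    have hn' : (0 : ℝ) < n := Nat.cast_pos.2 hn
    rcases hh.eq_or_lt with rfl | hpos
    · simp
    have step : ∀ k : ℕ, k ≤ n → ψ (k * (h / n)) ≤ ψ 0 + k * (K * (h / n) + C * (h / n) ^ 2) := by
      intro k
      induction k with
      | zero => simp
      | succ k ih =>
        intro hk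
        have hk' : (k : ℝ) + 1 ≤ n := by exact_mod_cast hk
        have h1 := ih (by omega)
        have hd : 0 < h / n := by positivity
        have hnd : n * (h / n) = h := by field_simp
        have h2 := H (k * (h / n)) ((k + 1 : ℕ) * (h / n)) (by positivity) (by nlinarith)
          (by push_cast; nlinarith) (by push_cast; nlinarith)
        have h3 : ((k + 1 : ℕ) : ℝ) * (h / n) - k * (h / n) = h / n := by push_cast; ring
        rw [h3] at h2
        push_cast at h2 ⊢
        linarith
    have h4 := step n le_rfl
    have hnd : n * (h / n) = h := by field_simp
    rw [hnd] at h4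
    refine h4.trans_eq ?_
    field_simp
    ring
  have hlim : Filter.Tendsto (fun n : ℕ => ψ 0 + K * h + C * h ^ 2 * (1 / (n : ℝ)))
      Filter.atTop (nhds (ψ 0 + K * h + C * h ^ 2 * 0)) :=
    (tendsto_one_div_atTop_nhds_zero_nat.const_mul _).const_add _
  rw [mul_zero, add_zero] at hlim
  refine ge_of_tendsto hlim ?_
  filter_upwards [Filter.eventually_gt_atTop 0] with n hn0 using hn n hn0

end Scalar

/-! ### Inner paths and their energy estimate. -/

section InnerPath

variable {𝕜 Y Z : Type*} [RCLike 𝕜]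
  [NormedAddCommGroup Y] [InnerProductSpace 𝕜 Y]
  [NormedAddCommGroup Z] [InnerProductSpace 𝕜 Z]

/-- `InnerPath H r η t v`: the dual variable `v` is reached at time `t` from `0` by explicit Euler
steps of unit size, implicit Euler steps and exact flows of `v' = r - H v`, as long as the residual
`r - H v` is not yet small compared to `r`. -/
inductive InnerPath (H : Y →L[𝕜] Y) (r : Y) (η : ℝ) : ℝ → Y → Prop
  | start : InnerPath H r η 0 0
  | explicit {t : ℝ} {v : Y} : InnerPath H r η t v → η * ‖r‖ ≤ ‖r - H v‖ → ‖r - H v‖ ≤ ‖r‖ →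
      InnerPath H r η (t + 1) (v + (r - H v))
  | implicit {t : ℝ} {v v' : Y} {h : ℝ} : InnerPath H r η t v → 0 ≤ h →
      v' = v + (h : 𝕜) • (r - H v') → η / 2 * ‖r‖ ≤ ‖r - H v'‖ → ‖r - H v'‖ ≤ ‖r‖ →
      InnerPath H r η (t + h) v'
  | flow {t h C : ℝ} {γ : ℝ → Y} : InnerPath H r η t (γ 0) → 0 ≤ h → 0 ≤ C →
      (∀ a b, 0 ≤ a → a ≤ b →
        ‖γ b - γ a - ((b - a : ℝ) : 𝕜) • (r - H (γ a))‖ ≤ C * (b - a) ^ 2) →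
      (∀ a, 0 ≤ a → a < h → η * ‖r‖ ≤ ‖r - H (γ a)‖) →
      (∀ a, 0 ≤ a → ‖r - H (γ a)‖ ≤ ‖r‖) →
      InnerPath H r η (t + h) (γ h)

variable {H : Y →L[𝕜] Y} {r : Y} {η : ℝ}

/-- A second-order expansion along the flow. The size of `M` is irrelevant, since
`le_add_of_increment_le` removes the quadratic term. -/
lemma norm_sq_flow_increment (G : Y →L[𝕜] Z) (z0 : Z) {h C : ℝ} {γ : ℝ → Y} (hC : 0 ≤ C)
    (hγ : ∀ a b, 0 ≤ a → a ≤ b →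
        ‖γ b - γ a - ((b - a : ℝ) : 𝕜) • (r - H (γ a))‖ ≤ C * (b - a) ^ 2)
    (hle : ∀ a, 0 ≤ a → ‖r - H (γ a)‖ ≤ ‖r‖) :
    ∃ M : ℝ, 0 ≤ M ∧ ∀ a b, 0 ≤ a → a ≤ b → b ≤ h →
      ‖z0 + G (γ b)‖ ^ 2 ≤ ‖z0 + G (γ a)‖ ^ 2
        + (b - a) * (2 * RCLike.re ⟪z0 + G (γ a), G (r - H (γ a))⟫_𝕜) + M * (b - a) ^ 2 := by
  have hinc : ∀ a b, 0 ≤ a → a ≤ b → b ≤ h → ‖γ b - γ a‖ ≤ (b - a) * (‖r‖ + C * h) := by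
    intro a b ha hab hbh
    have h1 := norm_add_le (γ b - γ a - ((b - a : ℝ) : 𝕜) • (r - H (γ a)))
      (((b - a : ℝ) : 𝕜) • (r - H (γ a)))
    rw [sub_add_cancel, norm_smul, RCLike.norm_ofReal, abs_of_nonneg (sub_nonneg.2 hab)] at h1
    have h2 := hγ a b ha hab
    have h3 := mul_le_mul_of_nonneg_left (hle a ha) (sub_nonneg.2 hab)
    have h4 : C * (b - a) ^ 2 ≤ (b - a) * (C * h) := by
      have : (b - a) * (C * (b - a)) ≤ (b - a) * (C * h) :=
        mul_le_mul_of_nonneg_left (mul_le_mul_of_nonneg_left (by linarith) hC)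
          (sub_nonneg.2 hab)
      nlinarith
    nlinarith
  refine ⟨2 * (‖z0 + G (γ 0)‖ + ‖G‖ * (|h| * (‖r‖ + C * |h|))) * (‖G‖ * C)
    + (‖G‖ * (‖r‖ + C * |h|)) ^ 2, by positivity, fun a b ha hab hbh => ?_⟩
  have hh : 0 ≤ h := ha.trans (hab.trans hbh)
  rw [abs_of_nonneg hh]
  set d := b - a with hd
  have hd0 : 0 ≤ d := sub_nonneg.2 hab
  set z := z0 + G (γ a) with hz
  set ρ := γ b - γ a - (d : 𝕜) • (r - H (γ a)) with hρ
  have hρn : ‖ρ‖ ≤ C * d ^ 2 := hγ a b ha hab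
  have hzb : z0 + G (γ b) = z + G (γ b - γ a) := by rw [hz, map_sub]; abel
  have hsplit : G (γ b - γ a) = (d : 𝕜) • G (r - H (γ a)) + G ρ := by
    rw [hρ, map_sub G (γ b - γ a), map_smul]; abel
  have hzn : ‖z‖ ≤ ‖z0 + G (γ 0)‖ + ‖G‖ * (h * (‖r‖ + C * h)) := by
    have h1 : z = (z0 + G (γ 0)) + G (γ a - γ 0) := by rw [hz, map_sub]; abel
    rw [h1]
    refine (norm_add_le _ _).trans (add_le_add le_rfl ((G.le_opNorm _).trans ?_))
    refine mul_le_mul_of_nonneg_left ?_ (norm_nonneg G)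
    refine (hinc 0 a le_rfl ha (hab.trans hbh)).trans ?_
    exact mul_le_mul_of_nonneg_right (by linarith) (by positivity)
  have hGn : ‖G (γ b - γ a)‖ ≤ ‖G‖ * (d * (‖r‖ + C * h)) :=
    (G.le_opNorm _).trans (mul_le_mul_of_nonneg_left (hinc a b ha hab hbh) (norm_nonneg G))
  have hGρ : ‖G ρ‖ ≤ ‖G‖ * (C * d ^ 2) :=
    (G.le_opNorm _).trans (mul_le_mul_of_nonneg_left hρn (norm_nonneg G))
  have hin : RCLike.re ⟪z, G (γ b - γ a)⟫_𝕜
      ≤ d * RCLike.re ⟪z, G (r - H (γ a))⟫_𝕜 + ‖z‖ * ‖G ρ‖ := by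
    rw [hsplit, inner_add_right, inner_smul_right, map_add, RCLike.re_ofReal_mul]
    exact add_le_add le_rfl (re_inner_le_norm _ _)
  have hzρ : ‖z‖ * ‖G ρ‖
      ≤ (‖z0 + G (γ 0)‖ + ‖G‖ * (h * (‖r‖ + C * h))) * (‖G‖ * (C * d ^ 2)) :=
    mul_le_mul hzn hGρ (norm_nonneg _) (by positivity)
  have hGsq := pow_le_pow_left₀ (norm_nonneg _) hGn 2
  rw [hzb, norm_add_sq (𝕜 := 𝕜)]
  nlinarith

/-- The energy estimate along inner paths. -/
lemma InnerPath.energy {t : ℝ} {v : Y} (hp : InnerPath H r η t v) (G : Y →L[𝕜] Z) (z0 : Z)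
    {α K : ℝ} (h0 : 0 < α) (h1 : α ≤ 1) (hK : 0 ≤ K ∨ α = 1)
    (hex : ∀ v, η * ‖r‖ ≤ ‖r - H v‖ → ‖r - H v‖ ≤ ‖r‖ →
      2 * RCLike.re ⟪z0 + G v, G (r - H v)⟫_𝕜 + ‖G (r - H v)‖ ^ 2
        ≤ K * (‖z0 + G v‖ ^ 2) ^ (1 - α))
    (him : ∀ v, η / 2 * ‖r‖ ≤ ‖r - H v‖ → ‖r - H v‖ ≤ ‖r‖ →
      2 * RCLike.re ⟪z0 + G v, G (r - H v)⟫_𝕜 ≤ K * (‖z0 + G v‖ ^ 2) ^ (1 - α)) :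
    (‖z0 + G v‖ ^ 2) ^ α ≤ (‖z0‖ ^ 2) ^ α + t * K := by
  induction hp with
  | start => simp
  | @explicit t v _ hl hu ih =>
    have h2 : ‖z0 + G (v + (r - H v))‖ ^ 2
        ≤ ‖z0 + G v‖ ^ 2 + K * (‖z0 + G v‖ ^ 2) ^ (1 - α) := by
      rw [map_add, ← add_assoc, norm_add_sq (𝕜 := 𝕜)]
      linarith [hex v hl hu]
    have := rpow_le_rpow_add_of_le_left (sq_nonneg _) (sq_nonneg _) h0 h1 hK h2
    linarith
  | @implicit t v v' h _ hh hv hl hu ih =>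
    have hKh : 0 ≤ h * K ∨ α = 1 := hK.imp_left fun hK => mul_nonneg hh hK
    have h2 : ‖z0 + G v'‖ ^ 2
        ≤ ‖z0 + G v‖ ^ 2 + h * K * (‖z0 + G v'‖ ^ 2) ^ (1 - α) := by
      have h3 : z0 + G v = (z0 + G v') - (h : 𝕜) • G (r - H v') := by
        have : v = v' - (h : 𝕜) • (r - H v') := eq_sub_of_add_eq hv.symm
        rw [this, map_sub, map_smul]
        abel
      -- Expanded around the end point, the squared step has the favourable sign and is dropped;
      -- hence `him` carries no second-order term, unlike `hex`.
      rw [h3, norm_sub_sq (𝕜 := 𝕜), inner_smul_right, RCLike.re_ofReal_mul]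
      have h4 := mul_le_mul_of_nonneg_left (him v' hl hu) hh
      nlinarith [sq_nonneg ‖(h : 𝕜) • G (r - H v')‖]
    have := rpow_le_rpow_add_of_le_right (sq_nonneg _) (sq_nonneg _) h0 h1 hKh h2
    linarith
  | @flow t h C γ _ hh hC hγ hl hu ih =>
    obtain ⟨M, hM0, hM⟩ := norm_sq_flow_increment (h := h) G z0 hC hγ hu
    have hη : ∀ a, 0 ≤ a → a < h → η / 2 * ‖r‖ ≤ ‖r - H (γ a)‖ := fun a ha hah => by
      have := hl a ha hah
      nlinarith [norm_nonneg (r - H (γ a))]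
    suffices hmain : (‖z0 + G (γ h)‖ ^ 2) ^ α ≤ (‖z0 + G (γ 0)‖ ^ 2) ^ α + K * h by linarith
    have hinc : ∀ a b, 0 ≤ a → a < h → a ≤ b → b ≤ h → ‖z0 + G (γ b)‖ ^ 2
        ≤ ‖z0 + G (γ a)‖ ^ 2 + (b - a) * (K * (‖z0 + G (γ a)‖ ^ 2) ^ (1 - α))
          + M * (b - a) ^ 2 := fun a b ha hah hab hbh => by
      have h2 := hM a b ha hab hbh
      have h3 := mul_le_mul_of_nonneg_left (him (γ a) (hη a ha hah) (hu a ha))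
        (sub_nonneg.2 hab)
      linarith
    rcases h1.eq_or_lt with rfl | h1'
    · simp only [Real.rpow_one]
      refine le_add_of_increment_le (ψ := fun a => ‖z0 + G (γ a)‖ ^ 2) (C := M) hh
        fun a b ha hah hab hbh => ?_
      have := hinc a b ha hah hab hbh
      simp only [sub_self, Real.rpow_zero, mul_one] at this
      linarith
    have hK' : 0 ≤ K := hK.resolve_right h1'.ne
    -- For `α < 1` the power is not differentiable at `0`, so the estimate is proved with a shift
    -- `ε` that tends to `0` at the end.
    have hreg : ∀ ε : ℝ, 0 < ε →
        (‖z0 + G (γ h)‖ ^ 2 + ε) ^ α ≤ (‖z0 + G (γ 0)‖ ^ 2 + ε) ^ α + K * h := by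
      intro ε hε
      refine le_add_of_increment_le (ψ := fun a => (‖z0 + G (γ a)‖ ^ 2 + ε) ^ α)
        (C := ε ^ (α - 1) * M) hh fun a b ha hah hab hbh => ?_
      set φ := ‖z0 + G (γ a)‖ ^ 2 with hφ
      have hφ0 : 0 ≤ φ := sq_nonneg _
      have h2 := hinc a b ha hah hab hbh
      have h3 := rpow_le_tangent (m := φ + ε) (u := ‖z0 + G (γ b)‖ ^ 2 + ε) (by positivity)
        (by positivity) h0.le h1
      have hpw : 0 < (φ + ε) ^ (α - 1) := by positivity
      have h4 : (φ + ε) ^ (α - 1) * φ ^ (1 - α) ≤ 1 := by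
        have h5 : φ ^ (1 - α) ≤ (φ + ε) ^ (1 - α) :=
          Real.rpow_le_rpow hφ0 (by linarith) (by linarith)
        refine (mul_le_mul_of_nonneg_left h5 hpw.le).trans_eq ?_
        rw [← Real.rpow_add (by positivity)]; simp
      have h6 : (φ + ε) ^ (α - 1) ≤ ε ^ (α - 1) :=
        Real.rpow_le_rpow_of_nonpos hε (by linarith) (by linarith)
      have hd0 : 0 ≤ b - a := sub_nonneg.2 hab
      have h7 : α * (φ + ε) ^ (α - 1) * (‖z0 + G (γ b)‖ ^ 2 + ε - (φ + ε))
          ≤ α * (φ + ε) ^ (α - 1) * ((b - a) * (K * φ ^ (1 - α)) + M * (b - a) ^ 2) :=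
        mul_le_mul_of_nonneg_left (by linarith) (by positivity)
      have h8 : α * (φ + ε) ^ (α - 1) * ((b - a) * (K * φ ^ (1 - α)) + M * (b - a) ^ 2)
          ≤ 1 * ((b - a) * K * 1 + ε ^ (α - 1) * (M * (b - a) ^ 2)) := by
        have h9 : (φ + ε) ^ (α - 1) * ((b - a) * (K * φ ^ (1 - α)) + M * (b - a) ^ 2)
            ≤ (b - a) * K * 1 + ε ^ (α - 1) * (M * (b - a) ^ 2) := by
          have h10 := mul_le_mul_of_nonneg_left h4 (mul_nonneg hd0 hK')
          have h11 := mul_le_mul_of_nonneg_right h6 (mul_nonneg hM0 (sq_nonneg (b - a)))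
          linarith
        rw [mul_assoc]
        refine mul_le_mul h1 h9 ?_ zero_le_one
        have : 0 ≤ φ ^ (1 - α) := Real.rpow_nonneg hφ0 _
        positivity
      linarith
    have hcont : ∀ x : ℝ, 0 ≤ x →
        Filter.Tendsto (fun ε : ℝ => (x + ε) ^ α) (nhdsWithin 0 (Ioi 0)) (nhds (x ^ α)) := by
      intro x hx
      have : Filter.Tendsto (fun ε : ℝ => (x + ε) ^ α) (nhds 0) (nhds ((x + 0) ^ α)) :=
        ((Real.continuous_rpow_const h0.le).comp (continuous_const.add continuous_id)).tendsto 0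
      rw [add_zero] at this
      exact this.mono_left nhdsWithin_le_nhds
    refine le_of_tendsto_of_tendsto (hcont _ (sq_nonneg _))
      ((hcont _ (sq_nonneg _)).add_const (K * h)) ?_
    filter_upwards [self_mem_nhdsWithin] with ε hε using hreg ε hε

end InnerPath

/-! ### The filter functions as time-stepping schemes. -/

section Filters

lemma spectralFilter_natFloor_landweber (t l : ℝ) :
    spectralFilter .landweber t l = spectralFilter .landweber (⌊t⌋₊ : ℝ) l := by
  simp [spectralFilter]

lemma spectralFilter_natFloor_implicit (t l : ℝ) :
    spectralFilter .implicitIteration t l = spectralFilter .implicitIteration (⌊t⌋₊ : ℝ) l := by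
  simp [spectralFilter]

/-- An explicit Euler step for `g' = 1 - l g`, `g(0) = 0`. The next two identities are implicit
steps of length `1` and `t` for this equation, and the asymptotic filter solves it exactly. -/
lemma spectralFilter_landweber_succ (n : ℕ) (l : ℝ) :
    spectralFilter .landweber ((n + 1 : ℕ) : ℝ) l
      = spectralFilter .landweber n l + (1 - l * spectralFilter .landweber n l) := by
  simp only [spectralFilter, Nat.floor_natCast]
  have h := geom_sum_succ (x := 1 - l) (n := n)
  rw [h]
  ring

lemma spectralFilter_implicit_succ (n : ℕ) {l : ℝ} (hl : 0 ≤ l) :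
    spectralFilter .implicitIteration ((n + 1 : ℕ) : ℝ) l
      = spectralFilter .implicitIteration n l
        + (1 - l * spectralFilter .implicitIteration ((n + 1 : ℕ) : ℝ) l) := by
  simp only [spectralFilter, Nat.floor_natCast]
  have h1 : (1 + l) ≠ 0 := by positivity
  have key : ∀ n : ℕ, l * ∑ j ∈ Finset.Icc 1 n, ((1 + l) ^ j)⁻¹ = 1 - ((1 + l) ^ n)⁻¹ := by
    intro n
    induction n with
    | zero => simp
    | succ n ih =>
      rw [Finset.sum_Icc_succ_top (by omega), mul_add, ih]
      field_simp
      ring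
  rw [key, Finset.sum_Icc_succ_top (by omega)]
  ring

lemma spectralFilter_tikhonov_eq {t l : ℝ} (ht : 0 < t) (hl : 0 ≤ l) :
    spectralFilter .tikhonov t l = t * (1 - l * spectralFilter .tikhonov t l) := by
  simp only [spectralFilter]
  have : 1 / t + l ≠ 0 := by positivity
  field_simp
  ring

lemma one_sub_mul_spectralFilter_asymptotic (t l : ℝ) :
    1 - l * spectralFilter .asymptotic t l = Real.exp (-(t * l)) := by
  simp only [spectralFilter]
  split_ifs with h
  · simp [h]
  · field_simp
    ring

/-- The flow restarted at time `a`, with the remaining residual `exp (-a l)` as the new right-hand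
side. -/
lemma spectralFilter_asymptotic_add (a d l : ℝ) :
    spectralFilter .asymptotic (a + d) l = spectralFilter .asymptotic a l
      + Real.exp (-(a * l)) * spectralFilter .asymptotic d l := by
  simp only [spectralFilter]
  split_ifs with h
  · simp [h]
  · have : Real.exp (-((a + d) * l)) = Real.exp (-(a * l)) * Real.exp (-(d * l)) := by
      rw [← Real.exp_add]; ring_nf
    rw [this]
    field_simp
    ring

lemma spectralFilter_asymptotic_mem {d l : ℝ} (hd : 0 ≤ d) (hl : 0 ≤ l) :
    d - l * d ^ 2 ≤ spectralFilter .asymptotic d l ∧ spectralFilter .asymptotic d l ≤ d := by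
  rcases hl.eq_or_lt with rfl | hl'
  · simp [spectralFilter]
  simp only [spectralFilter, hl'.ne', if_false]
  have hx : 0 ≤ d * l := by positivity
  constructor
  · rw [le_div_iff₀ hl']
    have h1 : Real.exp (-(d * l)) ≤ (1 + d * l)⁻¹ := by
      rw [Real.exp_neg]
      have := Real.add_one_le_exp (d * l)
      exact inv_anti₀ (by positivity) (by linarith)
    have h2 : (1 + d * l)⁻¹ ≤ 1 - d * l + (d * l) ^ 2 := by
      rw [inv_le_iff_one_le_mul₀ (by positivity)]
      nlinarith [pow_nonneg hx 3]
    nlinarith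
  · rw [div_le_iff₀ hl']
    have := Real.add_one_le_exp (-(d * l))
    linarith

/-- The residual functions `1 - l g_t(l)` take values in `[0, 1]`. -/
lemma one_sub_mul_spectralFilter_mem (m : InnerScheme) {t l : ℝ} (ht : 0 < t) (h0 : 0 ≤ l)
    (h1 : l ≤ 1) : 1 - l * spectralFilter m t l ∈ Icc (0 : ℝ) 1 := by
  cases m with
  | landweber =>
    rw [spectralFilter_natFloor_landweber]
    induction ⌊t⌋₊ with
    | zero => simp [spectralFilter]
    | succ n ih =>
      rw [spectralFilter_landweber_succ]
      have : 1 - l * (spectralFilter .landweber n l + (1 - l * spectralFilter .landweber n l))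
        = (1 - l) * (1 - l * spectralFilter .landweber n l) := by ring
      rw [this]
      exact ⟨mul_nonneg (by linarith) ih.1, mul_le_one₀ (by linarith) ih.1 ih.2⟩
  | implicitIteration =>
    rw [spectralFilter_natFloor_implicit]
    induction ⌊t⌋₊ with
    | zero => simp [spectralFilter]
    | succ n ih =>
      have := spectralFilter_implicit_succ n h0
      set g := spectralFilter .implicitIteration ((n + 1 : ℕ) : ℝ) l
      have h2 : (1 - l * g) * (1 + l) = 1 - l * spectralFilter .implicitIteration n l := by
        linear_combination -l * this
      obtain ⟨h3, h4⟩ := ih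
      rw [← h2] at h3 h4
      have h5 : 0 ≤ 1 - l * g := nonneg_of_mul_nonneg_left h3 (by linarith)
      exact ⟨h5, by nlinarith⟩
  | asymptotic =>
    rw [one_sub_mul_spectralFilter_asymptotic]
    exact ⟨(Real.exp_pos _).le, Real.exp_le_one_iff.2 (by nlinarith)⟩
  | tikhonov =>
    have := spectralFilter_tikhonov_eq ht h0
    set g := spectralFilter .tikhonov t l
    have h2 : (1 - l * g) * (1 + l * t) = 1 := by linear_combination -l * this
    have h3 : 0 ≤ l * t := by positivity
    have h5 : 0 ≤ 1 - l * g :=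
      nonneg_of_mul_nonneg_left (b := 1 + l * t) (by rw [h2]; exact zero_le_one) (by linarith)
    exact ⟨h5, by nlinarith⟩

lemma continuousOn_spectralFilter (m : InnerScheme) {t : ℝ} (ht : 0 < t) {s : Set ℝ}
    (hs : s ⊆ Ici 0) : ContinuousOn (spectralFilter m t) s := by
  cases m with
  | landweber => exact Continuous.continuousOn (by unfold spectralFilter; fun_prop)
  | implicitIteration =>
    refine continuousOn_finsetSum _ fun j _ => ContinuousOn.inv₀ (by fun_prop) fun l hl => ?_
    have : (0 : ℝ) ≤ l := hs hl
    positivity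
  | asymptotic =>
    -- With the value `t` at `0` the filter is a difference quotient of a differentiable function,
    -- completed by its derivative.
    have h : spectralFilter .asymptotic t = dslope (fun l => -Real.exp (-(t * l))) 0 := by
      have hd : HasDerivAt (fun l => -Real.exp (-(t * l))) t 0 := by
        have h1 : HasDerivAt (fun l : ℝ => -(t * l)) (-(t * 1)) 0 :=
          ((hasDerivAt_id (0 : ℝ)).const_mul t).neg
        have h2 := h1.exp.neg
        simp only [mul_zero, neg_zero, Real.exp_zero, mul_one, one_mul, neg_neg] at h2
        exact h2
      ext l
      rcases eq_or_ne l 0 with rfl | hl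
      · rw [dslope_same, hd.deriv]; simp [spectralFilter]
      · rw [dslope_of_ne _ hl, slope_def_field]
        simp only [spectralFilter, hl, if_false, mul_zero, neg_zero, Real.exp_zero, sub_zero]
        ring
    rw [h]
    have hdiff : Differentiable ℝ (fun l => -Real.exp (-(t * l))) := by fun_prop
    refine fun l _ => ContinuousAt.continuousWithinAt ?_
    rcases eq_or_ne l 0 with rfl | hl
    · exact continuousAt_dslope_same.2 (hdiff 0)
    · exact (continuousAt_dslope_of_ne hl).2 (hdiff l).continuousAt
  | tikhonov =>
    refine ContinuousOn.inv₀ (by fun_prop) fun l hl => ?_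
    have : (0 : ℝ) ≤ l := hs hl
    positivity

/-- The schemes with a continuous time parameter have filters that are Lipschitz in time. -/
lemma abs_spectralFilter_sub_le {m : InnerScheme} (hm : m = .asymptotic ∨ m = .tikhonov)
    {a b l : ℝ} (ha : 0 < a) (hab : a ≤ b) (hl : 0 ≤ l) :
    |spectralFilter m b l - spectralFilter m a l| ≤ b - a := by
  rcases hm with rfl | rfl
  · have h1 := spectralFilter_asymptotic_add a (b - a) l
    rw [add_sub_cancel] at h1
    have h2 := (spectralFilter_asymptotic_mem (sub_nonneg.2 hab) hl).2
    have h3 : 0 ≤ spectralFilter .asymptotic (b - a) l := by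
      simp only [spectralFilter]
      split_ifs with h
      · linarith
      · refine div_nonneg (sub_nonneg.2 (Real.exp_le_one_iff.2 ?_)) hl
        nlinarith
    have h4 : Real.exp (-(a * l)) ≤ 1 := Real.exp_le_one_iff.2 (by nlinarith)
    have h5 := Real.exp_pos (-(a * l))
    rw [h1, add_sub_cancel_left, abs_of_nonneg (mul_nonneg h5.le h3)]
    nlinarith
  · have hb : 0 < b := ha.trans_le hab
    have key : ∀ t : ℝ, 0 < t → spectralFilter .tikhonov t l = t / (1 + t * l) := fun t ht => by
      simp only [spectralFilter]
      have : 1 / t + l ≠ 0 := by positivity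
      field_simp
    have h1 : spectralFilter .tikhonov b l - spectralFilter .tikhonov a l
        = (b - a) / ((1 + b * l) * (1 + a * l)) := by
      rw [key a ha, key b hb]
      have : 1 + a * l ≠ 0 := by positivity
      have : 1 + b * l ≠ 0 := by positivity
      field_simp
      ring
    have hal : 0 ≤ a * l := by positivity
    have hbl : 0 ≤ b * l := by positivity
    rw [h1, abs_of_nonneg (div_nonneg (sub_nonneg.2 hab) (by positivity))]
    exact div_le_self (sub_nonneg.2 hab) (by nlinarith)

end Filters

/-! ### The inner schemes as inner paths; existence of stopping times. -/

section Schemes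

variable {𝕜 Y : Type*} [RCLike 𝕜]
  [NormedAddCommGroup Y] [InnerProductSpace 𝕜 Y]

/-- The dual variable `g_t(H) r` of an inner scheme. -/
noncomputable def dualSolution (m : InnerScheme) (H : Y →L[𝕜] Y) (r : Y) (t : ℝ) : Y :=
  opFun (spectralFilter m t) H r

variable {H : Y →L[𝕜] Y} {r : Y} {m : InnerScheme} {η : ℝ}

lemma contOn_filter (m : InnerScheme) (H : Y →L[𝕜] Y) {t : ℝ} (ht : 0 < t) :
    ContinuousOn (spectralFilter m t) (Icc 0 ‖H‖) :=
  continuousOn_spectralFilter m ht fun _ hl => hl.1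

lemma contOn_asymptotic (H : Y →L[𝕜] Y) {t : ℝ} (ht : 0 ≤ t) :
    ContinuousOn (spectralFilter .asymptotic t) (Icc 0 ‖H‖) := by
  rcases ht.eq_or_lt with rfl | ht
  · have : spectralFilter .asymptotic 0 = fun _ => 0 := by
      ext l
      simp [spectralFilter]
    rw [this]
    exact continuousOn_const
  · exact contOn_filter _ H ht

lemma contOn_landweber (H : Y →L[𝕜] Y) (t : ℝ) :
    ContinuousOn (spectralFilter .landweber t) (Icc 0 ‖H‖) :=
  Continuous.continuousOn (by unfold spectralFilter; fun_prop)

lemma contOn_implicit (H : Y →L[𝕜] Y) (t : ℝ) :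
    ContinuousOn (spectralFilter .implicitIteration t) (Icc 0 ‖H‖) := by
  refine continuousOn_finsetSum _ fun j _ => ContinuousOn.inv₀ (by fun_prop) fun l hl => ?_
  have : (0 : ℝ) ≤ l := hl.1
  positivity

lemma dualSolution_asymptotic_zero (hH : H.IsPositive) : dualSolution .asymptotic H r 0 = 0 := by
  have : spectralFilter .asymptotic 0 = fun _ => 0 := by
    ext l
    simp [spectralFilter]
  rw [dualSolution, this, opFun_const_apply hH]
  simp

lemma dualSolution_landweber_zero (hH : H.IsPositive) :
    dualSolution .landweber H r ((0 : ℕ) : ℝ) = 0 := by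
  have : spectralFilter .landweber ((0 : ℕ) : ℝ) = fun _ => 0 := by
    ext l
    simp [spectralFilter]
  rw [dualSolution, this, opFun_const_apply hH]
  simp

lemma dualSolution_implicit_zero (hH : H.IsPositive) :
    dualSolution .implicitIteration H r ((0 : ℕ) : ℝ) = 0 := by
  have : spectralFilter .implicitIteration ((0 : ℕ) : ℝ) = fun _ => 0 := by
    ext l
    simp [spectralFilter]
  rw [dualSolution, this, opFun_const_apply hH]
  simp

/-- The schemes whose time parameter only matters through its integer part. -/
def InnerScheme.IsDiscrete (m : InnerScheme) : Prop := m = .landweber ∨ m = .implicitIteration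

lemma dualSolution_natFloor (hm : m.IsDiscrete) (t : ℝ) :
    dualSolution m H r t = dualSolution m H r (⌊t⌋₊ : ℝ) := by
  rcases hm with rfl | rfl
  · rw [dualSolution, dualSolution, funext (spectralFilter_natFloor_landweber t)]
  · rw [dualSolution, dualSolution, funext (spectralFilter_natFloor_implicit t)]

lemma dualSolution_discrete_zero (hm : m.IsDiscrete) (hH : H.IsPositive) :
    dualSolution m H r ((0 : ℕ) : ℝ) = 0 := by
  rcases hm with rfl | rfl
  · exact dualSolution_landweber_zero hH
  · exact dualSolution_implicit_zero hH

/-- The set of inner times at which the relative residual is at most `η`. -/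
def stoppingTimes (m : InnerScheme) (H : Y →L[𝕜] Y) (r : Y) (η : ℝ) : Set ℝ :=
  {s | 0 < s ∧ ‖r - H (dualSolution m H r s)‖ ≤ η * ‖r‖}

/-- Rounding down cannot give `0`, where the relative residual is `1 > η`. A smallest stopping time
of a discrete scheme is therefore an integer. -/
lemma floor_mem_stoppingTimes (hm : m.IsDiscrete) (hH : H.IsPositive) (hη1 : η < 1) (hr : r ≠ 0)
    {s : ℝ} (hs : s ∈ stoppingTimes m H r η) : (⌊s⌋₊ : ℝ) ∈ stoppingTimes m H r η := by
  obtain ⟨hs0, hs1⟩ := hs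
  rw [dualSolution_natFloor hm] at hs1
  refine ⟨?_, hs1⟩
  rw [Nat.cast_pos]
  by_contra h0
  have h0' : ⌊s⌋₊ = 0 := by omega
  rw [h0', dualSolution_discrete_zero hm hH, map_zero, sub_zero] at hs1
  have := norm_pos_iff.2 hr
  nlinarith

variable [CompleteSpace Y]

lemma opFun_one_sub_mul_apply (hH : H.IsPositive) {g : ℝ → ℝ} (hg : ContinuousOn g (Icc 0 ‖H‖))
    (r : Y) : opFun (fun l => 1 - l * g l) H r = r - H (opFun g H r) := by
  have hm : ContinuousOn (fun l => l * g l) (Icc 0 ‖H‖) := continuousOn_id.mul hg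
  rw [opFun_sub hH (f := fun _ => 1) continuousOn_const hm, opFun_one hH,
    opFun_mul hH (f := fun l => l) continuousOn_id hg, opFun_id hH]
  rfl

lemma norm_residual_le (hH : H.IsPositive) (hH1 : ‖H‖ ≤ 1) {t : ℝ} (ht : 0 < t) :
    ‖r - H (dualSolution m H r t)‖ ≤ ‖r‖ := by
  have hg := contOn_filter m H ht
  rw [dualSolution, ← opFun_one_sub_mul_apply hH hg]
  have h : ‖opFun (fun l => 1 - l * spectralFilter m t l) H‖ ≤ 1 :=
    norm_opFun_le hH (continuousOn_const.sub (continuousOn_id.mul hg)) fun l hl => by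
      have := one_sub_mul_spectralFilter_mem m ht hl.1 (hl.2.trans hH1)
      exact (abs_of_nonneg this.1).trans_le this.2
  simpa using (opFun (fun l => 1 - l * spectralFilter m t l) H).le_of_opNorm_le h r

lemma norm_dualSolution_sub_le (hm : m = .asymptotic ∨ m = .tikhonov) (hH : H.IsPositive)
    {a b : ℝ} (ha : 0 < a) (hab : a ≤ b) :
    ‖dualSolution m H r b - dualSolution m H r a‖ ≤ (b - a) * ‖r‖ := by
  have hga := contOn_filter m H ha
  have hgb := contOn_filter m H (ha.trans_le hab)
  have h1 : dualSolution m H r b - dualSolution m H r a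
      = opFun (fun l => spectralFilter m b l - spectralFilter m a l) H r := by
    rw [opFun_sub hH hgb hga]; rfl
  rw [h1]
  exact ContinuousLinearMap.le_of_opNorm_le _ (norm_opFun_le hH (hgb.sub hga) fun l hl =>
    abs_spectralFilter_sub_le hm ha hab hl.1) r

lemma norm_dualSolution_le (hm : m = .asymptotic ∨ m = .tikhonov) (hH : H.IsPositive)
    {t : ℝ} (ht : 0 < t) : ‖dualSolution m H r t‖ ≤ t * ‖r‖ := by
  refine ContinuousLinearMap.le_of_opNorm_le _ (norm_opFun_le hH (contOn_filter m H ht)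
    fun l hl => ?_) r
  rcases hm with rfl | rfl
  · rw [abs_of_nonneg]
    · exact (spectralFilter_asymptotic_mem ht.le hl.1).2
    · simp only [spectralFilter]
      split_ifs with h
      · exact ht.le
      · refine div_nonneg (sub_nonneg.2 (Real.exp_le_one_iff.2 ?_)) hl.1
        nlinarith [hl.1]
  · have hpos : 0 < 1 / t + l := add_pos_of_pos_of_nonneg (by positivity) hl.1
    simp only [spectralFilter]
    rw [abs_of_nonneg (by positivity), inv_le_comm₀ hpos ht, ← one_div]
    linarith [hl.1]

/-- The estimate required by `InnerPath.flow`, with `C = ‖r‖`. Up to sign the filter error is `exp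
(-a l)` times `d - g_d(l)` with `d = b - a`, and `d - g_d(l) ≤ l d ^ 2 ≤ d ^ 2`. -/
lemma dualSolution_asymptotic_increment (hH : H.IsPositive) (hH1 : ‖H‖ ≤ 1) {a b : ℝ} (ha : 0 ≤ a)
    (hab : a ≤ b) :
    ‖dualSolution .asymptotic H r b - dualSolution .asymptotic H r a
      - ((b - a : ℝ) : 𝕜) • (r - H (dualSolution .asymptotic H r a))‖ ≤ ‖r‖ * (b - a) ^ 2 := by
  have hga := contOn_asymptotic H ha
  have hgb := contOn_asymptotic H (ha.trans hab)
  have hres : ContinuousOn (fun l => 1 - l * spectralFilter .asymptotic a l) (Icc 0 ‖H‖) :=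
    continuousOn_const.sub (continuousOn_id.mul hga)
  have hsm : ContinuousOn (fun l => (b - a) * (1 - l * spectralFilter .asymptotic a l))
    (Icc 0 ‖H‖) := continuousOn_const.mul hres
  have hsub : ContinuousOn (fun l => spectralFilter .asymptotic b l - spectralFilter .asymptotic a l)
    (Icc 0 ‖H‖) := hgb.sub hga
  have h1 : dualSolution .asymptotic H r b - dualSolution .asymptotic H r a
      - ((b - a : ℝ) : 𝕜) • (r - H (dualSolution .asymptotic H r a))
      = opFun (fun l => (spectralFilter .asymptotic b l - spectralFilter .asymptotic a l)
        - (b - a) * (1 - l * spectralFilter .asymptotic a l)) H r := by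
    rw [opFun_sub hH hsub hsm, opFun_sub hH hgb hga,
      opFun_mul hH (f := fun _ => b - a) continuousOn_const hres, sub_apply, sub_apply,
      mul_apply_eq_comp, opFun_one_sub_mul_apply hH hga, opFun_const_apply hH]
    rfl
  rw [h1, mul_comm]
  refine ContinuousLinearMap.le_of_opNorm_le _ (norm_opFun_le hH (hsub.sub hsm)
    fun l hl => ?_) r
  have hd := sub_nonneg.2 hab
  have h2 := spectralFilter_asymptotic_add a (b - a) l
  rw [add_sub_cancel] at h2
  obtain ⟨h3, h4⟩ := spectralFilter_asymptotic_mem hd hl.1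
  have h5 : Real.exp (-(a * l)) ≤ 1 := Real.exp_le_one_iff.2 (by nlinarith [hl.1])
  have h6 := Real.exp_pos (-(a * l))
  change |spectralFilter .asymptotic b l - spectralFilter .asymptotic a l
    - (b - a) * (1 - l * spectralFilter .asymptotic a l)| ≤ (b - a) ^ 2
  rw [h2, one_sub_mul_spectralFilter_asymptotic, add_sub_cancel_left,
    show Real.exp (-(a * l)) * spectralFilter .asymptotic (b - a) l
      - (b - a) * Real.exp (-(a * l))
      = -(Real.exp (-(a * l)) * ((b - a) - spectralFilter .asymptotic (b - a) l)) by ring,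
    abs_neg, abs_of_nonneg (mul_nonneg h6.le (by linarith))]
  have h7 : (b - a) - spectralFilter .asymptotic (b - a) l ≤ (b - a) ^ 2 := by
    nlinarith [hl.2.trans hH1, sq_nonneg (b - a)]
  nlinarith

lemma norm_residual_asymptotic_le (hH : H.IsPositive) (hH1 : ‖H‖ ≤ 1) {t : ℝ} (ht : 0 ≤ t) :
    ‖r - H (dualSolution .asymptotic H r t)‖ ≤ ‖r‖ := by
  rcases ht.eq_or_lt with rfl | ht
  · simp [dualSolution_asymptotic_zero hH]
  · exact norm_residual_le hH hH1 ht

lemma dualSolution_landweber_succ (hH : H.IsPositive) (n : ℕ) :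
    dualSolution .landweber H r ((n + 1 : ℕ) : ℝ) = dualSolution .landweber H r n
      + (r - H (dualSolution .landweber H r n)) := by
  have hg := contOn_landweber H n
  have hres : ContinuousOn (fun l => 1 - l * spectralFilter .landweber n l) (Icc 0 ‖H‖) :=
    continuousOn_const.sub (continuousOn_id.mul hg)
  rw [dualSolution, funext (spectralFilter_landweber_succ n), opFun_add hH hg hres, add_apply,
    opFun_one_sub_mul_apply hH hg]
  rfl

lemma dualSolution_implicit_succ (hH : H.IsPositive) (n : ℕ) :
    dualSolution .implicitIteration H r ((n + 1 : ℕ) : ℝ) = dualSolution .implicitIteration H r n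
      + (r - H (dualSolution .implicitIteration H r ((n + 1 : ℕ) : ℝ))) := by
  have hg := contOn_implicit H n
  have hg' := contOn_implicit H ((n + 1 : ℕ) : ℝ)
  have hres : ContinuousOn
      (fun l => 1 - l * spectralFilter .implicitIteration ((n + 1 : ℕ) : ℝ) l) (Icc 0 ‖H‖) :=
    continuousOn_const.sub (continuousOn_id.mul hg')
  have h := opFun_congr hH hg' (g := fun l => spectralFilter .implicitIteration n l
    + (1 - l * spectralFilter .implicitIteration ((n + 1 : ℕ) : ℝ) l))
    fun l hl => spectralFilter_implicit_succ n hl.1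
  rw [opFun_add hH hg hres] at h
  have h' := congrArg (fun G : Y →L[𝕜] Y => G r) h
  simp only [add_apply] at h'
  rw [opFun_one_sub_mul_apply hH hg'] at h'
  exact h'.symm

lemma dualSolution_tikhonov_eq (hH : H.IsPositive) {t : ℝ} (ht : 0 < t) :
    dualSolution .tikhonov H r t = (t : 𝕜) • (r - H (dualSolution .tikhonov H r t)) := by
  have hg := contOn_filter .tikhonov H ht
  have hres : ContinuousOn (fun l => 1 - l * spectralFilter .tikhonov t l) (Icc 0 ‖H‖) :=
    continuousOn_const.sub (continuousOn_id.mul hg)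
  have h := opFun_congr hH hg (g := fun l => t * (1 - l * spectralFilter .tikhonov t l))
    fun l hl => spectralFilter_tikhonov_eq ht hl.1
  rw [opFun_mul hH (f := fun _ => t) continuousOn_const hres] at h
  have h' := congrArg (fun G : Y →L[𝕜] Y => G r) h
  rw [mul_apply_eq_comp, opFun_const_apply hH, opFun_one_sub_mul_apply hH hg] at h'
  exact h'.symm

lemma innerPath_natCast (hm : m.IsDiscrete) (hH : H.IsPositive) (hH1 : ‖H‖ ≤ 1) (hη1 : η ≤ 1)
    (n : ℕ) (h : ∀ k : ℕ, 0 < k → k < n → η * ‖r‖ ≤ ‖r - H (dualSolution m H r k)‖) :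
    InnerPath H r η n (dualSolution m H r n) := by
  induction n with
  | zero =>
    rw [dualSolution_discrete_zero hm hH, Nat.cast_zero]
    exact .start
  | succ n ih =>
    have ih' := ih fun k hk hkn => h k hk (by omega)
    have hlow : η * ‖r‖ ≤ ‖r - H (dualSolution m H r n)‖ := by
      rcases Nat.eq_zero_or_pos n with rfl | hn
      · rw [dualSolution_discrete_zero hm hH]
        simp only [map_zero, sub_zero]
        nlinarith [norm_nonneg r]
      · exact h n hn (by omega)
    rcases hm with rfl | rfl
    · have hup : ‖r - H (dualSolution .landweber H r n)‖ ≤ ‖r‖ := by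
        rcases Nat.eq_zero_or_pos n with rfl | hn
        · rw [dualSolution_landweber_zero hH]; simp
        · exact norm_residual_le hH hH1 (Nat.cast_pos.2 hn)
      rw [dualSolution_landweber_succ hH, Nat.cast_succ]
      exact ih'.explicit hlow hup
    · have hstep := dualSolution_implicit_succ (r := r) hH n
      set v' := dualSolution .implicitIteration H r ((n + 1 : ℕ) : ℝ) with hv'
      have hup : ‖r - H v'‖ ≤ ‖r‖ := norm_residual_le hH hH1 (Nat.cast_pos.2 n.succ_pos)
      -- Residuals `s` before and `s'` after an implicit step satisfy `s = s' + H s'`, so `‖s‖ ≤ 2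
      -- ‖s'‖`: hence the `η / 2` in `InnerPath.implicit`.
      have hrel : r - H (dualSolution .implicitIteration H r n) = (r - H v') + H (r - H v') := by
        have h2 : dualSolution .implicitIteration H r n = v' - (r - H v') :=
          eq_sub_of_add_eq hstep.symm
        rw [h2, map_sub]
        abel
      rw [hrel] at hlow
      have h3 : ‖H (r - H v')‖ ≤ 1 * ‖r - H v'‖ := H.le_of_opNorm_le hH1 _
      have h4 := norm_add_le (r - H v') (H (r - H v'))
      rw [Nat.cast_succ]
      refine ih'.implicit zero_le_one ?_ (by linarith) hup
      rw [RCLike.ofReal_one, one_smul]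
      exact hstep

lemma innerPath_dualSolution (m : InnerScheme) (hH : H.IsPositive) (hH1 : ‖H‖ ≤ 1) (hη0 : 0 < η)
    (hη1 : η ≤ 1) {t : ℝ} (ht : 0 < t) (hmt : m.IsDiscrete → (⌊t⌋₊ : ℝ) = t)
    (h : ∀ s, 0 < s → s < t → η * ‖r‖ ≤ ‖r - H (dualSolution m H r s)‖) :
    InnerPath H r η t (dualSolution m H r t) := by
  by_cases hm : m.IsDiscrete
  · rw [← hmt hm]
    refine innerPath_natCast hm hH hH1 hη1 _ fun k hk hkn => h k (Nat.cast_pos.2 hk) ?_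
    rw [← hmt hm]
    exact Nat.cast_lt.2 hkn
  cases m with
  | landweber => exact absurd (Or.inl rfl) hm
  | implicitIteration => exact absurd (Or.inr rfl) hm
  | asymptotic =>
    have hstart : InnerPath H r η 0 (dualSolution .asymptotic H r 0) := by
      rw [dualSolution_asymptotic_zero hH]
      exact .start
    have := hstart.flow ht.le (norm_nonneg r)
      (fun a b ha hab => dualSolution_asymptotic_increment hH hH1 ha hab)
      (fun a ha hat => by
        rcases ha.eq_or_lt with rfl | ha'
        · rw [dualSolution_asymptotic_zero hH]
          simp only [map_zero, sub_zero]
          nlinarith [norm_nonneg r]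
        · exact h a ha' hat)
      (fun a ha => norm_residual_asymptotic_le hH hH1 ha)
    rwa [zero_add] at this
  | tikhonov =>
    have hlow : η / 2 * ‖r‖ ≤ ‖r - H (dualSolution .tikhonov H r t)‖ := by
      -- The residual is `‖r‖`-Lipschitz in time, so stepping back by at most `η / 2` changes it by
      -- at most `η / 2 * ‖r‖`. The maximum keeps `s` positive.
      set s := max (t / 2) (t - η / 2) with hs
      have hs0 : 0 < s := lt_max_of_lt_left (by linarith)
      have hst : s < t := max_lt (by linarith) (by linarith)
      have hts : t - s ≤ η / 2 := by linarith [le_max_right (t / 2) (t - η / 2)]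
      have h1 := h s hs0 hst
      have h2 := norm_dualSolution_sub_le (r := r) (Or.inr rfl) hH hs0 hst.le (m := .tikhonov)
      have h3 := H.le_of_opNorm_le hH1
        (dualSolution .tikhonov H r t - dualSolution .tikhonov H r s)
      have h4 := norm_add_le (r - H (dualSolution .tikhonov H r t))
        (H (dualSolution .tikhonov H r t - dualSolution .tikhonov H r s))
      have h5 : r - H (dualSolution .tikhonov H r t)
          + H (dualSolution .tikhonov H r t - dualSolution .tikhonov H r s)
          = r - H (dualSolution .tikhonov H r s) := by rw [map_sub]; abel
      rw [h5] at h4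
      nlinarith [norm_nonneg r]
    have := InnerPath.start.implicit (H := H) (r := r) (η := η) ht.le
      (v' := dualSolution .tikhonov H r t)
      (by rw [zero_add]; exact dualSolution_tikhonov_eq hH ht) hlow (norm_residual_le hH hH1 ht)
    rwa [zero_add] at this

lemma innerPath_of_isLeast (hH : H.IsPositive) (hH1 : ‖H‖ ≤ 1) (hη0 : 0 < η) (hη1 : η < 1)
    (hr : r ≠ 0) {t : ℝ} (ht : IsLeast (stoppingTimes m H r η) t) :
    InnerPath H r η t (dualSolution m H r t) := by
  refine innerPath_dualSolution m hH hH1 hη0 hη1.le ht.1.1 (fun hm => ?_) fun s hs0 hst => ?_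
  · exact le_antisymm (Nat.floor_le ht.1.1.le) (ht.2 (floor_mem_stoppingTimes hm hH hη1 hr ht.1))
  · by_contra hlt
    exact absurd (ht.2 ⟨hs0, (not_le.1 hlt).le⟩) (not_le.2 hst)

/-- If inner paths have bounded length, then a smallest stopping time exists. -/
lemma exists_isLeast_stoppingTimes (hH : H.IsPositive) (hH1 : ‖H‖ ≤ 1) (hη0 : 0 < η) (hη1 : η < 1)
    (hr : r ≠ 0) {L : ℝ} (hL : ∀ t v, InnerPath H r η t v → t ≤ L) :
    ∃ t, IsLeast (stoppingTimes m H r η) t := by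
  have hr' : 0 < ‖r‖ := norm_pos_iff.2 hr
  have hne : (stoppingTimes m H r η).Nonempty := by
    by_contra hemp
    -- Without any stopping time every positive integer time would be reached by a path, for
    -- discrete schemes too.
    obtain ⟨n, hn⟩ := exists_nat_gt (max L 0)
    have hn0 : (0 : ℝ) < n := (le_max_right L 0).trans_lt hn
    have := innerPath_dualSolution (r := r) m hH hH1 hη0 hη1.le hn0 (fun _ => by simp)
      fun s hs _ => by
        by_contra hlt
        exact hemp ⟨s, hs, (not_le.1 hlt).le⟩
    linarith [hL _ _ this, le_max_left L 0]
  by_cases hm : m.IsDiscrete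
  · classical
    obtain ⟨s, hs⟩ := hne
    have hex : ∃ n : ℕ, (n : ℝ) ∈ stoppingTimes m H r η :=
      ⟨_, floor_mem_stoppingTimes hm hH hη1 hr hs⟩
    refine ⟨(Nat.find hex : ℝ), Nat.find_spec hex, fun s hs => ?_⟩
    have h1 := Nat.find_min' hex (floor_mem_stoppingTimes hm hH hη1 hr hs)
    exact (Nat.cast_le.2 h1).trans (Nat.floor_le hs.1.le)
  · have hm' : m = .asymptotic ∨ m = .tikhonov := by
      cases m with
      | landweber => exact absurd (Or.inl rfl) hm
      | implicitIteration => exact absurd (Or.inr rfl) hm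
      | asymptotic => exact Or.inl rfl
      | tikhonov => exact Or.inr rfl
    -- The filters with continuous time are bounded by `t`, so nothing stops before `1 - η`;
    -- closedness need only be checked away from time `0`.
    have hlow : ∀ s ∈ stoppingTimes m H r η, 1 - η ≤ s := by
      rintro s ⟨hs0, hs1⟩
      have h1 := norm_dualSolution_le (r := r) hm' hH hs0
      have h2 := H.le_of_opNorm_le hH1 (dualSolution m H r s)
      have h3 := norm_sub_norm_le r (H (dualSolution m H r s))
      have h4 : (1 - η) * ‖r‖ ≤ s * ‖r‖ := by linarith
      exact le_of_mul_le_mul_right h4 hr'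
    have hclosed : IsClosed (stoppingTimes m H r η) := by
      have heq : stoppingTimes m H r η
          = Ici (1 - η) ∩ (fun s => ‖r - H (dualSolution m H r s)‖) ⁻¹' Iic (η * ‖r‖) := by
        ext s
        constructor
        · exact fun hs => ⟨hlow s hs, hs.2⟩
        · exact fun hs => ⟨lt_of_lt_of_le (by linarith) (mem_Ici.1 hs.1), hs.2⟩
      have hcont : ContinuousOn (dualSolution m H r) (Ici (1 - η)) := by
        have hlip : LipschitzOnWith (Real.toNNReal ‖r‖) (dualSolution m H r) (Ici (1 - η)) := by
          refine LipschitzOnWith.of_dist_le_mul fun a ha b hb => ?_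
          rw [Real.coe_toNNReal _ (norm_nonneg r), dist_eq_norm, Real.dist_eq]
          have ha' : 0 < a := lt_of_lt_of_le (by linarith) (mem_Ici.1 ha)
          have hb' : 0 < b := lt_of_lt_of_le (by linarith) (mem_Ici.1 hb)
          rcases le_total a b with hab | hab
          · rw [norm_sub_rev, abs_sub_comm, abs_of_nonneg (sub_nonneg.2 hab), mul_comm]
            exact norm_dualSolution_sub_le hm' hH ha' hab
          · rw [abs_of_nonneg (sub_nonneg.2 hab), mul_comm]
            exact norm_dualSolution_sub_le hm' hH hb' hab
        exact hlip.continuousOn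
      have hcont' : ContinuousOn (fun s => ‖r - H (dualSolution m H r s)‖) (Ici (1 - η)) := by
        fun_prop
      rw [heq]
      exact hcont'.preimage_isClosed_of_isClosed isClosed_Ici isClosed_Iic
    exact ⟨_, hclosed.csInf_mem hne ⟨_, fun s hs => hlow s hs⟩,
      fun s hs => csInf_le ⟨_, fun s hs => hlow s hs⟩ hs⟩

end Schemes

/-! ### Young's inequality for the source growth. -/

section Scalar

/-- The form of Young's inequality behind the growth bound for source elements. -/
lemma mul_sub_mul_sq_le {X w a f k μ α : ℝ} (hX : 0 ≤ X) (hw : 0 ≤ w) (ha : 0 ≤ a) (hk0 : 0 < k)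
    (hk1 : k ≤ 1) (hμ0 : 0 < μ) (hμ1 : μ ≤ 1 / 2) (hα : α = 1 / (1 + 2 * μ))
    (hf : f ≤ w ^ (2 * μ) * a ^ (1 - 2 * μ)) :
    X * f - k * a ^ 2 ≤ 1 / k * (X ^ (2 * α) * (w ^ 2) ^ (1 - α)) := by
  have hμ' : 0 < 1 + 2 * μ := by linarith
  have hα0 : 0 < α := by rw [hα]; positivity
  have hα1 : α ≤ 1 := by rw [hα, div_le_one hμ']; linarith
  set Z := X / k * w ^ (2 * μ) with hZ
  have hZ0 : 0 ≤ Z := by positivity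
  -- Split at `Z = a ^ (1 + 2 μ)`, where both terms on the right agree; the exponents fit because `1
  -- + α (1 - 2 μ) = 2 α`.
  have hyoung : Z * a ^ (1 - 2 * μ) ≤ a ^ 2 + Z ^ (2 * α) := by
    by_cases hcase : Z ≤ a ^ (1 + 2 * μ)
    · have h1 : Z * a ^ (1 - 2 * μ) ≤ a ^ (1 + 2 * μ) * a ^ (1 - 2 * μ) :=
        mul_le_mul_of_nonneg_right hcase (by positivity)
      rw [← Real.rpow_add_of_nonneg ha hμ'.le (by linarith)] at h1
      have h2 : (1 + 2 * μ) + (1 - 2 * μ) = (2 : ℝ) := by ring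
      rw [h2, Real.rpow_two] at h1
      have : 0 ≤ Z ^ (2 * α) := by positivity
      linarith
    · push Not at hcase
      have h1 : a ≤ Z ^ α := by
        have h2 := Real.rpow_le_rpow (by positivity) hcase.le hα0.le
        rwa [← Real.rpow_mul ha, hα, mul_one_div_cancel hμ'.ne', Real.rpow_one, ← hα] at h2
      have h3 : a ^ (1 - 2 * μ) ≤ (Z ^ α) ^ (1 - 2 * μ) :=
        Real.rpow_le_rpow ha h1 (by linarith)
      have hZpos : 0 < Z := lt_of_le_of_lt (by positivity) hcase
      have h4 : Z * (Z ^ α) ^ (1 - 2 * μ) = Z ^ (2 * α) := by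
        rw [← Real.rpow_mul hZ0, mul_comm, ← Real.rpow_add_one hZpos.ne']
        congr 1
        rw [hα]
        field_simp
        ring
      have h5 := mul_le_mul_of_nonneg_left h3 hZ0
      nlinarith [sq_nonneg a]
  have hZpow : Z ^ (2 * α) = X ^ (2 * α) * (1 / k) ^ (2 * α) * (w ^ 2) ^ (1 - α) := by
    rw [hZ, Real.mul_rpow (by positivity) (by positivity), div_eq_mul_one_div,
      Real.mul_rpow hX (by positivity), ← Real.rpow_mul hw, ← Real.rpow_natCast w 2,
      ← Real.rpow_mul hw]
    congr 2
    rw [hα]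
    push_cast
    field_simp
    ring
  have hkpow : (1 / k) ^ (2 * α) ≤ (1 / k) ^ (2 : ℝ) :=
    Real.rpow_le_rpow_of_exponent_le (by rw [le_div_iff₀ hk0]; linarith) (by linarith)
  rw [Real.rpow_two] at hkpow
  have h6 : X * f ≤ k * (Z * a ^ (1 - 2 * μ)) := by
    have : k * (Z * a ^ (1 - 2 * μ)) = X * (w ^ (2 * μ) * a ^ (1 - 2 * μ)) := by
      rw [hZ]; field_simp
    rw [this]
    exact mul_le_mul_of_nonneg_left hf hX
  have h7 := mul_le_mul_of_nonneg_left hyoung hk0.le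
  have h8 : k * Z ^ (2 * α) ≤ 1 / k * (X ^ (2 * α) * (w ^ 2) ^ (1 - α)) := by
    rw [hZpow]
    have h9 : 0 ≤ X ^ (2 * α) * (w ^ 2) ^ (1 - α) := by positivity
    have h10 := mul_le_mul_of_nonneg_left hkpow (mul_nonneg hk0.le h9)
    have h11 : k * (X ^ (2 * α) * (w ^ 2) ^ (1 - α)) * (1 / k) ^ 2
      = 1 / k * (X ^ (2 * α) * (w ^ 2) ^ (1 - α)) := by field_simp
    linarith
  linarith

end Scalar

/-! ### Error and source element during one inner iteration. -/

section NewtonStep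

variable {𝕜 X Y : Type*} [RCLike 𝕜]
  [NormedAddCommGroup X] [InnerProductSpace 𝕜 X] [CompleteSpace X]
  [NormedAddCommGroup Y] [InnerProductSpace 𝕜 Y] [CompleteSpace Y]

open ContinuousLinearMap (adjoint)

lemma innerSolution_eq (m : InnerScheme) (T : X →L[𝕜] Y) (r : Y) {t : ℝ} (ht : 0 < t) :
    innerSolution m T r t = adjoint T (dualSolution m (gram (adjoint T)) r t) :=
  opFun_gram_adjoint T (contOn_filter m _ ht) r

lemma map_innerSolution (m : InnerScheme) (T : X →L[𝕜] Y) (r : Y) {t : ℝ} (ht : 0 < t) :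
    T (innerSolution m T r t)
      = gram (adjoint T) (dualSolution m (gram (adjoint T)) r t) := by
  rw [innerSolution_eq m T r ht, gram_adjoint_apply]

lemma norm_gram_adjoint_le_one {T : X →L[𝕜] Y} (hT : ‖T‖ ≤ 1) : ‖gram (adjoint T)‖ ≤ 1 := by
  rw [norm_gram_adjoint, norm_gram]
  exact mul_le_one₀ hT (norm_nonneg _) hT

lemma stoppingTimes_eq (m : InnerScheme) (T : X →L[𝕜] Y) (r : Y) (η : ℝ) :
    {s : ℝ | 0 < s ∧ ‖r - T (innerSolution m T r s)‖ ≤ η * ‖r‖}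
      = stoppingTimes m (gram (adjoint T)) r η := by
  ext s
  refine and_congr_right fun hs => ?_
  rw [map_innerSolution m T r hs]

/-- The error decreases along inner paths. -/
lemma InnerPath.norm_sq_add_le {T : X →L[𝕜] Y} (hT : ‖T‖ ≤ 1) {r : Y} {e : X} {η θ t : ℝ} {v : Y}
    (hη0 : 0 < η) (hθη : θ < η / 2) (hres : ‖r + T e‖ ≤ θ * ‖r‖)
    (hp : InnerPath (gram (adjoint T)) r η t v) :
    ‖e + adjoint T v‖ ^ 2 + η * (η / 2 - θ) * (t * ‖r‖ ^ 2) ≤ ‖e‖ ^ 2 := by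
  have hin : ∀ v, RCLike.re ⟪e + adjoint T v, adjoint T (r - gram (adjoint T) v)⟫_𝕜
      ≤ θ * ‖r‖ * ‖r - gram (adjoint T) v‖ - ‖r - gram (adjoint T) v‖ ^ 2 := by
    intro v
    rw [gram_adjoint_apply, ContinuousLinearMap.adjoint_inner_right]
    set s := r - T (adjoint T v) with hs
    -- With `ν = r + T e` the image of the error is `ν - s`, so the drift is `-‖s‖ ^ 2` up to the
    -- small term `⟪ν, s⟫`.
    have h1 : T (e + adjoint T v) = (r + T e) - s := by rw [map_add, hs]; abel
    rw [h1, inner_sub_left, map_sub, inner_self_eq_norm_sq]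
    have h2 := re_inner_le_norm (𝕜 := 𝕜) (r + T e) s
    have h3 := mul_le_mul_of_nonneg_right hres (norm_nonneg s)
    linarith
  have h := hp.energy (adjoint T) e (α := 1) (K := -(η * (η / 2 - θ) * ‖r‖ ^ 2)) one_pos le_rfl
    (Or.inr rfl) (fun v hl _ => ?_) (fun v hl _ => ?_)
  · simp only [Real.rpow_one] at h
    linarith
  · simp only [sub_self, Real.rpow_zero, mul_one]
    have h1 := hin v
    have h2 : ‖adjoint T (r - gram (adjoint T) v)‖ ≤ 1 * ‖r - gram (adjoint T) v‖ :=
      ContinuousLinearMap.le_of_opNorm_le _ (by rwa [LinearIsometryEquiv.norm_map]) _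
    set σ := ‖r - gram (adjoint T) v‖
    have h3 := pow_le_pow_left₀ (norm_nonneg _) h2 2
    have hr := norm_nonneg r
    -- The extra `σ ^ 2` of an explicit step leaves `-σ (σ - 2 θ ‖r‖)`, which is negative because `θ
    -- < η / 2`. Implicit steps need the same condition, as there only `σ ≥ η / 2 * ‖r‖` is known.
    have h4 : η * ‖r‖ * ((η - 2 * θ) * ‖r‖) ≤ σ * (σ - 2 * θ * ‖r‖) :=
      mul_le_mul hl (by linarith) (mul_nonneg (by linarith) hr) (norm_nonneg _)
    have h5 : 0 ≤ η * (η / 2 - θ) * ‖r‖ ^ 2 :=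
      mul_nonneg (mul_nonneg hη0.le (by linarith)) (sq_nonneg _)
    nlinarith
  · simp only [sub_self, Real.rpow_zero, mul_one]
    have h1 := hin v
    set σ := ‖r - gram (adjoint T) v‖
    have hr := norm_nonneg r
    have h4 : η / 2 * ‖r‖ * ((η / 2 - θ) * ‖r‖) ≤ σ * (σ - θ * ‖r‖) :=
      mul_le_mul hl (by linarith) (mul_nonneg (by linarith) hr) (norm_nonneg _)
    nlinarith

/-- Interpolation between the source element and the image of an error. -/
lemma norm_le_of_source (A : X →L[𝕜] Y) {μ α : ℝ} (hμ0 : 0 < μ)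
    (hα : α = 1 / (1 + 2 * μ)) (ω : X) :
    ‖opPow (gram A) μ ω‖ ≤ ‖ω‖ ^ α * ‖A (opPow (gram A) μ ω)‖ ^ (1 - α) := by
  have hB := isPositive_gram A
  have h1α : 1 - α = 2 * μ / (1 + 2 * μ) := by rw [hα]; field_simp; ring
  -- Interpolation between the exponents `0` and `1/2 + μ`; at the latter, `‖B^(1/2) B^μ ω‖ = ‖A B^μ
  -- ω‖`.
  have h := norm_opPow_interpolation hB (b := 1 / 2 + μ) (θ := 1 - α) (by positivity)
    (by rw [h1α]; positivity) (by rw [hα]; linarith [show 0 < 1 / (1 + 2 * μ) by positivity]) ω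
  have hb : (1 - α) * (1 / 2 + μ) = μ := by rw [h1α]; field_simp
  rw [hb, sub_sub_cancel, ← opPow_apply_opPow hB (by norm_num) hμ0.le,
    norm_opPow_half_gram] at h
  exact h

/-- The constant in the growth bound for source elements. -/
noncomputable def sourceConst (Θ η : ℝ) : ℝ := 49 * (2 / (1 - Θ ^ 2) + 56 / η)

/-- Along an inner iteration for `T`, close to `A`, the source element `z` of the error with respect
to `A` is driven by `-B z` up to a small perturbation, where `B = A* A`. -/
lemma exists_source_dynamics {A T : X →L[𝕜] Y} {κ μ θ δ : ℝ} (hA : ‖A‖ ≤ 1)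
    (hT : ‖T‖ ≤ 1) (hκ0 : 0 ≤ κ) (hκ1 : κ ≤ 1 / 2) (hTA : ∀ h, ‖(T - A) h‖ ≤ κ * ‖A h‖)
    (hμ0 : 0 < μ) (hμ1 : μ ≤ 1 / 2) (hθ1 : θ ≤ 1) (hδ0 : 0 ≤ δ) {r : Y} {ω : X}
    (hres : ‖r + T (opPow (gram A) μ ω)‖ ≤ θ * ‖r‖)
    (hres' : ‖r + T (opPow (gram A) μ ω)‖ ≤ 2 * (δ + κ * ‖r‖)) :
    ∃ G : Y →L[𝕜] X, (∀ y, opPow (gram A) μ (G y) = adjoint T y) ∧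
      ∀ v, ‖r - gram (adjoint T) v‖ ≤ ‖r‖ → ∃ ξ : X, ‖ξ‖ ≤ 7 * (δ + κ * ‖r‖) ∧
        G (r - gram (adjoint T) v) = opPow (gram A) (1 / 2 - μ) ξ - gram A (ω + G v) ∧
        ‖r - gram (adjoint T) v‖ ≤ θ * ‖r‖ + ‖ω + G v‖ := by
  have hB := isPositive_gram A
  have hB1 : ‖gram A‖ ≤ 1 := by
    rw [norm_gram]
    exact mul_le_one₀ hA (norm_nonneg _) hA
  obtain ⟨V, hV, hVA, hVadj, hVhalf⟩ := exists_polar A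
  obtain ⟨Q, hQ, hQA⟩ := exists_factorization (T - A) A hκ0 hTA
  have hTeq : ∀ x, T x = A x + Q (A x) := fun x => by rw [hQA, sub_apply]; abel
  have hTadj : ∀ y, adjoint T y = adjoint A (y + adjoint Q y) := fun y => by
    refine ext_inner_right 𝕜 fun x => ?_
    rw [ContinuousLinearMap.adjoint_inner_left, ContinuousLinearMap.adjoint_inner_left, hTeq,
      inner_add_left, inner_add_right, ContinuousLinearMap.adjoint_inner_left]
  -- `T* = A* (1 + Q*)` and `A* = B^(1/2) V*`; taking `B^μ` out of `B^(1/2)` leaves this solution of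
  -- `B^μ G = T*`.
  obtain ⟨G, hGapp⟩ : ∃ G : Y →L[𝕜] X,
      ∀ y, G y = opPow (gram A) (1 / 2 - μ) (adjoint V (y + adjoint Q y)) :=
    ⟨opPow (gram A) (1 / 2 - μ) ∘L adjoint V ∘L (ContinuousLinearMap.id 𝕜 Y + adjoint Q),
      fun y => by simp only [ContinuousLinearMap.comp_apply, add_apply,
        ContinuousLinearMap.id_apply]⟩
  have hBG : ∀ y, opPow (gram A) μ (G y) = adjoint T y := fun y => by
    rw [hGapp, opPow_apply_opPow hB hμ0.le (by linarith), add_sub_cancel, hVhalf, hTadj]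
  refine ⟨G, hBG, fun v hu => ?_⟩
  rw [gram_adjoint_apply] at hu ⊢
  obtain ⟨e, he⟩ : ∃ e, e = opPow (gram A) μ (ω + G v) := ⟨_, rfl⟩
  obtain ⟨s, hs⟩ : ∃ s, s = r - T (adjoint T v) := ⟨_, rfl⟩
  obtain ⟨ν, hν⟩ : ∃ ν, ν = r + T (opPow (gram A) μ ω) := ⟨_, rfl⟩
  rw [← hν] at hres hres'
  rw [← hs] at hu ⊢
  have hTe : T e = ν - s := by rw [he, map_add, hBG, map_add, hs, hν]; abel
  have hTen : ‖T e‖ ≤ 2 * ‖r‖ := by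
    rw [hTe]
    have h1 := norm_sub_le ν s
    have h2 := mul_le_mul_of_nonneg_right hθ1 (norm_nonneg r)
    linarith
  have hQn' : ∀ y, ‖adjoint Q y‖ ≤ κ * ‖y‖ := fun y =>
    ContinuousLinearMap.le_of_opNorm_le _ (by rwa [LinearIsometryEquiv.norm_map]) y
  have hQA' : ‖Q (A e)‖ ≤ κ * ‖A e‖ := Q.le_of_opNorm_le hQ _
  have hAe : ‖A e‖ ≤ 4 * ‖r‖ := by
    have h1 : A e = T e - Q (A e) := by rw [hTeq]; abel
    have h2 := norm_sub_le (T e) (Q (A e))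
    rw [← h1] at h2
    have h3 := mul_le_mul_of_nonneg_right hκ1 (norm_nonneg (A e))
    linarith
  -- From `s = ν - A e - Q A e` follows `(1 + Q*) s = (ν - Q A e + Q* s) - A e`. The bracket is
  -- small, and `V* A e = B^(1/2) e` produces `-B z` for `z = ω + G v`. The factor `7` is `2` from
  -- `ν` plus `4` and `1` from the two terms with `Q`.
  refine ⟨adjoint V (ν - Q (A e) + adjoint Q s), ?_, ?_, ?_⟩
  · have h0 : ‖adjoint V (ν - Q (A e) + adjoint Q s)‖ ≤ 1 * ‖ν - Q (A e) + adjoint Q s‖ :=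
      ContinuousLinearMap.le_of_opNorm_le _ (by rwa [LinearIsometryEquiv.norm_map]) _
    have h1 := norm_add_le (ν - Q (A e)) (adjoint Q s)
    have h2 := norm_sub_le ν (Q (A e))
    have h4 := hQn' s
    have h5 := mul_le_mul_of_nonneg_left hAe hκ0
    have h6 := mul_le_mul_of_nonneg_left hu hκ0
    have h7 : ‖ν‖ + 5 * (κ * ‖r‖) ≤ 7 * (δ + κ * ‖r‖) := by
      have := mul_nonneg hκ0 (norm_nonneg r)
      have := norm_nonneg ν
      linarith
    linarith
  · have h1 : s + adjoint Q s = (ν - Q (A e) + adjoint Q s) - A e := by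
      have h2 : s = ν - (A e + Q (A e)) := by rw [← hTeq, hTe]; abel
      nth_rewrite 1 [h2]
      abel
    rw [hGapp, h1, map_sub (adjoint V) _ (A e), map_sub, hVadj,
      opPow_apply_opPow hB (by linarith) (by norm_num), he,
      opPow_apply_opPow hB (by linarith) hμ0.le]
    have h3 : 1 / 2 - μ + 1 / 2 + μ = (1 : ℝ) := by ring
    rw [h3, opPow_one hB]
  · have h1 : s = ν - T e := by rw [hTe]; abel
    have h3 : ‖T e‖ ≤ 1 * ‖e‖ := T.le_of_opNorm_le hT e
    have h4 := norm_opPow_apply_le hB hB1 hμ0.le (ω + G v)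
    rw [← he] at h4
    have h5 := norm_sub_le ν (T e)
    rw [← h1] at h5
    linarith

lemma two_mul_re_inner_source_le (A : X →L[𝕜] Y) {μ χ : ℝ} (hμ1 : μ ≤ 1 / 2) (z : X) {ξ : X}
    (hξ : ‖ξ‖ ≤ χ) :
    2 * RCLike.re ⟪z, opPow (gram A) (1 / 2 - μ) ξ - gram A z⟫_𝕜
      ≤ 2 * (χ * ‖opPow (gram A) (1 / 2 - μ) z‖) - 2 * ‖A z‖ ^ 2 := by
  have h1 : RCLike.re ⟪z, gram A z⟫_𝕜 = ‖A z‖ ^ 2 := by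
    rw [gram, ContinuousLinearMap.comp_apply, ContinuousLinearMap.adjoint_inner_right,
      inner_self_eq_norm_sq]
  have h2 : RCLike.re ⟪z, opPow (gram A) (1 / 2 - μ) ξ⟫_𝕜
      ≤ χ * ‖opPow (gram A) (1 / 2 - μ) z‖ := by
    rw [← inner_opPow_left (isPositive_gram A) (by linarith)]
    refine (re_inner_le_norm _ _).trans ?_
    rw [mul_comm]
    exact mul_le_mul_of_nonneg_right hξ (norm_nonneg _)
  rw [inner_sub_right, map_sub, h1]
  linarith

/-- The second-order cost of an explicit step. Its `2 Θ ^ 2 ‖A z‖ ^ 2` is paid for by the `-2 ‖A z‖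
^ 2` of `two_mul_re_inner_source_le`, with a surplus since `Θ < 1`. -/
lemma norm_sq_source_step_le {A : X →L[𝕜] Y} {Θ μ χ : ℝ} (hA : ‖A‖ ≤ Θ) (hΘ : Θ ≤ 1)
    (hμ1 : μ ≤ 1 / 2) (z : X) {ξ : X} (hξ : ‖ξ‖ ≤ χ) :
    ‖opPow (gram A) (1 / 2 - μ) ξ - gram A z‖ ^ 2 ≤ 2 * χ ^ 2 + 2 * Θ ^ 2 * ‖A z‖ ^ 2 := by
  have hB1 : ‖gram A‖ ≤ 1 := by
    rw [norm_gram]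
    exact mul_le_one₀ (hA.trans hΘ) (norm_nonneg _) (hA.trans hΘ)
  have h3 : ‖opPow (gram A) (1 / 2 - μ) ξ - gram A z‖ ≤ χ + Θ * ‖A z‖ := by
    refine (norm_sub_le _ _).trans (add_le_add ?_ ?_)
    · exact (norm_opPow_apply_le (isPositive_gram A) hB1 (by linarith) ξ).trans hξ
    · exact ContinuousLinearMap.le_of_opNorm_le (adjoint A)
        (by rwa [LinearIsometryEquiv.norm_map]) _
  have h4 := pow_le_pow_left₀ (norm_nonneg _) h3 2
  nlinarith [sq_nonneg (χ - Θ * ‖A z‖)]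

lemma norm_opPow_half_sub_le (A : X →L[𝕜] Y) {μ : ℝ} (hμ0 : 0 < μ) (hμ1 : μ ≤ 1 / 2) (z : X) :
    ‖opPow (gram A) (1 / 2 - μ) z‖ ≤ ‖z‖ ^ (2 * μ) * ‖A z‖ ^ (1 - 2 * μ) := by
  have h := norm_opPow_interpolation (isPositive_gram A) (b := 1 / 2) (θ := 1 - 2 * μ)
    (by norm_num) (by linarith) (by linarith) z
  rwa [sub_sub_cancel, show (1 - 2 * μ) * (1 / 2) = 1 / 2 - μ by ring,
    norm_opPow_half_gram] at h

/-- Brings the remaining `χ ^ 2` of an explicit step into the form of the Young bound. -/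
lemma sq_le_rpow_mul_rpow {χ z L α : ℝ} (hχ0 : 0 ≤ χ) (hz : 0 ≤ z) (hL : 1 ≤ L) (hχz : χ ≤ L * z)
    (hα0 : 1 / 2 ≤ α) (hα1 : α ≤ 1) : χ ^ 2 ≤ L * (χ ^ (2 * α) * (z ^ 2) ^ (1 - α)) := by
  have h7 : χ ^ 2 = χ ^ (2 * α) * χ ^ (2 * (1 - α)) := by
    rw [← Real.rpow_add_of_nonneg hχ0 (by linarith) (by linarith), ← Real.rpow_two]
    ring_nf
  have h8 : χ ^ (2 * (1 - α)) ≤ L * (z ^ 2) ^ (1 - α) := by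
    have h9 := Real.rpow_le_rpow hχ0 hχz (show 0 ≤ 2 * (1 - α) by linarith)
    rw [Real.mul_rpow (by linarith) hz] at h9
    have h10 : L ^ (2 * (1 - α)) ≤ L := by
      have := Real.rpow_le_rpow_of_exponent_le hL (show 2 * (1 - α) ≤ 1 by linarith)
      rwa [Real.rpow_one] at this
    rw [Real.rpow_mul hz, Real.rpow_two] at h9
    exact h9.trans (mul_le_mul_of_nonneg_right h10 (by positivity))
  rw [h7]
  have := mul_le_mul_of_nonneg_left h8 (show 0 ≤ χ ^ (2 * α) by positivity)
  linarith

lemma rpow_seven_mul_le {a p : ℝ} (ha : 0 ≤ a) (hp : p ≤ 2) : (7 * a) ^ p ≤ 49 * a ^ p := by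
  rw [Real.mul_rpow (by norm_num) ha]
  refine mul_le_mul_of_nonneg_right ?_ (by positivity)
  have h7 : (7 : ℝ) ^ p ≤ 7 ^ (2 : ℝ) := Real.rpow_le_rpow_of_exponent_le (by norm_num) hp
  rw [Real.rpow_two] at h7
  linarith

/-- Errors keep their source representation along inner paths, with controlled growth. -/
lemma InnerPath.exists_source {A T : X →L[𝕜] Y} {Θ κ μ α η θ δ t : ℝ} (hA : ‖A‖ ≤ Θ) (hΘ : Θ < 1)
    (hT : ‖T‖ ≤ 1) (hκ0 : 0 ≤ κ) (hκ1 : κ ≤ 1 / 2) (hTA : ∀ h, ‖(T - A) h‖ ≤ κ * ‖A h‖)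
    (hμ0 : 0 < μ) (hμ1 : μ ≤ 1 / 2) (hα : α = 1 / (1 + 2 * μ))
    (hη0 : 0 < η) (hη1 : η < 1) (hθη : θ < η / 2) {r : Y} {v : Y} {ω : X}
    (hδ0 : 0 ≤ δ) (hδ : δ ≤ ‖r‖)
    (hres : ‖r + T (opPow (gram A) μ ω)‖ ≤ θ * ‖r‖)
    (hres' : ‖r + T (opPow (gram A) μ ω)‖ ≤ 2 * (δ + κ * ‖r‖))
    (hp : InnerPath (gram (adjoint T)) r η t v) :
    ∃ ω', opPow (gram A) μ ω + adjoint T v = opPow (gram A) μ ω' ∧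
      (‖ω'‖ ^ 2) ^ α ≤ (‖ω‖ ^ 2) ^ α
        + t * (sourceConst Θ η * (δ + κ * ‖r‖) ^ (2 * α)) := by
  have hΘ0 : 0 ≤ Θ := (norm_nonneg A).trans hA
  have hα0 : 0 < α := by rw [hα]; positivity
  have hα1 : α ≤ 1 := by rw [hα, div_le_one (by positivity)]; linarith
  have hαhalf : 1 / 2 ≤ α := by
    rw [hα, div_le_div_iff₀ (by norm_num) (by positivity)]; linarith
  obtain ⟨G, hBG, hmain⟩ := exists_source_dynamics (hA.trans hΘ.le) hT hκ0 hκ1 hTA hμ0 hμ1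
    (by linarith) hδ0 hres hres'
  have hκr : 0 ≤ κ * ‖r‖ := mul_nonneg hκ0 (norm_nonneg r)
  have hχpow := rpow_seven_mul_le (p := 2 * α) (add_nonneg hδ0 hκr) (by linarith)
  have hχr : 7 * (δ + κ * ‖r‖) ≤ 14 * ‖r‖ := by
    have := mul_le_mul_of_nonneg_right hκ1 (norm_nonneg r)
    linarith
  obtain ⟨χ, hχ⟩ : ∃ χ, χ = 7 * (δ + κ * ‖r‖) := ⟨_, rfl⟩
  have hχ0 : 0 ≤ χ := by rw [hχ]; positivity
  rw [← hχ] at hχpow hχr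
  simp only [← hχ] at hmain
  obtain ⟨k, hk⟩ : ∃ k, k = 1 - Θ ^ 2 := ⟨_, rfl⟩
  have hk0 : 0 < k := by rw [hk]; nlinarith
  have hk1 : k ≤ 1 := by rw [hk]; linarith [sq_nonneg Θ]
  obtain ⟨K, hK⟩ : ∃ K, K = sourceConst Θ η * (δ + κ * ‖r‖) ^ (2 * α) := ⟨_, rfl⟩
  have hKle : ∀ z : X, 2 * (1 / k * (χ ^ (2 * α) * (‖z‖ ^ 2) ^ (1 - α)))
      + 2 * (28 / η * (χ ^ (2 * α) * (‖z‖ ^ 2) ^ (1 - α))) ≤ K * (‖z‖ ^ 2) ^ (1 - α) := fun z => by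
    have h1 := mul_le_mul_of_nonneg_left hχpow (show 0 ≤ 2 / k + 56 / η by positivity)
    have h2 := mul_le_mul_of_nonneg_right h1 (show 0 ≤ (‖z‖ ^ 2) ^ (1 - α) by positivity)
    rw [hK, sourceConst, ← hk]
    refine Eq.trans_le ?_ (h2.trans_eq ?_) <;> ring
  have hK0 : 0 ≤ K := by
    rw [hK, sourceConst, ← hk]; positivity
  have hyoung : ∀ z : X, χ * ‖opPow (gram A) (1 / 2 - μ) z‖ - k * ‖A z‖ ^ 2
      ≤ 1 / k * (χ ^ (2 * α) * (‖z‖ ^ 2) ^ (1 - α)) := fun z =>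
    mul_sub_mul_sq_le hχ0 (norm_nonneg z) (norm_nonneg _) hk0 hk1 hμ0 hμ1 hα
      (norm_opPow_half_sub_le A hμ0 hμ1 z)
  rw [← hK]
  have hfin := hp.energy G ω hα0 hα1 (Or.inl hK0) (fun v hl hu => ?_) (fun v _ hu => ?_)
  · exact ⟨ω + G v, by rw [map_add, hBG], hfin⟩
  · obtain ⟨ξ, hξ, hGs, hσ⟩ := hmain v hu
    rw [hGs]
    generalize ω + G v = z at hσ ⊢
    have h1 := two_mul_re_inner_source_le A hμ1 z hξ
    have h2 := hyoung z
    have h3 := norm_sq_source_step_le hA hΘ.le hμ1 z hξ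
    -- Before stopping, `η ‖r‖ ≤ ‖s‖ ≤ θ ‖r‖ + ‖z‖` forces `‖z‖ ≥ η / 2 * ‖r‖`, while `χ ≤ 14 ‖r‖`.
    have hχz : χ ≤ 28 / η * ‖z‖ := by
      rw [div_mul_eq_mul_div, le_div_iff₀ hη0]
      have h7 : η / 2 * ‖r‖ ≤ ‖z‖ := by
        have := mul_le_mul_of_nonneg_right hθη.le (norm_nonneg r)
        linarith
      have := mul_le_mul_of_nonneg_right hχr hη0.le
      linarith
    have h6 := sq_le_rpow_mul_rpow hχ0 (norm_nonneg z)
      (by rw [le_div_iff₀ hη0]; linarith) hχz hαhalf hα1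
    refine le_trans ?_ (hKle z)
    rw [show Θ ^ 2 = 1 - k by rw [hk]; ring] at h3
    linarith
  · obtain ⟨ξ, hξ, hGs, -⟩ := hmain v hu
    rw [hGs]
    generalize ω + G v = z
    have h1 := two_mul_re_inner_source_le A hμ1 z hξ
    have h2 := hyoung z
    refine le_trans ?_ (hKle z)
    have h10 : 0 ≤ 28 / η * (χ ^ (2 * α) * (‖z‖ ^ 2) ^ (1 - α)) := by positivity
    have h11 := mul_le_mul_of_nonneg_right hk1 (sq_nonneg ‖A z‖)
    linarith

end NewtonStep

/-! ### The recursion for error and source norm over a whole run. -/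

section Recursion

/-- The potential `v / (v + E)` rises by at least a multiple of `t / (v + t)`: the drop `c t ρ ^ 2`
of `E` is weighed against `v + E ≤ (1 + C) v ρ`. So the increase of `log v` is paid for by the
potential. -/
lemma potential_step {v E E' t ρ c C : ℝ} (hv : 0 < v) (hE' : 0 ≤ E') (ht : 0 ≤ t) (hρ : 1 ≤ ρ)
    (hc : 0 < c) (hC : 0 < C) (hdec : E' + c * t * ρ ^ 2 ≤ E) (hEv : E ≤ C * v * ρ) :
    v + t ≤ v * Real.exp ((1 + C / c) * (1 + C) ^ 2 / c
      * ((v + t) / (v + t + E') - v / (v + E))) := by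
  have hinc : 0 ≤ c * t * ρ ^ 2 := by positivity
  have hE : 0 ≤ E := by linarith
  have hρ2 : ρ ≤ ρ ^ 2 := by nlinarith
  -- `c t ρ ^ 2 ≤ E ≤ C v ρ` with `ρ ≥ 1`; hence `v` and `v + t` are comparable.
  have htv : t ≤ C / c * v := by
    rw [div_mul_eq_mul_div, le_div_iff₀ hc]
    have h1 : c * t * ρ ^ 2 ≤ C * v * ρ ^ 2 := by
      have := mul_le_mul_of_nonneg_left hρ2 (show 0 ≤ C * v by positivity)
      linarith
    have h2 := le_of_mul_le_mul_right h1 (by positivity)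
    linarith
  have hy : c / (1 + C) ^ 2 * (t / (v + t)) ≤ (v + t) / (v + t + E') - v / (v + E) := by
    have hsum : v + E ≤ (1 + C) * v * ρ := by nlinarith
    have hsq : (v + E) ^ 2 ≤ ((1 + C) * v * ρ) ^ 2 :=
      pow_le_pow_left₀ (by positivity) hsum 2
    have hEE : E' ≤ E := by linarith
    rw [div_sub_div _ _ (by positivity) (by positivity), div_mul_div_comm,
      div_le_div_iff₀ (by positivity) (by positivity)]
    have hnum : v * (c * t * ρ ^ 2) ≤ (v + t) * (v + E) - (v + t + E') * v := by
      have h1 : v * (c * t * ρ ^ 2) ≤ v * (E - E') :=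
        mul_le_mul_of_nonneg_left (by linarith) hv.le
      have h2 := mul_nonneg ht hE
      linarith
    have hden : (v + t + E') * v ≤ (v + t) * (v + E) := by
      have h1 := mul_le_mul_of_nonneg_right hEE hv.le
      have h2 := mul_nonneg ht hE
      linarith
    have h3 : c * t * ((v + t + E') * (v + E)) * v
        ≤ v * (c * t * ρ ^ 2) * ((1 + C) ^ 2 * (v + t)) * v := by
      have h4 : c * t * ((v + t + E') * (v + E)) * v
          = c * t * (v + E) * ((v + t + E') * v) := by ring
      have h5 : c * t * (v + E) * ((v + t + E') * v) ≤ c * t * (v + E) * ((v + t) * (v + E)) :=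
        mul_le_mul_of_nonneg_left hden (by positivity)
      have h6 : c * t * (v + E) * ((v + t) * (v + E)) = c * t * (v + t) * (v + E) ^ 2 := by ring
      have h7 := mul_le_mul_of_nonneg_left hsq (show 0 ≤ c * t * (v + t) by positivity)
      rw [h4]
      refine h5.trans ?_
      rw [h6]
      refine h7.trans_eq ?_
      ring
    have h8 := le_of_mul_le_mul_right h3 hv
    refine h8.trans ?_
    exact mul_le_mul_of_nonneg_right hnum (by positivity)
  have hexp : t / v ≤ (1 + C / c) * (1 + C) ^ 2 / c
      * ((v + t) / (v + t + E') - v / (v + E)) := by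
    have h1 : t / v ≤ (1 + C / c) * (t / (v + t)) := by
      rw [mul_div_assoc', div_le_div_iff₀ hv (by positivity)]
      have := mul_le_mul_of_nonneg_left htv ht
      linarith
    have h2 := mul_le_mul_of_nonneg_left hy
      (show 0 ≤ (1 + C / c) * (1 + C) ^ 2 / c by positivity)
    have h3 : (1 + C / c) * (1 + C) ^ 2 / c * (c / (1 + C) ^ 2 * (t / (v + t)))
        = (1 + C / c) * (t / (v + t)) := by
      have : (1 + C) ≠ 0 := by positivity
      field_simp
    linarith
  have h1 := Real.add_one_le_exp (t / v)
  have h2 := Real.exp_le_exp.2 hexp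
  have h3 : v + t = v * (t / v + 1) := by field_simp; ring
  refine h3.trans_le ?_
  exact mul_le_mul_of_nonneg_left (h1.trans h2) hv.le

/-- The potential stays in `[0, 1]`, so the exponents gained in all steps sum to at most the
constant. -/
lemma bounded_of_potential {N : ℕ} {v E t ρ : ℕ → ℝ} {c C : ℝ} (hc : 0 < c) (hC : 0 < C)
    (hv0 : 0 < v 0) (hv : ∀ n < N, v (n + 1) = v n + t n) (ht : ∀ n < N, 0 ≤ t n)
    (hE : ∀ n ≤ N, 0 ≤ E n) (hρ : ∀ n < N, 1 ≤ ρ n)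
    (hdec : ∀ n < N, E (n + 1) + c * t n * ρ n ^ 2 ≤ E n)
    (hEv : ∀ n < N, E n ≤ C * v n * ρ n) :
    v N ≤ v 0 * Real.exp ((1 + C / c) * (1 + C) ^ 2 / c) := by
  set k := (1 + C / c) * (1 + C) ^ 2 / c with hk
  have hk0 : 0 ≤ k := by positivity
  have key : ∀ n ≤ N, 0 < v n ∧
      v n ≤ v 0 * Real.exp (k * (v n / (v n + E n) - v 0 / (v 0 + E 0))) := by
    intro n
    induction n with
    | zero => simp [hv0]
    | succ n ih =>
      intro hn
      obtain ⟨hpos, hle⟩ := ih (by omega)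
      have hstep := potential_step hpos (hE (n + 1) hn) (ht n hn) (hρ n hn) hc hC (hdec n hn)
        (hEv n hn)
      rw [← hv n hn, ← hk] at hstep
      refine ⟨by rw [hv n hn]; linarith [ht n hn], ?_⟩
      have h1 := mul_le_mul_of_nonneg_right hle
        (Real.exp_pos (k * (v (n + 1) / (v (n + 1) + E (n + 1)) - v n / (v n + E n)))).le
      rw [mul_assoc, ← Real.exp_add, ← mul_add] at h1
      refine (hstep.trans h1).trans_eq ?_
      congr 3
      ring
  obtain ⟨hpos, hle⟩ := key N le_rfl
  refine hle.trans (mul_le_mul_of_nonneg_left (Real.exp_le_exp.2 ?_) hv0.le)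
  have h1 : v N / (v N + E N) ≤ 1 := by
    have := hE N le_rfl
    rw [div_le_one (by linarith)]; linarith
  have h2 : 0 ≤ v 0 / (v 0 + E 0) := by
    have := hE 0 (Nat.zero_le _)
    positivity
  nlinarith

lemma add_rpow_le_four_mul {a b p : ℝ} (ha : 0 ≤ a) (hb : 0 ≤ b) (hp0 : 0 ≤ p) (hp2 : p ≤ 2) :
    (a + b) ^ p ≤ 4 * a ^ p + 4 * b ^ p := by
  have h4 : (2 : ℝ) ^ p ≤ 4 := by
    have := Real.rpow_le_rpow_of_exponent_le (x := 2) (by norm_num) hp2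
    rw [Real.rpow_two] at this
    linarith
  have key : ∀ x y : ℝ, 0 ≤ x → 0 ≤ y → x ≤ y → (x + y) ^ p ≤ 4 * y ^ p := fun x y hx hy hxy => by
    have h1 := Real.rpow_le_rpow (by positivity) (show x + y ≤ 2 * y by linarith) hp0
    rw [Real.mul_rpow (by norm_num) hy] at h1
    exact h1.trans (mul_le_mul_of_nonneg_right h4 (by positivity))
  have ha' : 0 ≤ a ^ p := by positivity
  have hb' : 0 ≤ b ^ p := by positivity
  rcases le_total a b with h | h
  · linarith [key a b ha hb h]
  · have := key b a hb ha h
    rw [add_comm] at this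
    linarith

/-- Makes the nonlinear growth telescope: by concavity `E ^ α` drops by at least `α E ^ (α - 1) c t
ρ ^ 2`, and one factor `E` of `E ^ α` is traded for `C w ρ ^ (2 (1 - α))`. -/
lemma dissipation_le {E E' w t ρ c C α : ℝ} (hE : 0 ≤ E) (hE' : 0 ≤ E') (ht : 0 ≤ t) (hρ : 0 < ρ)
    (hc : 0 < c) (hα0 : 0 < α) (hα1 : α ≤ 1)
    (hdec : E' + c * t * ρ ^ 2 ≤ E) (hEw : E ≤ C * w * ρ ^ (2 * (1 - α))) :
    t * (E ^ α * ρ ^ (2 * α)) ≤ C / (α * c) * (w * (E ^ α - E' ^ α)) := by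
  rcases hE.eq_or_lt with rfl | hEpos
  · have h1 : 0 ≤ c * t * ρ ^ 2 := by positivity
    have h2 : E' = 0 := by linarith
    rw [h2, Real.zero_rpow hα0.ne']
    simp
  have htan := rpow_le_tangent hEpos hE' hα0.le hα1
  have hpow : 0 < E ^ (α - 1) := by positivity
  have h1 : α * c * (t * ρ ^ 2 * E ^ (α - 1)) ≤ E ^ α - E' ^ α := by
    have := mul_le_mul_of_nonneg_left (show c * t * ρ ^ 2 ≤ E - E' by linarith)
      (mul_pos hα0 hpow).le
    nlinarith
  have hρpow : ρ ^ (2 * (1 - α)) * ρ ^ (2 * α) = ρ ^ 2 := by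
    rw [← Real.rpow_add hρ, ← Real.rpow_two]
    ring_nf
  have h2 : E ^ α * ρ ^ (2 * α) ≤ C * w * (ρ ^ 2 * E ^ (α - 1)) := by
    have h3 : E ^ α = E * E ^ (α - 1) := by
      rw [mul_comm, ← Real.rpow_add_one hEpos.ne']; simp
    have h4 := mul_le_mul_of_nonneg_right hEw
      (show 0 ≤ ρ ^ (2 * α) * E ^ (α - 1) by positivity)
    have h5 : C * w * ρ ^ (2 * (1 - α)) * (ρ ^ (2 * α) * E ^ (α - 1))
        = C * w * (ρ ^ 2 * E ^ (α - 1)) := by rw [← hρpow]; ring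
    rw [h3]
    linarith
  have hCw : 0 ≤ C * w := by
    have h3 : 0 < C * w * ρ ^ (2 * (1 - α)) := hEpos.trans_le hEw
    exact (pos_of_mul_pos_left h3 (by positivity)).le
  have h6 := mul_le_mul_of_nonneg_left h2 ht
  have h7 := mul_le_mul_of_nonneg_left h1 hCw
  have h8 : C / (α * c) * (w * (E ^ α - E' ^ α)) = C * w * (E ^ α - E' ^ α) / (α * c) := by
    field_simp
  rw [h8, le_div_iff₀ (by positivity)]
  have h9 := mul_le_mul_of_nonneg_right h6 (show 0 ≤ α * c by positivity)
  linarith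

/-- The constant in the uniform bound for source elements. -/
noncomputable def recursionConst (c C₁ C₂ α : ℝ) : ℝ :=
  Real.exp (4 * C₁ * C₂ / (α * c))
    * Real.exp ((1 + C₂ * Real.exp (4 * C₁ * C₂ / (α * c)) / (c / (4 * C₁)))
      * (1 + C₂ * Real.exp (4 * C₁ * C₂ / (α * c))) ^ 2 / (c / (4 * C₁)))

/-- Uniform boundedness of the source elements from energy dissipation, growth control and
interpolation. -/
lemma source_bounded {N : ℕ} {E w t ρ : ℕ → ℝ} {c C₁ C₂ K₀ δ α : ℝ} (hc : 0 < c) (hC₁ : 0 < C₁)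
    (hC₂ : 0 < C₂) (hK₀ : 0 ≤ K₀) (hδ : 0 < δ) (hα0 : 1 / 2 ≤ α) (hα1 : α ≤ 1)
    (hE : ∀ n ≤ N, 0 ≤ E n) (hw : ∀ n ≤ N, 0 ≤ w n) (ht : ∀ n < N, 0 < t n)
    (hρ : ∀ n < N, δ ≤ ρ n) (hdec : ∀ n < N, E (n + 1) + c * t n * ρ n ^ 2 ≤ E n)
    (hgrow : ∀ n < N, w (n + 1) ≤ w n
      + t n * (C₁ * (δ + K₀ * Real.sqrt (E n) * ρ n) ^ (2 * α)))
    (hEw : ∀ n < N, E n ≤ C₂ * w n * ρ n ^ (2 * (1 - α))) (hsmall : K₀ ^ 2 * E 0 ≤ 1) :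
    w N ≤ recursionConst c C₁ C₂ α * w 0 := by
  have hαpos : 0 < α := by linarith
  rcases Nat.eq_zero_or_pos N with rfl | hN
  · have h1 : 1 ≤ recursionConst c C₁ C₂ α := by
      rw [recursionConst, ← Real.exp_add, Real.one_le_exp_iff]
      positivity
    nlinarith [hw 0 le_rfl]
  -- If `w 0 = 0`, then `E 0 ≤ 0`, which the first step's positive dissipation excludes.
  have hw0 : 0 < w 0 := by
    refine (hw 0 (Nat.zero_le _)).lt_of_ne fun h0 => ?_
    have h1 := hEw 0 hN
    rw [← h0] at h1
    have h2 := hdec 0 hN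
    have h3 : 0 < ρ 0 := hδ.trans_le (hρ 0 hN)
    have h4 : 0 < c * t 0 * ρ 0 ^ 2 := mul_pos (mul_pos hc (ht 0 hN)) (by positivity)
    have h5 := hE 1 hN
    simp only [mul_zero, zero_mul] at h1
    rw [zero_add] at h2
    linarith
  set D := 4 * C₁ * C₂ / (α * c) with hD
  have hD0 : 0 < D := by positivity
  -- The growth caused by the nonlinearity is bounded by `D w_n (b_n - b_(n+1))`, and `b_0 ≤ 1`
  -- bounds the accumulated Gronwall exponent by `D`.
  set b : ℕ → ℝ := fun n => (K₀ ^ 2 * E n) ^ α with hb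
  have hb0 : ∀ n ≤ N, 0 ≤ b n := fun n hn =>
    Real.rpow_nonneg (mul_nonneg (sq_nonneg _) (hE n hn)) _
  have hb1 : b 0 ≤ 1 := Real.rpow_le_one (mul_nonneg (sq_nonneg _) (hE 0 (Nat.zero_le _)))
    hsmall hαpos.le
  have hstep : ∀ n < N, w (n + 1) ≤ w n + 4 * C₁ * δ ^ (2 * α) * t n
      + D * (w n * (b n - b (n + 1))) := by
    intro n hn
    have hEn := hE n hn.le
    have hρn : 0 < ρ n := hδ.trans_le (hρ n hn)
    have h1 := add_rpow_le_four_mul (a := δ) (b := K₀ * Real.sqrt (E n) * ρ n) (p := 2 * α) hδ.le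
      (by positivity) (by linarith) (by linarith)
    have h2 : (K₀ * Real.sqrt (E n) * ρ n) ^ (2 * α)
        = (K₀ ^ 2) ^ α * (E n ^ α * ρ n ^ (2 * α)) := by
      rw [Real.mul_rpow (by positivity) hρn.le, Real.mul_rpow hK₀ (Real.sqrt_nonneg _),
        Real.rpow_mul hK₀, Real.rpow_two, Real.rpow_mul (Real.sqrt_nonneg _), Real.rpow_two,
        Real.sq_sqrt hEn]
      ring
    have h3 := dissipation_le hEn (hE (n + 1) hn) (ht n hn).le hρn hc hαpos hα1 (hdec n hn)
      (hEw n hn)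
    have h4 : b n - b (n + 1) = (K₀ ^ 2) ^ α * (E n ^ α - E (n + 1) ^ α) := by
      simp only [hb]
      rw [Real.mul_rpow (sq_nonneg _) hEn, Real.mul_rpow (sq_nonneg _) (hE (n + 1) hn)]
      ring
    have h5 : D * (w n * (b n - b (n + 1)))
        = 4 * C₁ * (K₀ ^ 2) ^ α * (C₂ / (α * c) * (w n * (E n ^ α - E (n + 1) ^ α))) := by
      rw [h4, hD]
      ring
    have h6 := mul_le_mul_of_nonneg_left h3 (show 0 ≤ 4 * C₁ * (K₀ ^ 2) ^ α by positivity)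
    have h7 := mul_le_mul_of_nonneg_left h1 (mul_pos (ht n hn) hC₁).le
    rw [h2] at h7
    have h8 := hgrow n hn
    rw [h5]
    linarith
  -- The growth by noise alone, proportional to the total inner time; discrete Gronwall compares `w`
  -- with it.
  set v : ℕ → ℝ := fun n => w 0 + ∑ j ∈ Finset.range n, 4 * C₁ * δ ^ (2 * α) * t j with hv
  have hv0 : v 0 = w 0 := by simp [hv]
  have hvs : ∀ n, v (n + 1) = v n + 4 * C₁ * δ ^ (2 * α) * t n := fun n => by
    simp only [hv, Finset.sum_range_succ]
    ring
  have hgron : ∀ n ≤ N, w n ≤ Real.exp (D * (b 0 - b n)) * v n := by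
    intro n
    induction n with
    | zero => simp [hv0]
    | succ n ih =>
      intro hn
      have h1 := ih (by omega)
      have h2 := hstep n hn
      have hbn : b (n + 1) ≤ b n := by
        refine Real.rpow_le_rpow (mul_nonneg (sq_nonneg _) (hE (n + 1) hn)) ?_ hαpos.le
        refine mul_le_mul_of_nonneg_left ?_ (sq_nonneg _)
        have h3 := hdec n hn
        have h4 : 0 ≤ c * t n * ρ n ^ 2 := mul_nonneg (mul_pos hc (ht n hn)).le (sq_nonneg _)
        linarith
      have hbn0 : b (n + 1) ≤ b 0 := by
        have : b n ≤ b 0 := by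
          refine Real.rpow_le_rpow (mul_nonneg (sq_nonneg _) (hE n (by omega))) ?_ hαpos.le
          refine mul_le_mul_of_nonneg_left ?_ (sq_nonneg _)
          clear h1 h2 hbn ih
          induction n with
          | zero => exact le_rfl
          | succ n ih =>
            have h3 := hdec n (by omega)
            have h4 : 0 ≤ c * t n * ρ n ^ 2 :=
              mul_nonneg (mul_pos hc (ht n (by omega))).le (sq_nonneg _)
            linarith [ih (by omega)]
        exact hbn.trans this
      have h3 : 1 + D * (b n - b (n + 1)) ≤ Real.exp (D * (b n - b (n + 1))) := by
        linarith [Real.add_one_le_exp (D * (b n - b (n + 1)))]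
      have h4 : w n * (1 + D * (b n - b (n + 1)))
          ≤ Real.exp (D * (b 0 - b n)) * v n * Real.exp (D * (b n - b (n + 1))) := by
        have hpos : 0 ≤ 1 + D * (b n - b (n + 1)) := by nlinarith
        exact mul_le_mul h1 h3 hpos ((hw n (by omega)).trans h1)
      have h5 : Real.exp (D * (b 0 - b n)) * v n * Real.exp (D * (b n - b (n + 1)))
          = Real.exp (D * (b 0 - b (n + 1))) * v n := by
        rw [mul_right_comm, ← Real.exp_add]
        ring_nf
      have h6 : 1 ≤ Real.exp (D * (b 0 - b (n + 1))) :=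
        Real.one_le_exp (mul_nonneg hD0.le (by linarith))
      have h7 : 0 ≤ 4 * C₁ * δ ^ (2 * α) * t n := by
        have := (ht n hn).le
        positivity
      rw [hvs, mul_add]
      have h8 := mul_le_mul_of_nonneg_right h6 h7
      linarith
  have hexpD : ∀ n ≤ N, Real.exp (D * (b 0 - b n)) ≤ Real.exp D := fun n hn => by
    refine Real.exp_le_exp.2 ?_
    nlinarith [hb0 n hn]
  have hvpos : ∀ n ≤ N, 0 ≤ v n := fun n hn => by
    simp only [hv]
    refine add_nonneg hw0.le (Finset.sum_nonneg fun j hj => ?_)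
    have := (ht j ((Finset.mem_range.1 hj).trans_le hn)).le
    positivity
  have hwv : ∀ n ≤ N, w n ≤ Real.exp D * v n := fun n hn =>
    (hgron n hn).trans (mul_le_mul_of_nonneg_right (hexpD n hn) (hvpos n hn))
  have hδpow : 0 < δ ^ (2 * (1 - α)) := by positivity
  have hδ2 : δ ^ (2 * (1 - α)) * δ ^ (2 * α) = δ ^ 2 := by
    rw [← Real.rpow_add hδ, ← Real.rpow_two]
    ring_nf
  -- Rescaling by powers of `δ` removes `δ` from the constants. As `ρ / δ ≥ 1` and `2 (1 - α) ≤ 1`,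
  -- the power of `ρ / δ` may be replaced by `ρ / δ`.
  have hfin := bounded_of_potential (N := N) (v := v) (E := fun n => E n / δ ^ (2 * (1 - α)))
    (t := fun n => 4 * C₁ * δ ^ (2 * α) * t n) (ρ := fun n => ρ n / δ) (c := c / (4 * C₁))
    (C := C₂ * Real.exp D) (by positivity) (by positivity) (by rw [hv0]; exact hw0)
    (fun n _ => hvs n) (fun n hn => by have := (ht n hn).le; positivity)
    (fun n hn => div_nonneg (hE n hn) hδpow.le)
    (fun n hn => by rw [one_le_div hδ]; exact hρ n hn)
    (fun n hn => by
      have h1 : c / (4 * C₁) * (4 * C₁ * δ ^ (2 * α) * t n) * (ρ n / δ) ^ 2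
          = c * t n * ρ n ^ 2 / δ ^ (2 * (1 - α)) := by
        rw [div_pow, ← hδ2]
        field_simp
      rw [h1, ← add_div]
      exact div_le_div_of_nonneg_right (hdec n hn) hδpow.le)
    (fun n hn => by
      have hρn : 0 < ρ n := hδ.trans_le (hρ n hn)
      have hρδ : 1 ≤ ρ n / δ := by rw [one_le_div hδ]; exact hρ n hn
      have h1 : (ρ n / δ) ^ (2 * (1 - α)) ≤ ρ n / δ := by
        have := Real.rpow_le_rpow_of_exponent_le hρδ (show 2 * (1 - α) ≤ 1 by linarith)
        rwa [Real.rpow_one] at this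
      have h2 : E n / δ ^ (2 * (1 - α)) ≤ C₂ * w n * (ρ n / δ) ^ (2 * (1 - α)) := by
        rw [Real.div_rpow hρn.le hδ.le, mul_div_assoc']
        exact div_le_div_of_nonneg_right (hEw n hn) hδpow.le
      have h3 := mul_le_mul (mul_le_mul_of_nonneg_left (hwv n hn.le) hC₂.le) h1
        (by positivity) (mul_nonneg hC₂.le (mul_nonneg (Real.exp_pos D).le (hvpos n hn.le)))
      refine (h2.trans h3).trans_eq ?_
      ring)
  rw [hv0] at hfin
  have h1 := hwv N le_rfl
  have h2 := mul_le_mul_of_nonneg_left hfin (Real.exp_pos D).le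
  rw [recursionConst, ← hD]
  linarith

end Recursion

/-! ### The outer Newton iteration. -/

section Newton

variable {𝕜 X Y : Type*} [RCLike 𝕜]
  [NormedAddCommGroup X] [InnerProductSpace 𝕜 X]
  [NormedAddCommGroup Y] [InnerProductSpace 𝕜 Y]
  {D : Set X} {F : X → Y} {F' : X → X →L[𝕜] Y} {xd : X} {ρ K₀ Θ : ℝ}

/-- The linearization error under the Newton–Mysovskii condition. -/
lemma NewtonMysovskii.norm_linearization_le (hF : NewtonMysovskii D F F' xd ρ K₀ Θ) {x z : X}
    (hx : x ∈ closedBall xd ρ) (hz : z ∈ closedBall xd ρ) :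
    ‖F x - F z - F' z (x - z)‖ ≤ K₀ * ‖x - z‖ * ‖F' z (x - z)‖ := by
  let : InnerProductSpace ℝ X := InnerProductSpace.rclikeToReal 𝕜 X
  let : InnerProductSpace ℝ Y := InnerProductSpace.rclikeToReal 𝕜 Y
  have : IsScalarTower ℝ 𝕜 X := RestrictScalars.isScalarTower ℝ 𝕜 X
  have : IsScalarTower ℝ 𝕜 Y := RestrictScalars.isScalarTower ℝ 𝕜 Y
  set h := x - z with hh
  have hmem : ∀ s ∈ Icc (0 : ℝ) 1, z + s • h ∈ closedBall xd ρ := fun s hs =>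
    (convex_closedBall xd ρ).add_smul_sub_mem hz hx hs
  -- Mean value inequality along the segment, for `F` minus its linearization at `z`.
  have hderiv : ∀ s ∈ Icc (0 : ℝ) 1,
      HasDerivWithinAt (fun s : ℝ => F (z + s • h) - s • F' z h)
        (F' (z + s • h) h - F' z h) (Icc 0 1) s := by
    intro s hs
    have hp : HasDerivWithinAt (fun s : ℝ => z + s • h) h (Icc 0 1) s := by
      have := ((hasDerivAt_id s).smul_const h).const_add z
      rw [one_smul] at this
      exact this.hasDerivWithinAt
    have hFd := (hF.hasDeriv _ (hF.ball_subset (hmem s hs))).restrictScalars ℝ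
    have hc := hFd.comp_hasDerivWithinAt s hp fun s hs => hF.ball_subset (hmem s hs)
    have hl : HasDerivWithinAt (fun s : ℝ => s • F' z h) (F' z h) (Icc 0 1) s := by
      have := (hasDerivAt_id s).smul_const (F' z h)
      rw [one_smul] at this
      exact this.hasDerivWithinAt
    exact hc.sub hl
  have hbound : ∀ s ∈ Ico (0 : ℝ) 1, ‖F' (z + s • h) h - F' z h‖ ≤ K₀ * ‖h‖ * ‖F' z h‖ := by
    intro s hs
    have h1 := hF.bound _ (hmem s ⟨hs.1, hs.2.le⟩) z hz h
    rw [sub_apply, add_sub_cancel_left, norm_smul, Real.norm_eq_abs, abs_of_nonneg hs.1] at h1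
    refine h1.trans (mul_le_mul_of_nonneg_right ?_ (norm_nonneg _))
    refine mul_le_mul_of_nonneg_left ?_ hF.const_nonneg
    nlinarith [norm_nonneg h, hs.2]
  have := norm_image_sub_le_of_norm_deriv_le_segment' hderiv hbound 1 ⟨zero_le_one, le_rfl⟩
  simp only [one_smul, zero_smul, add_zero, sub_zero, mul_one] at this
  rw [hh, add_sub_cancel, ← hh] at this
  rw [sub_right_comm]
  exact this

/-- With `ν` the vector on the left, linearizing at `x` costs `κ ‖F' x (x - xd)‖ ≤ κ (‖yδ - F x‖ +
‖ν‖)`, where `κ = K₀ ‖x - xd‖`; the `ν` term is absorbed. -/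
lemma NewtonMysovskii.norm_residual_add_le (hF : NewtonMysovskii D F F' xd ρ K₀ Θ)
    {δ : ℝ} {yδ : Y} {x : X} (hx : x ∈ closedBall xd ρ) (hy : ‖yδ - F xd‖ ≤ δ) :
    (1 - K₀ * ‖x - xd‖) * ‖(yδ - F x) + F' x (x - xd)‖
      ≤ δ + K₀ * ‖x - xd‖ * ‖yδ - F x‖ := by
  have hxd : xd ∈ closedBall xd ρ := mem_closedBall_self hF.radius_pos.le
  have h1 := hF.norm_linearization_le hxd hx
  set ν := (yδ - F x) + F' x (x - xd) with hν
  have h2 : ν = (yδ - F xd) + (F xd - F x - F' x (xd - x)) := by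
    rw [hν, map_sub, map_sub]; abel
  have h3 : ‖F' x (xd - x)‖ ≤ ‖yδ - F x‖ + ‖ν‖ := by
    have h4 : F' x (xd - x) = (yδ - F x) - ν := by rw [hν, map_sub, map_sub]; abel
    rw [h4]
    exact norm_sub_le _ _
  have h5 : ‖ν‖ ≤ δ + K₀ * ‖x - xd‖ * ‖F' x (xd - x)‖ := by
    rw [norm_sub_rev xd x] at h1
    nth_rewrite 1 [h2]
    exact (norm_add_le _ _).trans (add_le_add hy h1)
  have h6 := mul_le_mul_of_nonneg_left h3 (mul_nonneg hF.const_nonneg (norm_nonneg (x - xd)))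
  linarith

/-- The relative noise and linearization level that is admitted in the inner iterations. -/
noncomputable def noiseLevel (τ η : ℝ) : ℝ := (1 / τ + η / 2) / 2

/-- The admissible size of `K₀ ‖x₀ - x†‖`. -/
noncomputable def smallness (τ η : ℝ) : ℝ := min ((1 - η) / 8) ((η / 2 - 1 / τ) / 4)

/-- The rate at which the squared error is dissipated. -/
noncomputable def dissipation (τ η : ℝ) : ℝ := η * (η / 2 - noiseLevel τ η)

section Parameters

variable {τ η : ℝ}

lemma one_div_lt_half (hτ : 2 < τ) (hτη : 2 < τ * η) : 1 / τ < η / 2 := by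
  rw [div_lt_div_iff₀ (by linarith) (by norm_num)]
  linarith

lemma smallness_pos (hτ : 2 < τ) (hη₁ : η < 1) (hτη : 2 < τ * η) : 0 < smallness τ η := by
  have := one_div_lt_half hτ hτη
  exact lt_min (by linarith) (by linarith)

lemma smallness_le (hη₀ : 0 < η) : smallness τ η ≤ 1 / 8 :=
  (min_le_left _ _).trans (by linarith)

lemma noiseLevel_lt (hτ : 2 < τ) (hτη : 2 < τ * η) : noiseLevel τ η < η / 2 := by
  have := one_div_lt_half hτ hτη
  rw [noiseLevel]
  linarith

lemma dissipation_pos (hτ : 2 < τ) (hη₀ : 0 < η) (hτη : 2 < τ * η) : 0 < dissipation τ η :=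
  mul_pos hη₀ (by linarith [noiseLevel_lt hτ hτη])

/-- `noiseLevel` is the midpoint of `1 / τ` and `η / 2`; a quarter of that gap is small enough to
add to `1 / τ` and then to divide by `1 - smallness`. -/
lemma add_smallness_le (hτ : 2 < τ) (hη₁ : η < 1) (hτη : 2 < τ * η) :
    1 / τ + smallness τ η ≤ noiseLevel τ η * (1 - smallness τ η) := by
  have h1 := one_div_lt_half hτ hτη
  have h2 : smallness τ η ≤ (η / 2 - 1 / τ) / 4 := min_le_right _ _
  have h3 := smallness_pos hτ hη₁ hτη
  have h4 := noiseLevel_lt hτ hτη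
  have h5 : noiseLevel τ η - 1 / τ = (η / 2 - 1 / τ) / 2 := by rw [noiseLevel]; ring
  nlinarith

end Parameters

section Step

variable {τ η δ : ℝ} {yδ : Y} {x : X}

lemma NewtonMysovskii.norm_residual_add_le_noiseLevel (hF : NewtonMysovskii D F F' xd ρ K₀ Θ)
    (hτ : 2 < τ) (hη₀ : 0 < η) (hη₁ : η < 1) (hτη : 2 < τ * η)
    (hx : x ∈ closedBall xd ρ) (hκ : K₀ * ‖x - xd‖ ≤ smallness τ η) (hy : ‖yδ - F xd‖ ≤ δ)
    (hcont : τ * δ < ‖yδ - F x‖) :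
    ‖(yδ - F x) + F' x (x - xd)‖ ≤ noiseLevel τ η * ‖yδ - F x‖ := by
  have h1 := hF.norm_residual_add_le hx hy
  have h2 := add_smallness_le hτ hη₁ hτη
  have h3 := smallness_le (τ := τ) hη₀
  have hδ : δ ≤ 1 / τ * ‖yδ - F x‖ := by
    rw [div_mul_eq_mul_div, le_div_iff₀ (by linarith)]
    linarith
  have hr := norm_nonneg (yδ - F x)
  have hnl : 0 ≤ noiseLevel τ η := by
    have : 0 < 1 / τ := by positivity
    rw [noiseLevel]; linarith
  set κ := K₀ * ‖x - xd‖
  have h4 : κ * ‖yδ - F x‖ ≤ smallness τ η * ‖yδ - F x‖ := mul_le_mul_of_nonneg_right hκ hr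
  have h5 : (1 / τ + smallness τ η) * ‖yδ - F x‖
      ≤ noiseLevel τ η * (1 - smallness τ η) * ‖yδ - F x‖ := mul_le_mul_of_nonneg_right h2 hr
  have h6 : noiseLevel τ η * (1 - smallness τ η) * ‖yδ - F x‖
      ≤ noiseLevel τ η * (1 - κ) * ‖yδ - F x‖ :=
    mul_le_mul_of_nonneg_right (mul_le_mul_of_nonneg_left (by linarith) hnl) hr
  have h7 : (1 - κ) * ‖(yδ - F x) + F' x (x - xd)‖
      ≤ (1 - κ) * (noiseLevel τ η * ‖yδ - F x‖) := by linarith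
  exact le_of_mul_le_mul_left h7 (by linarith)

end Step

variable [CompleteSpace X] [CompleteSpace Y]

open ContinuousLinearMap (adjoint)

section Step

variable {τ η δ : ℝ} {yδ : Y} {x : X}

/-- The inner stopping time of a Newton step. -/
def IsInnerStop (m : InnerScheme) (T : X →L[𝕜] Y) (r : Y) (η t : ℝ) : Prop :=
  IsLeast {s : ℝ | 0 < s ∧ ‖r - T (innerSolution m T r s)‖ ≤ η * ‖r‖} t

lemma NewtonMysovskii.norm_sq_add_le (hF : NewtonMysovskii D F F' xd ρ K₀ Θ) (hΘ : Θ < 1)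
    (hτ : 2 < τ) (hη₀ : 0 < η) (hη₁ : η < 1) (hτη : 2 < τ * η)
    (hx : x ∈ closedBall xd ρ) (hκ : K₀ * ‖x - xd‖ ≤ smallness τ η) (hy : ‖yδ - F xd‖ ≤ δ)
    (hcont : τ * δ < ‖yδ - F x‖) {t : ℝ} {v : Y}
    (hp : InnerPath (gram (adjoint (F' x))) (yδ - F x) η t v) :
    ‖x - xd + adjoint (F' x) v‖ ^ 2 + dissipation τ η * (t * ‖yδ - F x‖ ^ 2) ≤ ‖x - xd‖ ^ 2 :=
  hp.norm_sq_add_le ((hF.scaled x hx).trans hΘ.le) hη₀ (noiseLevel_lt hτ hτη)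
    (hF.norm_residual_add_le_noiseLevel hτ hη₀ hη₁ hτη hx hκ hy hcont)

/-- Dissipation bounds the length of every inner path, because the squared error cannot become
negative. -/
lemma NewtonMysovskii.exists_innerStop (hF : NewtonMysovskii D F F' xd ρ K₀ Θ) (hΘ : Θ < 1)
    (hτ : 2 < τ) (hη₀ : 0 < η) (hη₁ : η < 1) (hτη : 2 < τ * η) (hδ : 0 < δ)
    (hx : x ∈ closedBall xd ρ) (hκ : K₀ * ‖x - xd‖ ≤ smallness τ η) (hy : ‖yδ - F xd‖ ≤ δ)
    (hcont : τ * δ < ‖yδ - F x‖) (m : InnerScheme) :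
    ∃ t, IsInnerStop m (F' x) (yδ - F x) η t := by
  have hr : 0 < ‖yδ - F x‖ := lt_trans (by positivity) hcont
  have hT := (hF.scaled x hx).trans hΘ.le
  have hc := dissipation_pos hτ hη₀ hτη
  obtain ⟨t, ht⟩ := exists_isLeast_stoppingTimes (m := m)
    (isPositive_gram (adjoint (F' x))) (norm_gram_adjoint_le_one hT) hη₀ hη₁ (norm_pos_iff.1 hr)
    (L := ‖x - xd‖ ^ 2 / (dissipation τ η * ‖yδ - F x‖ ^ 2)) fun t v hp => by
      have h1 := hF.norm_sq_add_le hΘ hτ hη₀ hη₁ hτη hx hκ hy hcont hp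
      rw [le_div_iff₀ (by positivity)]
      nlinarith [sq_nonneg ‖x - xd + adjoint (F' x) v‖]
  refine ⟨t, ?_⟩
  rw [IsInnerStop, stoppingTimes_eq]
  exact ht

lemma NewtonMysovskii.innerPath (hF : NewtonMysovskii D F F' xd ρ K₀ Θ) (hΘ : Θ < 1)
    (hτ : 2 < τ) (hη₀ : 0 < η) (hη₁ : η < 1) (hδ : 0 < δ)
    (hx : x ∈ closedBall xd ρ) (hcont : τ * δ < ‖yδ - F x‖) {m : InnerScheme} {t : ℝ}
    (ht : IsInnerStop m (F' x) (yδ - F x) η t) :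
    ∃ v, innerSolution m (F' x) (yδ - F x) t = adjoint (F' x) v ∧
      InnerPath (gram (adjoint (F' x))) (yδ - F x) η t v := by
  have hr : 0 < ‖yδ - F x‖ := lt_trans (by positivity) hcont
  have hT := (hF.scaled x hx).trans hΘ.le
  refine ⟨_, innerSolution_eq m _ _ ht.1.1, ?_⟩
  rw [IsInnerStop, stoppingTimes_eq] at ht
  exact innerPath_of_isLeast (isPositive_gram _) (norm_gram_adjoint_le_one hT) hη₀ hη₁
    (norm_pos_iff.1 hr) ht

/-- One step of the inexact Newton method decreases the error and the residual. -/
lemma NewtonMysovskii.newton_step (hF : NewtonMysovskii D F F' xd ρ K₀ Θ) (hΘ : Θ < 1)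
    (hτ : 2 < τ) (hη₀ : 0 < η) (hη₁ : η < 1) (hτη : 2 < τ * η) (hδ : 0 < δ)
    (hx : x ∈ closedBall xd ρ) (hκ : K₀ * ‖x - xd‖ ≤ smallness τ η) (hy : ‖yδ - F xd‖ ≤ δ)
    (hcont : τ * δ < ‖yδ - F x‖) {m : InnerScheme} {t : ℝ}
    (ht : IsInnerStop m (F' x) (yδ - F x) η t) {x' : X}
    (hx' : x' = x + innerSolution m (F' x) (yδ - F x) t) :
    ‖x' - xd‖ ^ 2 + dissipation τ η * t * ‖yδ - F x‖ ^ 2 ≤ ‖x - xd‖ ^ 2 ∧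
      ‖x' - xd‖ ≤ ‖x - xd‖ ∧ ‖yδ - F x'‖ ≤ (1 + η) / 2 * ‖yδ - F x‖ := by
  obtain ⟨v, hv, hp⟩ := hF.innerPath hΘ hτ hη₀ hη₁ hδ hx hcont ht
  have hc := dissipation_pos hτ hη₀ hτη
  have h1 := hF.norm_sq_add_le hΘ hτ hη₀ hη₁ hτη hx hκ hy hcont hp
  have h2 : x - xd + adjoint (F' x) v = x' - xd := by rw [hx', hv]; abel
  rw [h2] at h1
  have ht0 : 0 < t := ht.1.1
  have hmono : ‖x' - xd‖ ≤ ‖x - xd‖ := by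
    refine le_of_sq_le_sq ?_ (norm_nonneg _)
    have : 0 ≤ dissipation τ η * (t * ‖yδ - F x‖ ^ 2) := by positivity
    linarith
  refine ⟨by linarith, hmono, ?_⟩
  set u := innerSolution m (F' x) (yδ - F x) t with hu
  set r := yδ - F x with hr
  have hxball : x' ∈ closedBall xd ρ := by
    rw [mem_closedBall, dist_eq_norm] at hx ⊢
    exact hmono.trans hx
  have hxx : x' - x = u := by rw [hx']; abel
  have hlin := hF.norm_linearization_le hxball hx
  rw [hxx] at hlin
  have hres : ‖r - F' x u‖ ≤ η * ‖r‖ := ht.1.2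
  have hTu : ‖F' x u‖ ≤ 2 * ‖r‖ := by
    have h3 : F' x u = r - (r - F' x u) := by abel
    rw [h3]
    have h4 := norm_sub_le r (r - F' x u)
    nlinarith [norm_nonneg r]
  have hun : ‖u‖ ≤ 2 * ‖x - xd‖ := by
    have h3 : u = (x' - xd) - (x - xd) := by rw [← hxx]; abel
    rw [h3]
    have h4 := norm_sub_le (x' - xd) (x - xd)
    linarith
  have hsm : smallness τ η ≤ (1 - η) / 8 := min_le_left _ _
  -- The linearization error is at most `(1 - η) / 2 * ‖r‖`; added to `η ‖r‖` this gives the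
  -- contraction factor `(1 + η) / 2`.
  have h5 : K₀ * ‖u‖ * ‖F' x u‖ ≤ (1 - η) / 4 * (2 * ‖r‖) := by
    refine mul_le_mul ?_ hTu (norm_nonneg _) (by linarith)
    have := mul_le_mul_of_nonneg_left hun hF.const_nonneg
    linarith
  have h6 : yδ - F x' = (r - F' x u) - (F x' - F x - F' x u) := by rw [hr]; abel
  rw [h6]
  have h7 := norm_sub_le (r - F' x u) (F x' - F x - F' x u)
  linarith

end Step

section Run

variable {τ η δ : ℝ} {yδ : Y} {x₀ : X}

lemma NewtonMysovskii.iterates (hF : NewtonMysovskii D F F' xd ρ K₀ Θ) (hΘ : Θ < 1)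
    (hτ : 2 < τ) (hη₀ : 0 < η) (hη₁ : η < 1) (hτη : 2 < τ * η) (hδ : 0 < δ)
    (hx₀ : x₀ ∈ closedBall xd ρ) (hκ : K₀ * ‖x₀ - xd‖ ≤ smallness τ η) (hy : ‖yδ - F xd‖ ≤ δ)
    {m : InnerScheme} {x : ℕ → X} {t : ℕ → ℝ} (hstart : x 0 = x₀) (n : ℕ)
    (hcont : ∀ k < n, τ * δ < ‖yδ - F (x k)‖)
    (hleast : ∀ k < n, IsInnerStop m (F' (x k)) (yδ - F (x k)) η (t k))
    (hstep : ∀ k < n, x (k + 1) = x k + innerSolution m (F' (x k)) (yδ - F (x k)) (t k)) :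
    x n ∈ closedBall xd ρ ∧ K₀ * ‖x n - xd‖ ≤ smallness τ η ∧
      ‖yδ - F (x n)‖ ≤ ((1 + η) / 2) ^ n * ‖yδ - F x₀‖ := by
  induction n with
  | zero => simpa [hstart] using ⟨hx₀, hκ⟩
  | succ n ih =>
    obtain ⟨h1, h2, h3⟩ := ih (fun k hk => hcont k (by omega)) (fun k hk => hleast k (by omega))
      (fun k hk => hstep k (by omega))
    obtain ⟨-, h4, h5⟩ := hF.newton_step hΘ hτ hη₀ hη₁ hτη hδ h1 h2 hy (hcont n (by omega))
      (hleast n (by omega)) (hstep n (by omega))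
    refine ⟨?_, (mul_le_mul_of_nonneg_left h4 hF.const_nonneg).trans h2, ?_⟩
    · rw [mem_closedBall, dist_eq_norm] at h1 ⊢
      exact h4.trans h1
    · rw [pow_succ', mul_assoc]
      exact h5.trans (mul_le_mul_of_nonneg_left h3 (by linarith))

lemma NewtonMysovskii.exists_run (hF : NewtonMysovskii D F F' xd ρ K₀ Θ) (hΘ : Θ < 1)
    (hτ : 2 < τ) (hη₀ : 0 < η) (hη₁ : η < 1) (hτη : 2 < τ * η) (hδ : 0 < δ)
    (hx₀ : x₀ ∈ closedBall xd ρ) (hκ : K₀ * ‖x₀ - xd‖ ≤ smallness τ η) (hy : ‖yδ - F xd‖ ≤ δ)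
    (m : InnerScheme) :
    ∃ (N : ℕ) (x : ℕ → X) (t : ℕ → ℝ), IsRun m D F F' τ η δ yδ x₀ N x t := by
  classical
  -- The default `0` makes the iteration total; `hleast` shows that it is not used before the
  -- discrepancy principle stops.
  have hex : ∀ z : X, ∃ t, (∃ t, IsInnerStop m (F' z) (yδ - F z) η t) →
      IsInnerStop m (F' z) (yδ - F z) η t := fun z => by
    by_cases h : ∃ t, IsInnerStop m (F' z) (yδ - F z) η t
    · exact ⟨h.choose, fun _ => h.choose_spec⟩
    · exact ⟨0, fun h' => absurd h' h⟩
  choose T hT using hex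
  set x : ℕ → X := fun n =>
    Nat.rec x₀ (fun _ z => z + innerSolution m (F' z) (yδ - F z) (T z)) n with hx
  have hstep : ∀ n, x (n + 1)
      = x n + innerSolution m (F' (x n)) (yδ - F (x n)) (T (x n)) := fun n => rfl
  have hleast : ∀ n, (∀ k < n, τ * δ < ‖yδ - F (x k)‖) →
      ∀ k < n, IsInnerStop m (F' (x k)) (yδ - F (x k)) η (T (x k)) := by
    intro n
    induction n with
    | zero => exact fun _ k hk => absurd hk (Nat.not_lt_zero k)
    | succ n ih =>
      intro hcont k hk
      have ih' := ih fun k hk => hcont k (by omega)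
      rcases Nat.lt_succ_iff_lt_or_eq.1 hk with hk' | rfl
      · exact ih' k hk'
      · obtain ⟨h1, h2, -⟩ := hF.iterates hΘ hτ hη₀ hη₁ hτη hδ hx₀ hκ hy (x := x)
          (t := fun n => T (x n)) rfl k (fun j hj => hcont j (by omega)) ih'
          (fun j _ => hstep j)
        exact hT _ (hF.exists_innerStop hΘ hτ hη₀ hη₁ hτη hδ h1 h2 hy (hcont k hk) m)
  have hend : ∃ n, ‖yδ - F (x n)‖ ≤ τ * δ := by
    by_contra hno
    push Not at hno
    have hτδ : 0 < τ * δ := by positivity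
    have hlim : Filter.Tendsto (fun n : ℕ => ((1 + η) / 2) ^ n * ‖yδ - F x₀‖) Filter.atTop
        (nhds (0 * ‖yδ - F x₀‖)) :=
      (tendsto_pow_atTop_nhds_zero_of_lt_one (by linarith) (by linarith)).mul_const _
    rw [zero_mul] at hlim
    obtain ⟨n, hn⟩ := (hlim.eventually (gt_mem_nhds hτδ)).exists
    have h1 := (hF.iterates hΘ hτ hη₀ hη₁ hτη hδ hx₀ hκ hy (x := x)
      (t := fun n => T (x n)) rfl n (fun k _ => hno k) (hleast n fun k _ => hno k)
      (fun k _ => hstep k)).2.2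
    linarith [hno n]
  have hcont : ∀ n < Nat.find hend, τ * δ < ‖yδ - F (x n)‖ := fun n hn =>
    not_le.1 (Nat.find_min hend hn)
  refine ⟨Nat.find hend, x, fun n => T (x n), rfl, fun n hn => hF.ball_subset ?_, hcont,
    Nat.find_spec hend, hleast _ hcont, fun n _ => hstep n⟩
  exact (hF.iterates hΘ hτ hη₀ hη₁ hτη hδ hx₀ hκ hy (x := x) (t := fun n => T (x n)) rfl n
    (fun k hk => hcont k (by omega)) (hleast n fun k hk => hcont k (by omega))
    (fun k _ => hstep k)).1

/-- Logarithmic bound for the number of outer iterations. -/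
lemma NewtonMysovskii.run_length_le (hF : NewtonMysovskii D F F' xd ρ K₀ Θ) (hΘ : Θ < 1)
    (hτ : 2 < τ) (hη₀ : 0 < η) (hη₁ : η < 1) (hτη : 2 < τ * η) (hδ : 0 < δ)
    (hx₀ : x₀ ∈ closedBall xd ρ) (hκ : K₀ * ‖x₀ - xd‖ ≤ smallness τ η) (hy : ‖yδ - F xd‖ ≤ δ)
    {m : InnerScheme} {N : ℕ} {x : ℕ → X} {t : ℕ → ℝ}
    (hrun : IsRun m D F F' τ η δ yδ x₀ N x t) :
    (N : ℝ) ≤ (1 + (Real.log (1 + ‖F xd - F x₀‖) + 1) / -Real.log ((1 + η) / 2))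
      * (1 + |Real.log δ|) := by
  set q := (1 + η) / 2 with hq
  have hq0 : 0 < q := by rw [hq]; linarith
  have hq1 : q < 1 := by rw [hq]; linarith
  have hlq : 0 < -Real.log q := by linarith [Real.log_neg hq0 hq1]
  set a := ‖F xd - F x₀‖ with ha
  have ha0 : 0 ≤ a := norm_nonneg _
  have hla : 0 ≤ Real.log (1 + a) := Real.log_nonneg (by linarith)
  have hld := abs_nonneg (Real.log δ)
  rcases Nat.eq_zero_or_pos N with rfl | hN
  · rw [Nat.cast_zero]
    have : 0 ≤ (Real.log (1 + a) + 1) / -Real.log q := by positivity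
    exact mul_nonneg (by linarith) (by linarith)
  -- The last index before stopping still has residual above `τ δ`, while the residuals decay
  -- geometrically.
  obtain ⟨k, rfl⟩ : ∃ k, N = k + 1 := ⟨N - 1, by omega⟩
  have h1 := (hF.iterates hΘ hτ hη₀ hη₁ hτη hδ hx₀ hκ hy hrun.start k
    (fun j hj => hrun.continues j (by omega)) (fun j hj => hrun.inner_stop j (by omega))
    (fun j hj => hrun.step j (by omega))).2.2
  have h2 := hrun.continues k (by omega)
  have h3 : ‖yδ - F x₀‖ ≤ δ + a := by
    have h4 : yδ - F x₀ = (yδ - F xd) + (F xd - F x₀) := by abel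
    rw [h4]
    exact (norm_add_le _ _).trans (add_le_add hy le_rfl)
  have h5 : δ < q ^ k * (δ + a) := by
    have h6 := mul_le_mul_of_nonneg_left h3 (pow_pos hq0 k).le
    nlinarith
  have h7 := Real.log_lt_log hδ h5
  rw [Real.log_mul (by positivity) (by positivity), Real.log_pow] at h7
  have h8 : Real.log (δ + a) ≤ Real.log δ + |Real.log δ| + Real.log (1 + a) := by
    rcases le_total 0 (Real.log δ) with hl | hl
    · have hδ1 : 1 ≤ δ := by
        by_contra hlt
        exact absurd hl (not_le.2 (Real.log_neg hδ (not_le.1 hlt)))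
      have h9 : Real.log (δ + a) ≤ Real.log (δ * (1 + a)) :=
        Real.log_le_log (by positivity) (by nlinarith)
      rw [Real.log_mul (by positivity) (by positivity)] at h9
      linarith
    · have hδ1 : δ ≤ 1 := (Real.log_nonpos_iff hδ.le).1 hl
      have h9 : Real.log (δ + a) ≤ Real.log (1 + a) :=
        Real.log_le_log (by positivity) (by linarith)
      rw [abs_of_nonpos hl]
      linarith
  have h9 : (k : ℝ) * -Real.log q ≤ (Real.log (1 + a) + 1) * (1 + |Real.log δ|) := by
    nlinarith
  have h10 : (k : ℝ) ≤ (Real.log (1 + a) + 1) / -Real.log q * (1 + |Real.log δ|) := by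
    rw [div_mul_eq_mul_div, le_div_iff₀ hlq]
    exact h9
  push_cast
  linarith

end Run

section Rates

variable {τ η δ : ℝ} {yδ : Y} {x₀ : X}

/-- The constant in the convergence rate. -/
noncomputable def rateConst (τ η Θ α : ℝ) : ℝ :=
  Real.sqrt (recursionConst (dissipation τ η) (sourceConst Θ η) 4 α)
    * (2 * (τ + 1)) ^ (1 - α)

lemma rateConst_pos {Θ α : ℝ} (hτ : 2 < τ) : 0 < rateConst τ η Θ α :=
  mul_pos (Real.sqrt_pos.2 (mul_pos (Real.exp_pos _) (Real.exp_pos _)))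
    (Real.rpow_pos_of_pos (by linarith) _)

/-- Along a run the source elements of the errors stay bounded. -/
lemma NewtonMysovskii.exists_source_of_run (hF : NewtonMysovskii D F F' xd ρ K₀ Θ) (hΘ : Θ < 1)
    (hτ : 2 < τ) (hη₀ : 0 < η) (hη₁ : η < 1) (hτη : 2 < τ * η) (hδ : 0 < δ)
    (hx₀ : x₀ ∈ closedBall xd ρ) (hκ : K₀ * ‖x₀ - xd‖ ≤ smallness τ η) (hy : ‖yδ - F xd‖ ≤ δ)
    {μ α : ℝ} (hμ0 : 0 < μ) (hμ1 : μ ≤ 1 / 2) (hα : α = 1 / (1 + 2 * μ)) {ω : X}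
    (hω : x₀ - xd = opPow (gram (F' xd)) μ ω)
    {m : InnerScheme} {N : ℕ} {x : ℕ → X} {t : ℕ → ℝ}
    (hrun : IsRun m D F F' τ η δ yδ x₀ N x t) :
    ∃ ω', x N - xd = opPow (gram (F' xd)) μ ω' ∧
      (‖ω'‖ ^ 2) ^ α
        ≤ recursionConst (dissipation τ η) (sourceConst Θ η) 4 α * (‖ω‖ ^ 2) ^ α := by
  have hxd : xd ∈ closedBall xd ρ := mem_closedBall_self hF.radius_pos.le
  have hA := hF.scaled xd hxd
  have hΘ0 : 0 ≤ Θ := (norm_nonneg _).trans hA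
  have hα0 : 1 / 2 ≤ α := by
    rw [hα, div_le_div_iff₀ (by norm_num) (by positivity)]; linarith
  have hα1 : α ≤ 1 := by rw [hα, div_le_one (by positivity)]; linarith
  have hε : smallness τ η ≤ 1 / 2 := (smallness_le hη₀).trans (by norm_num)
  have hiter : ∀ n ≤ N, x n ∈ closedBall xd ρ ∧ K₀ * ‖x n - xd‖ ≤ smallness τ η := fun n hn => by
    obtain ⟨h1, h2, -⟩ := hF.iterates hΘ hτ hη₀ hη₁ hτη hδ hx₀ hκ hy hrun.start n
      (fun j hj => hrun.continues j (by omega)) (fun j hj => hrun.inner_stop j (by omega))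
      (fun j hj => hrun.step j (by omega))
    exact ⟨h1, h2⟩
  have hδr : ∀ n < N, δ ≤ ‖yδ - F (x n)‖ := fun n hn => by
    have := hrun.continues n hn
    nlinarith
  have hν : ∀ n < N, ‖(yδ - F (x n)) + F' (x n) (x n - xd)‖
      ≤ noiseLevel τ η * ‖yδ - F (x n)‖ := fun n hn =>
    hF.norm_residual_add_le_noiseLevel hτ hη₀ hη₁ hτη (hiter n hn.le).1 (hiter n hn.le).2 hy
      (hrun.continues n hn)
  have hTA : ∀ n ≤ N, ∀ h, ‖(F' (x n) - F' xd) h‖ ≤ K₀ * ‖x n - xd‖ * ‖F' xd h‖ := fun n hn h =>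
    hF.bound _ (hiter n hn).1 xd hxd h
  -- Hypotheses placed under the existential let `choose` give a total function, from which the
  -- source elements are built recursively.
  have hexists : ∀ n ω, ∃ ω', n < N → x n - xd = opPow (gram (F' xd)) μ ω →
      x (n + 1) - xd = opPow (gram (F' xd)) μ ω' ∧
      (‖ω'‖ ^ 2) ^ α ≤ (‖ω‖ ^ 2) ^ α + t n * (sourceConst Θ η
        * (δ + K₀ * ‖x n - xd‖ * ‖yδ - F (x n)‖) ^ (2 * α)) := by
    intro n ω
    by_cases hn : n < N
    swap
    · exact ⟨0, fun h => absurd h hn⟩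
    by_cases hω : x n - xd = opPow (gram (F' xd)) μ ω
    swap
    · exact ⟨0, fun _ h => absurd h hω⟩
    obtain ⟨hxn, hκn⟩ := hiter n hn.le
    obtain ⟨v, hv, hp⟩ := hF.innerPath hΘ hτ hη₀ hη₁ hδ hxn (hrun.continues n hn)
      (hrun.inner_stop n hn)
    have hres := hν n hn
    have hres' : ‖(yδ - F (x n)) + F' (x n) (x n - xd)‖
        ≤ 2 * (δ + K₀ * ‖x n - xd‖ * ‖yδ - F (x n)‖) := by
      have h1 := hF.norm_residual_add_le hxn hy
      have h2 : 1 / 2 * ‖(yδ - F (x n)) + F' (x n) (x n - xd)‖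
          ≤ (1 - K₀ * ‖x n - xd‖) * ‖(yδ - F (x n)) + F' (x n) (x n - xd)‖ :=
        mul_le_mul_of_nonneg_right (by linarith) (norm_nonneg _)
      linarith
    rw [hω] at hres hres'
    obtain ⟨ω', h1, h2⟩ := hp.exists_source hA hΘ ((hF.scaled _ hxn).trans hΘ.le)
      (mul_nonneg hF.const_nonneg (norm_nonneg (x n - xd))) (hκn.trans hε) (hTA n hn.le) hμ0 hμ1
      hα hη₀ hη₁ (noiseLevel_lt hτ hτη) hδ.le (hδr n hn) hres (by rw [hω]; exact hres')
    refine ⟨ω', fun _ _ => ⟨?_, h2⟩⟩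
    rw [← h1, hrun.step n hn, hv, ← hω]
    abel
  choose g hg using hexists
  set s : ℕ → X := fun n => Nat.rec ω (fun n w => g n w) n with hs
  have hsource : ∀ n ≤ N, x n - xd = opPow (gram (F' xd)) μ (s n) := by
    intro n
    induction n with
    | zero => intro _; rw [hrun.start]; exact hω
    | succ n ih => exact fun hn => (hg n (s n) (by omega) (ih (by omega))).1
  refine ⟨s N, hsource N le_rfl, ?_⟩
  refine source_bounded (N := N) (E := fun n => ‖x n - xd‖ ^ 2) (w := fun n => (‖s n‖ ^ 2) ^ α)
    (t := t) (ρ := fun n => ‖yδ - F (x n)‖) (K₀ := K₀) (δ := δ) (dissipation_pos hτ hη₀ hτη)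
    ?_ (by norm_num) hF.const_nonneg hδ hα0 hα1 (fun _ _ => sq_nonneg _)
    (fun _ _ => by positivity) (fun n hn => (hrun.inner_stop n hn).1.1) hδr (fun n hn => ?_)
    (fun n hn => ?_) (fun n hn => ?_) ?_
  · have : 0 < 1 - Θ ^ 2 := by nlinarith
    rw [sourceConst]
    positivity
  · exact (hF.newton_step hΘ hτ hη₀ hη₁ hτη hδ (hiter n hn.le).1 (hiter n hn.le).2 hy
      (hrun.continues n hn) (hrun.inner_stop n hn) (hrun.step n hn)).1
  · rw [Real.sqrt_sq (norm_nonneg _)]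
    exact (hg n (s n) hn (hsource n hn.le)).2
  · obtain ⟨hxn, hκn⟩ := hiter n hn.le
    -- Source of the constant `4` in the interpolation bound: `(4 ^ (1 - α)) ^ 2 ≤ 4` because `1 - α
    -- ≤ 1/2`.
    have hAe : ‖F' xd (x n - xd)‖ ≤ 4 * ‖yδ - F (x n)‖ := by
      have h1 : F' xd (x n - xd) = F' (x n) (x n - xd) - (F' (x n) - F' xd) (x n - xd) := by
        rw [sub_apply]; abel
      have h2 := norm_sub_le (F' (x n) (x n - xd)) ((F' (x n) - F' xd) (x n - xd))
      rw [← h1] at h2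
      have h3 := hTA n hn.le (x n - xd)
      have h4 : F' (x n) (x n - xd)
          = ((yδ - F (x n)) + F' (x n) (x n - xd)) - (yδ - F (x n)) := by abel
      have h5 := norm_sub_le ((yδ - F (x n)) + F' (x n) (x n - xd)) (yδ - F (x n))
      rw [← h4] at h5
      have h6 := hν n hn
      have h7 := noiseLevel_lt hτ hτη
      have h8 : K₀ * ‖x n - xd‖ * ‖F' xd (x n - xd)‖ ≤ 1 / 2 * ‖F' xd (x n - xd)‖ :=
        mul_le_mul_of_nonneg_right (hκn.trans hε) (norm_nonneg _)
      have h9 : noiseLevel τ η * ‖yδ - F (x n)‖ ≤ 1 * ‖yδ - F (x n)‖ :=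
        mul_le_mul_of_nonneg_right (by linarith) (norm_nonneg _)
      linarith
    have h1 := norm_le_of_source (F' xd) hμ0 hα (s n)
    rw [← hsource n hn.le] at h1
    have h2 := Real.rpow_le_rpow (norm_nonneg _) hAe (show 0 ≤ 1 - α by linarith)
    rw [Real.mul_rpow (by norm_num) (norm_nonneg _)] at h2
    have h3 := h1.trans (mul_le_mul_of_nonneg_left h2 (by positivity))
    have h4 := pow_le_pow_left₀ (norm_nonneg _) h3 2
    have h5 : (‖s n‖ ^ α * (4 ^ (1 - α) * ‖yδ - F (x n)‖ ^ (1 - α))) ^ 2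
        = (4 ^ (1 - α)) ^ 2 * ((‖s n‖ ^ 2) ^ α * ‖yδ - F (x n)‖ ^ (2 * (1 - α))) := by
      have h6 : (‖s n‖ ^ 2) ^ α = (‖s n‖ ^ α) ^ 2 := by
        rw [← Real.rpow_two, ← Real.rpow_two, ← Real.rpow_mul (norm_nonneg _),
          ← Real.rpow_mul (norm_nonneg _), mul_comm]
      have h7 : ‖yδ - F (x n)‖ ^ (2 * (1 - α)) = (‖yδ - F (x n)‖ ^ (1 - α)) ^ 2 := by
        rw [mul_comm, Real.rpow_mul (norm_nonneg _), Real.rpow_two]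
      rw [h6, h7]
      ring
    have h8 : ((4 : ℝ) ^ (1 - α)) ^ 2 ≤ 4 := by
      rw [← Real.rpow_two, ← Real.rpow_mul (by norm_num)]
      have := Real.rpow_le_rpow_of_exponent_le (x := 4) (by norm_num)
        (show (1 - α) * 2 ≤ 1 by linarith)
      rwa [Real.rpow_one] at this
    have h9 := mul_le_mul_of_nonneg_right h8
      (show 0 ≤ (‖s n‖ ^ 2) ^ α * ‖yδ - F (x n)‖ ^ (2 * (1 - α)) by positivity)
    rw [h5] at h4
    linarith
  · rw [hrun.start, ← mul_pow]
    have h1 : 0 ≤ K₀ * ‖x₀ - xd‖ := mul_nonneg hF.const_nonneg (norm_nonneg _)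
    have h2 : K₀ * ‖x₀ - xd‖ ≤ 1 := by linarith
    exact pow_le_one₀ h1 h2

/-- Order optimal convergence of the inexact Newton method. -/
lemma NewtonMysovskii.norm_run_sub_le (hF : NewtonMysovskii D F F' xd ρ K₀ Θ) (hΘ : Θ < 1)
    (hτ : 2 < τ) (hη₀ : 0 < η) (hη₁ : η < 1) (hτη : 2 < τ * η) (hδ : 0 < δ)
    (hx₀ : x₀ ∈ closedBall xd ρ) (hκ : K₀ * ‖x₀ - xd‖ ≤ smallness τ η) (hy : ‖yδ - F xd‖ ≤ δ)
    {μ α : ℝ} (hμ0 : 0 < μ) (hμ1 : μ ≤ 1 / 2) (hα : α = 1 / (1 + 2 * μ)) {ω : X}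
    (hω : x₀ - xd = opPow (gram (F' xd)) μ ω)
    {m : InnerScheme} {N : ℕ} {x : ℕ → X} {t : ℕ → ℝ}
    (hrun : IsRun m D F F' τ η δ yδ x₀ N x t) :
    ‖x N - xd‖ ≤ rateConst τ η Θ α * ‖ω‖ ^ α * δ ^ (1 - α) := by
  obtain ⟨ω', h1, h2⟩ := hF.exists_source_of_run hΘ hτ hη₀ hη₁ hτη hδ hx₀ hκ hy hμ0 hμ1 hα hω
    hrun
  have hα1 : α ≤ 1 := by rw [hα, div_le_one (by positivity)]; linarith
  have hxd : xd ∈ closedBall xd ρ := mem_closedBall_self hF.radius_pos.le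
  have hε : smallness τ η ≤ 1 / 2 := (smallness_le hη₀).trans (by norm_num)
  obtain ⟨h3, h4, -⟩ := hF.iterates hΘ hτ hη₀ hη₁ hτη hδ hx₀ hκ hy hrun.start N
    hrun.continues hrun.inner_stop hrun.step
  -- Noise and discrepancy give `(τ + 1) δ`; the linearization error is at most half the left side,
  -- hence the factor `2`.
  have hAe : ‖F' xd (x N - xd)‖ ≤ 2 * (τ + 1) * δ := by
    have h5 := hF.norm_linearization_le h3 hxd
    have h6 : F' xd (x N - xd) = (yδ - F xd) - (yδ - F (x N))
        - (F (x N) - F xd - F' xd (x N - xd)) := by abel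
    have h7 := norm_sub_le ((yδ - F xd) - (yδ - F (x N)))
      (F (x N) - F xd - F' xd (x N - xd))
    rw [← h6] at h7
    have h8 := norm_sub_le (yδ - F xd) (yδ - F (x N))
    have h9 := hrun.stops
    have h10 : K₀ * ‖x N - xd‖ * ‖F' xd (x N - xd)‖ ≤ 1 / 2 * ‖F' xd (x N - xd)‖ :=
      mul_le_mul_of_nonneg_right (h4.trans hε) (norm_nonneg _)
    linarith
  have hsource : ‖ω'‖ ^ α
      ≤ Real.sqrt (recursionConst (dissipation τ η) (sourceConst Θ η) 4 α) * ‖ω‖ ^ α := by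
    have h6 : ∀ z : X, (‖z‖ ^ 2) ^ α = (‖z‖ ^ α) ^ 2 := fun z => by
      rw [← Real.rpow_two, ← Real.rpow_two, ← Real.rpow_mul (norm_nonneg _),
        ← Real.rpow_mul (norm_nonneg _), mul_comm]
    rw [h6, h6] at h2
    have h7 := Real.le_sqrt_of_sq_le h2
    rwa [Real.sqrt_mul' _ (sq_nonneg _), Real.sqrt_sq (by positivity)] at h7
  have h5 := norm_le_of_source (F' xd) hμ0 hα ω'
  rw [← h1] at h5
  have h6 := Real.rpow_le_rpow (norm_nonneg _) hAe (show 0 ≤ 1 - α by linarith)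
  rw [Real.mul_rpow (by positivity) hδ.le] at h6
  refine h5.trans ((mul_le_mul hsource h6 (by positivity) (by positivity)).trans_eq ?_)
  rw [rateConst]
  ring

end Rates

end Newton

end InexactNewton

theorem theorem1 {𝕜 X Y : Type*} [RCLike 𝕜]
    [NormedAddCommGroup X] [InnerProductSpace 𝕜 X] [CompleteSpace X]
    [NormedAddCommGroup Y] [InnerProductSpace 𝕜 Y] [CompleteSpace Y]
    (τ η Θ : ℝ) (hτ : 2 < τ) (hη₀ : 0 < η) (hη₁ : η < 1) (hτη : 2 < τ * η) (hΘ : Θ < 1) :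
    ∃ ε : ℝ, 0 < ε ∧
      -- well-definedness and termination after `O(1 + |log δ|)` outer iterations
      (∀ (D : Set X) (F : X → Y) (F' : X → X →L[𝕜] Y) (xd : X) (ρ K₀ : ℝ),
        InexactNewton.NewtonMysovskii D F F' xd ρ K₀ Θ →
        ∀ x₀ ∈ Metric.closedBall xd ρ, K₀ * ‖x₀ - xd‖ ≤ ε →
        ∃ C : ℝ, ∀ (m : InexactNewton.InnerScheme) (δ : ℝ) (yδ : Y),
          0 < δ → ‖yδ - F xd‖ ≤ δ →
          (∃ (N : ℕ) (x : ℕ → X) (t : ℕ → ℝ),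
            InexactNewton.IsRun m D F F' τ η δ yδ x₀ N x t) ∧
          ∀ (N : ℕ) (x : ℕ → X) (t : ℕ → ℝ),
            InexactNewton.IsRun m D F F' τ η δ yδ x₀ N x t →
            (N : ℝ) ≤ C * (1 + |Real.log δ|)) ∧
      -- order optimal convergence rates
      (∀ μ : ℝ, 0 < μ → μ ≤ 1 / 2 →
        ∃ ε' C : ℝ, 0 < ε' ∧ 0 < C ∧
          ∀ (D : Set X) (F : X → Y) (F' : X → X →L[𝕜] Y) (xd : X) (ρ K₀ : ℝ),
          InexactNewton.NewtonMysovskii D F F' xd ρ K₀ Θ →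
          ∀ x₀ ∈ Metric.closedBall xd ρ, K₀ * ‖x₀ - xd‖ ≤ ε →
          ∀ ω ∈ (F' xd).kerᗮ,
            x₀ - xd = InexactNewton.opFun (fun l => l ^ μ) (InexactNewton.gram (F' xd)) ω →
            K₀ * ‖ω‖ ≤ ε' →
            ∀ (m : InexactNewton.InnerScheme) (δ : ℝ) (yδ : Y),
              0 < δ → ‖yδ - F xd‖ ≤ δ →
              ∀ (N : ℕ) (x : ℕ → X) (t : ℕ → ℝ),
                InexactNewton.IsRun m D F F' τ η δ yδ x₀ N x t →
                ‖x N - xd‖ ≤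
                  C * ‖ω‖ ^ (1 / (1 + 2 * μ)) * δ ^ (2 * μ / (1 + 2 * μ))) := by
  refine ⟨InexactNewton.smallness τ η, InexactNewton.smallness_pos hτ hη₁ hτη, ?_, ?_⟩
  · intro D F F' xd ρ K₀ hF x₀ hx₀ hκ
    -- The constant is the one of `run_length_le`; it depends on `η` and `‖F xd - F x₀‖` only.
    exact ⟨_, fun m δ yδ hδ hy => ⟨hF.exists_run hΘ hτ hη₀ hη₁ hτη hδ hx₀ hκ hy m,
      fun N x t hrun => hF.run_length_le hΘ hτ hη₀ hη₁ hτη hδ hx₀ hκ hy hrun⟩⟩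
  · intro μ hμ0 hμ1
    refine ⟨1, InexactNewton.rateConst τ η Θ (1 / (1 + 2 * μ)), one_pos,
      InexactNewton.rateConst_pos hτ, ?_⟩
    intro D F F' xd ρ K₀ hF x₀ hx₀ hκ ω _ hω _ m δ yδ hδ hy N x t hrun
    have h := hF.norm_run_sub_le hΘ hτ hη₀ hη₁ hτη hδ hx₀ hκ hy hμ0 hμ1 rfl hω hrun
    have hexp : 1 - 1 / (1 + 2 * μ) = 2 * μ / (1 + 2 * μ) := by field_simp; ring
    rwa [hexp] at h
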